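/- Proposition 4.1. Let $1<p\le 3$, let $\mathbb T=\mathbb R/2\pi\mathbb Z$ with Lebesgue measure, and let $\theta:\mathbb R\to\mathbb R$ be smooth with $\theta(x)=1$ for $|x|\le 1$ and $\theta(x)=0$ for $|x|\ge 2$. Let $(\Omega,\mathcal F,(\mathcal F_t)_{t\ge 0},P)$ be a filtered probability space, $W$ a standard real Brownian motion relative to $(\mathcal F_t)$ (that is, adapted, and with $W_t-W_s$ independent of $\mathcal F_s$ for $s\le t$), and let $u_0\in L^4(\Omega;L^2(\mathbb T))$ be $\mathcal F_0$-measurable. Consider the truncated equation $$ i\,du=\Delta u\circ dW_t+\Theta[u](t)\,|u|^{p-1}u\,dt,\qquad u(0)=u_0,\qquad \Theta[u](t)=\theta\bigl(\|\mathbf 1_{s<t}u(s)\|_{L^4_{s,x}}\bigr). \tag{1}$$ A solution of (1) in $L^4_{\omega,T,x}$ is a predictable $u\in L^4(\Omega\times[0,T]\times\mathbb T)$ that satisfies, for almost every $(t,\omega)\in[0,T]\times\Omega$, $$u(t)=e^{-iW_t\Delta}u_0-i\int_0^t e^{-i(W_t-W_s)\Delta}\,\Theta[u](s)|u(s)|^{p-1}u(s)\,ds$$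 as distributions on $\mathbb T$, where $e^{-ia\Delta}$ is the Fourier multiplier with symbol $e^{ik^2a}$, $k\in\mathbb Z$. For every $R\ge 0$ there is $T_0>0$, depending only on $R$ (and on the fixed $p$ and $\theta$), such that whenever $\|u_0\|_{L^4_\omega L^2_x}\le R$ and $0<T\le T_0$: (a) (1) has a solution $u$ in $L^4_{\omega,T,x}$, and it is unique up to equality almost everywhere on $[0,T]\times\Omega\times\mathbb T$; (b) almost surely, $u$ agrees for almost every $t\in[0,T]$ with a path $w\in C([0,T];L^2(\mathbb T))$ such that $w(0)=u_0$ and $\|w(t)\|_{L^2}=\|u_0\|_{L^2}$ for all $t\in[0,T]$; (c) if $\tau=\inf\{t\in(0,T]:\|\mathbf 1_{s<t}u(s)\|_{L^4_{s,x}}=1\}$, with $\inf\emptyset=\infty$, then $P(\tau<T)\le\frac12$. -/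

import Mathlib

open MeasureTheory ProbabilityTheory
open scoped NNReal ENNReal

noncomputable section

namespace WND

/-- The torus `ℝ / 2πℤ`, with Lebesgue measure `volume` of total mass `2π`. -/
abbrev Torus : Type := AddCircle (2 * Real.pi)

instance instTwoPiPos : Fact (0 < 2 * Real.pi) := ⟨Real.two_pi_pos⟩

instance instOneLeFour : Fact ((1 : ℝ≥0∞) ≤ 4) := ⟨by norm_num⟩

/-- Lebesgue measure on the time half-line `[0, ∞)`. -/
def timeMeasure : Measure ℝ≥0 := (volume : Measure ℝ).comap ((↑) : ℝ≥0 → ℝ)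

/-- `L^q(𝕋; ℂ)`. -/
abbrev LTorus (q : ℝ≥0∞) : Type := Lp ℂ q (volume : Measure Torus)

/-- `W` is a standard Brownian motion relative to the filtration `𝓕`: it is a Brownian motion,
it is adapted, and its increments after time `s` are independent of `𝓕 s`. -/
structure IsBrownianFor {Ω : Type*} {mΩ : MeasurableSpace Ω} (𝓕 : Filtration ℝ≥0 mΩ)
    (W : ℝ≥0 → Ω → ℝ) (P : Measure Ω) : Prop where
  isBrownian : IsBrownianReal W P
  adapted : StronglyAdapted 𝓕 W
  indep : ∀ s t : ℝ≥0, s ≤ t →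
    Indep (𝓕 s) (MeasurableSpace.comap (fun ω => W t ω - W s ω) inferInstance) P

/-- A smooth cutoff function: `θ = 1` on `[-1, 1]` and `θ = 0` outside `(-2, 2)`. -/
structure IsCutoff (θ : ℝ → ℝ) : Prop where
  smooth : ContDiff ℝ ((⊤ : ℕ∞) : WithTop ℕ∞) θ
  eq_one : ∀ x : ℝ, |x| ≤ 1 → θ x = 1
  eq_zero : ∀ x : ℝ, 2 ≤ |x| → θ x = 0

variable {Ω : Type*}

/-- The measure `dt ⊗ dP` on `[0, T] × Ω`. -/
def timeProb [MeasurableSpace Ω] (T : ℝ≥0) (P : Measure Ω) : Measure (ℝ≥0 × Ω) :=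
  (timeMeasure.restrict (Set.Icc 0 T)).prod P

/-- The running norm `‖1_{s < t} u(s)‖_{L⁴_{s,x}}` along the path `ω`. -/
def runningNorm (u : ℝ≥0 → Ω → LTorus 4) (t : ℝ≥0) (ω : Ω) : ℝ≥0∞ :=
  eLpNorm (fun s => u s ω) 4 (timeMeasure.restrict (Set.Iio t))

/-- The truncation factor `Θ[u](t) = θ(‖1_{s < t} u(s)‖_{L⁴_{s,x}})`. For `u ∈ L⁴_{ω,T,x}` the
running norm is a.s. finite at all `t ≤ T`. -/
def truncation (θ : ℝ → ℝ) (u : ℝ≥0 → Ω → LTorus 4) (t : ℝ≥0) (ω : Ω) : ℝ :=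
  θ (runningNorm u t ω).toReal

/-- The truncated nonlinearity `Θ[u](t) |u(t, x)|^{p-1} u(t, x)`. -/
def nonlinearity (p : ℝ) (θ : ℝ → ℝ) (u : ℝ≥0 → Ω → LTorus 4) (t : ℝ≥0) (ω : Ω) (x : Torus) : ℂ :=
  (truncation θ u t ω : ℂ) * ((‖u t ω x‖ ^ (p - 1) : ℝ) : ℂ) * u t ω x

/-- The Fourier multiplier `e^{i k² a}` of the propagator `e^{-i a Δ}`. -/
def propagatorSymbol (a : ℝ) (k : ℤ) : ℂ := Complex.exp (Complex.I * (k : ℂ) ^ 2 * (a : ℂ))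

/-- `u` is a solution in `L⁴_{ω,T,x}` on `[0, T]` of
`i du = Δu ∘ dW + Θ[u] |u|^{p-1} u dt`, `u(0) = u₀`: it is predictable, it has finite
`L⁴([0, T] × Ω × 𝕋)` norm, and it satisfies the Duhamel formula
`u(t) = e^{-i W_t Δ} u₀ - i ∫₀ᵗ e^{-i (W_t - W_s) Δ} Θ[u](s) |u|^{p-1} u(s) ds`.
The formula is read on Fourier coefficients, which is an equality of distributions on `𝕋`
(the nonlinearity is in `L^{4/3}_x` only, where the propagator is not bounded). -/
structure IsTruncSolution [mΩ : MeasurableSpace Ω] (𝓕 : Filtration ℝ≥0 mΩ) (P : Measure Ω)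
    (W : ℝ≥0 → Ω → ℝ) (p : ℝ) (θ : ℝ → ℝ) (u₀ : Ω → LTorus 2) (T : ℝ≥0)
    (u : ℝ≥0 → Ω → LTorus 4) : Prop where
  predictable : IsStronglyPredictable 𝓕 u
  memLp : MemLp (Function.uncurry u) 4 (timeProb T P)
  duhamel : ∀ᵐ z : ℝ≥0 × Ω ∂(timeProb T P), ∀ k : ℤ,
    fourierCoeff (u z.1 z.2 : Torus → ℂ) k =
      propagatorSymbol (W z.1 z.2) k * fourierCoeff (u₀ z.2 : Torus → ℂ) k
        - Complex.I * ∫ s in Set.Icc (0 : ℝ≥0) z.1,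
            propagatorSymbol (W z.1 z.2 - W s z.2) k *
              fourierCoeff (nonlinearity p θ u s z.2) k ∂timeMeasure

/-- `τ = inf {t > 0 : ‖1_{s < t} u(s)‖_{L⁴_{s,x}} = 1}` for a process on `[0, T]`, with
`inf ∅ = ∞`. -/
def hittingTime (T : ℝ≥0) (u : ℝ≥0 → Ω → LTorus 4) (ω : Ω) : ℝ≥0∞ :=
  ⨅ t ∈ {t : ℝ≥0 | 0 < t ∧ t ≤ T ∧ runningNorm u t ω = 1}, (t : ℝ≥0∞)

/-- The path `t ↦ v(t)`, `t ∈ [0, T]`, of `L⁴(𝕋)`-valued functions agrees, up to a null set of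
times, with some `w ∈ C([0, T]; L²(𝕋))` with `w(0) = f` and `‖w(t)‖_{L²} = ‖f‖_{L²}` for
all `t ∈ [0, T]`. -/
def IsContinuousConservative (T : ℝ≥0) (f : LTorus 2) (v : ℝ≥0 → LTorus 4) : Prop :=
  ∃ w : ℝ≥0 → LTorus 2, ContinuousOn w (Set.Icc 0 T) ∧
    (∀ᵐ t : ℝ≥0 ∂(timeMeasure.restrict (Set.Icc 0 T)),
      (v t : Torus → ℂ) =ᵐ[volume] (w t : Torus → ℂ)) ∧
    w 0 = f ∧ ∀ t ∈ Set.Icc 0 T, ‖w t‖ = ‖f‖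

end WND

end

/-! ### Resonance sums and the fourth power of the `L⁴` norm. -/

noncomputable section
namespace WND

open ComplexConjugate

/-! Everything rests on a stochastic Strichartz inequality with a small constant,
`integral_solNorm_pow_le`. For finitely many frequencies, `‖u‖⁴` in `L⁴(𝕋)` is a sum of products
`d_k conj(d_l) conj(d_j) d_n` over `k + n = l + j` (`norm_trig_four_pow`), and on such a quadruple
the propagator contributes the single phase `exp(i m W_t)` with `m = 2(k-l)(k-j)`. Once the phases
are removed, the coefficients are absolutely continuous in time. The product rule therefore writes
the product at time `t` as a data term plus an integral over `s ≤ t` of `exp(i m (W_t - W_s))` times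
a source known at time `s` (`quadProd_amplitude`). The increment is independent of the past, so
taking the expectation turns the phase into `exp(-m²(t-s)/2)`, and integration in `t` leaves a
kernel bounded both by `T` and by `2/m²` (`integral_quadProd`).

Interpolating the two bounds gives `T^{1/4} |(k-l)(k-j)|^{-3/2}`, which is summable in `k-l` and in
`k-j`. The quadruples with `m = 0` do not oscillate, but their sum factors into the mass times the
pairing of forcing and solution (`norm_quarticForm_le`). Combined with the pathwise energy
inequality, this bounds the fourth moment of the `L⁴` norm by a small multiple of the fourth moments
of the data, of the forcing in `L^{4/3}`, and of the solution itself; the last is absorbed. Applied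
to blocks of high frequencies, the same inequality shows that Galerkin approximations are Cauchy,
which solves the linear problem (`exists_isLinearSolution`).

For `p ≤ 3` the power maps `L⁴` to `L^{4/3}` with at most cubic growth. The truncation keeps the
active part of every path below norm two, so the truncated nonlinearity is bounded and Lipschitz
from `L⁴` to `L^{4/3}` uniformly over all paths (`eLpNorm_pathForce_sub_le`). For small `T` the
Duhamel map is thus a contraction on predictable processes. Uniqueness follows because a process
with the Duhamel Fourier coefficients is itself a Galerkin limit, so that the contraction estimate
applies to it.

The pairing of the nonlinearity with `u` is real, so the mass of a Galerkin approximation changes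
only through its distance to `u`. This distance tends to zero along almost every path of a
subsequence, and the energy inequality on high frequencies upgrades the convergence to uniform
convergence in `L²`. The bound on the hitting time is Markov's inequality for the fourth moment of
the `L⁴` norm. -/

/-- The weight `⟨a⟩^{-3/2}` (equal to one at the origin) that controls the resonance sums. -/
def resWeight (a : ℤ) : ℝ := if a = 0 then 1 else |(a : ℝ)| ^ (-(3 / 2) : ℝ)

lemma resWeight_nonneg (a : ℤ) : 0 ≤ resWeight a := by
  unfold resWeight; split_ifs <;> positivity

lemma resWeight_zero : resWeight 0 = 1 := by simp [resWeight]

lemma summable_resWeight : Summable resWeight := by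
  have h : Summable fun a : ℤ => |(a : ℝ)| ^ (-(3 / 2) : ℝ) :=
    Real.summable_abs_int_rpow (by norm_num)
  have h2 : Summable fun a : ℤ => if a = 0 then (1 : ℝ) else 0 :=
    (hasSum_ite_eq (0 : ℤ) (1 : ℝ)).summable
  refine Summable.of_nonneg_of_le resWeight_nonneg (fun a => ?_) (h.add h2)
  unfold resWeight
  split_ifs
  · have : 0 ≤ |(a : ℝ)| ^ (-(3 / 2) : ℝ) := by positivity
    linarith
  · simp

/-- The sum of the weights. -/
def resConst : ℝ := ∑' a, resWeight a

lemma one_le_resConst : 1 ≤ resConst := by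
  have := summable_resWeight.le_tsum 0 (fun a _ => resWeight_nonneg a)
  rwa [resWeight_zero] at this

lemma sum_resWeight_sub_left (S : Finset ℤ) (k : ℤ) :
    ∑ j ∈ S, resWeight (k - j) ≤ resConst := by
  have h : ∑ j ∈ S, resWeight (k - j) = ∑ a ∈ S.map (Equiv.subLeft k).toEmbedding, resWeight a := by
    simp [Finset.sum_map]
  rw [h]
  exact summable_resWeight.sum_le_tsum _ (fun a _ => resWeight_nonneg a)

lemma sum_resWeight_sub_right (S : Finset ℤ) (l : ℤ) :
    ∑ k ∈ S, resWeight (k - l) ≤ resConst := by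
  have h : ∑ k ∈ S, resWeight (k - l) = ∑ a ∈ S.map (Equiv.subRight l).toEmbedding, resWeight a := by
    simp [Finset.sum_map]
  rw [h]
  exact summable_resWeight.sum_le_tsum _ (fun a _ => resWeight_nonneg a)

/-- A Schur test: `j` and `k` are summed while `l` is frozen, and each of the two sums costs one
factor `resConst` because the weights depend on differences only. -/
lemma sum_resWeight_mul_sq_le (S : Finset ℤ) (g : ℤ → ℝ) :
    ∑ k ∈ S, ∑ l ∈ S, ∑ j ∈ S, resWeight (k - l) * resWeight (k - j) * g l ^ 2 ≤
      resConst ^ 2 * ∑ l ∈ S, g l ^ 2 := by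
  have hc : 0 ≤ resConst := zero_le_one.trans one_le_resConst
  calc ∑ k ∈ S, ∑ l ∈ S, ∑ j ∈ S, resWeight (k - l) * resWeight (k - j) * g l ^ 2
      = ∑ k ∈ S, ∑ l ∈ S, resWeight (k - l) * g l ^ 2 * ∑ j ∈ S, resWeight (k - j) := by
        refine Finset.sum_congr rfl fun k _ => Finset.sum_congr rfl fun l _ => ?_
        rw [Finset.mul_sum]
        exact Finset.sum_congr rfl fun j _ => by ring
    _ ≤ ∑ k ∈ S, ∑ l ∈ S, resWeight (k - l) * g l ^ 2 * resConst := by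
        gcongr with k _ l _
        · exact mul_nonneg (resWeight_nonneg _) (sq_nonneg _)
        · exact sum_resWeight_sub_left S k
    _ = ∑ l ∈ S, g l ^ 2 * resConst * ∑ k ∈ S, resWeight (k - l) := by
        rw [Finset.sum_comm]
        refine Finset.sum_congr rfl fun l _ => ?_
        rw [Finset.mul_sum]
        exact Finset.sum_congr rfl fun k _ => by ring
    _ ≤ ∑ l ∈ S, g l ^ 2 * resConst * resConst := by
        gcongr with l _
        exact sum_resWeight_sub_right S l
    _ = resConst ^ 2 * ∑ l ∈ S, g l ^ 2 := by
        rw [Finset.mul_sum]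
        exact Finset.sum_congr rfl fun j _ => by ring

/-- The inequality `2 g_l g_j ≤ g_l² + g_j²` and the symmetry in `l` and `j` reduce this to the sum
with a square. -/
lemma sum_resWeight_mul_le (S : Finset ℤ) (g : ℤ → ℝ) :
    ∑ k ∈ S, ∑ l ∈ S, ∑ j ∈ S, resWeight (k - l) * resWeight (k - j) * (g l * g j) ≤
      resConst ^ 2 * ∑ l ∈ S, g l ^ 2 := by
  have h1 := sum_resWeight_mul_sq_le S g
  have h2 : ∑ k ∈ S, ∑ l ∈ S, ∑ j ∈ S, resWeight (k - l) * resWeight (k - j) * g j ^ 2 ≤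
      resConst ^ 2 * ∑ l ∈ S, g l ^ 2 := by
    refine le_of_eq_of_le (Finset.sum_congr rfl fun k _ => ?_) h1
    rw [Finset.sum_comm]
    exact Finset.sum_congr rfl fun l _ => Finset.sum_congr rfl fun j _ => by ring
  have h3 : ∑ k ∈ S, ∑ l ∈ S, ∑ j ∈ S, resWeight (k - l) * resWeight (k - j) * (g l * g j) ≤
      ∑ k ∈ S, ∑ l ∈ S, ∑ j ∈ S, ((1 / 2) * (resWeight (k - l) * resWeight (k - j) * g l ^ 2) +
        (1 / 2) * (resWeight (k - l) * resWeight (k - j) * g j ^ 2)) := by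
    gcongr with k _ l _ j _
    have : 0 ≤ resWeight (k - l) * resWeight (k - j) :=
      mul_nonneg (resWeight_nonneg _) (resWeight_nonneg _)
    nlinarith [mul_nonneg this (sq_nonneg (g l - g j))]
  simp only [Finset.sum_add_distrib, ← Finset.mul_sum] at h3
  linarith

/-- The quartic form `∑ κ(2(k-l)(k-j)) f_k conj(d_l) conj(d_j) d_n` over the resonant quadruples
`k + n = l + j` in `S`. -/
def quarticForm (S : Finset ℤ) (κ : ℤ → ℝ) (f d : ℤ → ℂ) : ℂ :=
  ∑ k ∈ S, ∑ l ∈ S, ∑ j ∈ S, ∑ n ∈ S,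
    if k + n = l + j then (κ (2 * (k - l) * (k - j)) : ℂ) * (f k * conj (d l) * conj (d j) * d n)
    else 0

/-- On the degenerate quadruples, `l = k` or `j = k`, the argument of `κ` vanishes and the sum
factors, so `f` enters only through its pairing with `d`. On the others the product weight is
summable, and the supremum of `f` suffices. This separation matters because a forcing in `L^{4/3}`
controls the pairing and the size of single coefficients, but no `ℓ²` norm. -/
lemma norm_quarticForm_le (S : Finset ℤ) (κ : ℤ → ℝ) {ε : ℝ} (hκ0 : |κ 0| ≤ ε)
    (hκ : ∀ a b : ℤ, a ≠ 0 → b ≠ 0 → |κ (2 * a * b)| ≤ ε * (resWeight a * resWeight b))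
    (f d : ℤ → ℂ) {φ δ : ℝ} (hf : ∀ k ∈ S, ‖f k‖ ≤ φ) (hφ : 0 ≤ φ) (hδ : 0 ≤ δ)
    (hd : ∑ k ∈ S, ‖d k‖ ^ 2 ≤ δ ^ 2) :
    ‖quarticForm S κ f d‖ ≤
      ε * (2 * ‖∑ k ∈ S, f k * conj (d k)‖ * δ ^ 2 + resConst ^ 2 * φ * δ ^ 3) := by
  have hε : 0 ≤ ε := (abs_nonneg _).trans hκ0
  -- The resonance fixes `n = l + j - k`; extension of `d` by zero removes the condition that this
  -- lies in `S`.
  set D : ℤ → ℂ := fun n => if n ∈ S then d n else 0 with hD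
  -- Both degenerate families are subtracted in full, so `l = j = k` is subtracted twice and leaves
  -- `-κ 0`, which is harmless since the weight is one there.
  set e : ℤ → ℤ → ℤ → ℝ := fun k l j => κ (2 * (k - l) * (k - j)) - (if l = k then κ 0 else 0)
    - (if j = k then κ 0 else 0) with he
  have he_le : ∀ k l j, |e k l j| ≤ ε * (resWeight (k - l) * resWeight (k - j)) := by
    intro k l j
    by_cases h1 : l = k
    · by_cases h2 : j = k
      · simp only [he, h1, h2, sub_self, mul_zero, if_true, zero_sub, abs_neg, resWeight_zero]
        simpa using hκ0
      · simp only [he, h1, h2, sub_self, mul_zero, zero_mul, if_true, if_false, abs_zero]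
        exact mul_nonneg hε (mul_nonneg (resWeight_nonneg _) (resWeight_nonneg _))
    · by_cases h2 : j = k
      · simp only [he, h1, h2, sub_self, mul_zero, if_true, if_false, sub_zero, abs_zero]
        exact mul_nonneg hε (mul_nonneg (resWeight_nonneg _) (resWeight_nonneg _))
      · simp only [he, h1, h2, if_false, sub_zero]
        exact hκ _ _ (sub_ne_zero.2 (Ne.symm h1)) (sub_ne_zero.2 (Ne.symm h2))
  have hsum : quarticForm S κ f d = ∑ k ∈ S, ∑ l ∈ S, ∑ j ∈ S,
      (κ (2 * (k - l) * (k - j)) : ℂ) * (f k * conj (d l) * conj (d j) * D (l + j - k)) := by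
    unfold quarticForm
    refine Finset.sum_congr rfl fun k _ => Finset.sum_congr rfl fun l _ =>
      Finset.sum_congr rfl fun j _ => ?_
    have : ∀ n : ℤ, (k + n = l + j) = (l + j - k = n) := fun n => by
      apply propext; constructor <;> intro h <;> linarith
    simp only [this, Finset.sum_ite_eq, hD]
    split_ifs <;> simp
  have hdd : ∑ j ∈ S, conj (d j) * d j = ((∑ j ∈ S, ‖d j‖ ^ 2 : ℝ) : ℂ) := by
    push_cast
    exact Finset.sum_congr rfl fun j _ => by rw [mul_comm, Complex.mul_conj']
  have hdiag : ∑ k ∈ S, ∑ j ∈ S, (κ 0 : ℂ) * (f k * conj (d k) * conj (d j) * d j) =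
      κ 0 * (∑ k ∈ S, f k * conj (d k)) * ((∑ j ∈ S, ‖d j‖ ^ 2 : ℝ) : ℂ) := by
    rw [← hdd, mul_assoc, Finset.sum_mul_sum, Finset.mul_sum]
    refine Finset.sum_congr rfl fun k _ => ?_
    rw [Finset.mul_sum]
    exact Finset.sum_congr rfl fun j _ => by ring
  have hsplit : quarticForm S κ f d =
      2 * (κ 0 * (∑ k ∈ S, f k * conj (d k)) * ((∑ j ∈ S, ‖d j‖ ^ 2 : ℝ) : ℂ)) +
      ∑ k ∈ S, ∑ l ∈ S, ∑ j ∈ S,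
        (e k l j : ℂ) * (f k * conj (d l) * conj (d j) * D (l + j - k)) := by
    have h1 : ∑ k ∈ S, ∑ l ∈ S, ∑ j ∈ S, ((if l = k then κ 0 else 0 : ℝ) : ℂ) *
        (f k * conj (d l) * conj (d j) * D (l + j - k)) =
        κ 0 * (∑ k ∈ S, f k * conj (d k)) * ((∑ j ∈ S, ‖d j‖ ^ 2 : ℝ) : ℂ) := by
      rw [← hdiag]
      refine Finset.sum_congr rfl fun k hk => ?_
      rw [Finset.sum_comm]
      refine Finset.sum_congr rfl fun j hj => ?_
      rw [Finset.sum_eq_single k]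
      · simp [hD, hj]
      · intro l _ hl; simp [hl]
      · intro h; exact absurd hk h
    have h2 : ∑ k ∈ S, ∑ l ∈ S, ∑ j ∈ S, ((if j = k then κ 0 else 0 : ℝ) : ℂ) *
        (f k * conj (d l) * conj (d j) * D (l + j - k)) =
        κ 0 * (∑ k ∈ S, f k * conj (d k)) * ((∑ j ∈ S, ‖d j‖ ^ 2 : ℝ) : ℂ) := by
      rw [← hdiag]
      refine Finset.sum_congr rfl fun k hk => ?_
      refine Finset.sum_congr rfl fun l hl => ?_
      rw [Finset.sum_eq_single k]
      · simp only [if_true, add_sub_cancel_right, hD, hl]; ring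
      · intro l _ hl; simp [hl]
      · intro h; exact absurd hk h
    rw [hsum, two_mul]
    nth_rewrite 1 [← h1]
    rw [← h2]
    simp only [← Finset.sum_add_distrib]
    refine Finset.sum_congr rfl fun k _ => Finset.sum_congr rfl fun l _ =>
      Finset.sum_congr rfl fun j _ => ?_
    simp only [he]
    push_cast
    ring
  have hDle : ∀ n, ‖D n‖ ≤ δ := by
    intro n
    simp only [hD]
    split_ifs with hn
    · refine abs_le_of_sq_le_sq' ?_ hδ |>.2
      exact (Finset.single_le_sum (f := fun k => ‖d k‖ ^ 2) (fun k _ => sq_nonneg _) hn).trans hd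
    · simpa using hδ
  have hrest : ‖∑ k ∈ S, ∑ l ∈ S, ∑ j ∈ S,
        (e k l j : ℂ) * (f k * conj (d l) * conj (d j) * D (l + j - k))‖ ≤
      ε * φ * δ * (resConst ^ 2 * ∑ l ∈ S, ‖d l‖ ^ 2) := by
    refine (norm_sum_le _ _).trans ?_
    refine le_trans ?_ (mul_le_mul_of_nonneg_left (sum_resWeight_mul_le S fun l => ‖d l‖)
      (by positivity))
    rw [Finset.mul_sum]
    refine Finset.sum_le_sum fun k hk => (norm_sum_le _ _).trans ?_
    rw [Finset.mul_sum]
    refine Finset.sum_le_sum fun l _ => (norm_sum_le _ _).trans ?_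
    rw [Finset.mul_sum]
    refine Finset.sum_le_sum fun j _ => ?_
    simp only [norm_mul, RCLike.norm_conj, Complex.norm_real, Real.norm_eq_abs]
    calc |e k l j| * (‖f k‖ * ‖d l‖ * ‖d j‖ * ‖D (l + j - k)‖)
        ≤ (ε * (resWeight (k - l) * resWeight (k - j))) * (φ * ‖d l‖ * ‖d j‖ * δ) := by
          gcongr
          · exact mul_nonneg hε (mul_nonneg (resWeight_nonneg _) (resWeight_nonneg _))
          · exact he_le k l j
          · exact hf k hk
          · exact hDle _
      _ = _ := by ring
  rw [hsplit]
  refine (norm_add_le _ _).trans ?_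
  have hpos : 0 ≤ ∑ j ∈ S, ‖d j‖ ^ 2 := Finset.sum_nonneg fun _ _ => sq_nonneg _
  have h1 : ‖2 * ((κ 0 : ℂ) * (∑ k ∈ S, f k * conj (d k)) * ((∑ j ∈ S, ‖d j‖ ^ 2 : ℝ) : ℂ))‖ ≤
      2 * (ε * ‖∑ k ∈ S, f k * conj (d k)‖ * δ ^ 2) := by
    rw [norm_mul, norm_mul, norm_mul, Complex.norm_real, Complex.norm_real, Real.norm_eq_abs,
      Real.norm_eq_abs, abs_of_nonneg hpos, Complex.norm_ofNat]
    gcongr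
  have h2 : ε * φ * δ * (resConst ^ 2 * ∑ l ∈ S, ‖d l‖ ^ 2) ≤
      ε * φ * δ * (resConst ^ 2 * δ ^ 2) := by gcongr
  linarith

/-- The `k`-th Fourier mode as an element of `L^q`. -/
def mode (q : ℝ≥0∞) [Fact (1 ≤ q)] (k : ℤ) : LTorus q :=
  ContinuousMap.toLp (E := ℂ) q (volume : Measure Torus) ℂ (fourier k)

/-- The trigonometric polynomial with frequencies in `S` and coefficients `d`. -/
def trig (q : ℝ≥0∞) [Fact (1 ≤ q)] (S : Finset ℤ) (d : ℤ → ℂ) : LTorus q :=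
  ∑ k ∈ S, d k • mode q k

lemma coeFn_mode (q : ℝ≥0∞) [Fact (1 ≤ q)] (k : ℤ) : mode q k =ᵐ[volume] fourier k :=
  ContinuousMap.coeFn_toLp _ _

lemma coeFn_trig (q : ℝ≥0∞) [Fact (1 ≤ q)] (S : Finset ℤ) (d : ℤ → ℂ) :
    trig q S d =ᵐ[volume] fun x => ∑ k ∈ S, d k * fourier k x := by
  unfold trig
  refine (Lp.coeFn_fun_finsetSum S _).trans ?_
  have : ∀ᵐ x : Torus ∂volume, ∀ k : ℤ, (d k • mode q k : LTorus q) x = d k * fourier k x := by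
    rw [ae_all_iff]
    intro k
    filter_upwards [Lp.coeFn_smul (d k) (mode q k), coeFn_mode q k] with x h1 h2
    rw [h1, Pi.smul_apply, h2, smul_eq_mul]
  filter_upwards [this] with x hx
  exact Finset.sum_congr rfl fun k _ => hx k

lemma integral_fourier (m : ℤ) :
    ∫ x : Torus, fourier m x = if m = 0 then (2 * Real.pi : ℂ) else 0 := by
  have h := fourierCoeff_fourier (T := 2 * Real.pi) m
  have h0 : fourierCoeff (fourier m : Torus → ℂ) 0 =
      (2 * Real.pi)⁻¹ • ∫ x : Torus, fourier m x := by
    rw [fourierCoeff, AddCircle.integral_haarAddCircle]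
    simp [-fourier_apply, fourier_zero]
  have hpi : (2 * Real.pi) ≠ 0 := by positivity
  have h1 : ∫ x : Torus, fourier m x = (2 * Real.pi) • fourierCoeff (fourier m : Torus → ℂ) 0 := by
    rw [h0, smul_inv_smul₀ hpi]
  rw [h1, h]
  by_cases hm : m = 0
  · subst hm; simp
  · simp [hm, Ne.symm hm]

lemma integrable_fourier_mul (m : ℤ) (c : ℂ) :
    Integrable (fun x : Torus => c * fourier m x) := by
  have : Continuous fun x : Torus => c * fourier m x := by fun_prop
  exact this.integrable_of_hasCompactSupport (HasCompactSupport.of_compactSpace _)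

lemma eLpNorm_four_pow {α E : Type*} [MeasurableSpace α] [NormedAddCommGroup E] (μ : Measure α)
    (f : α → E) : eLpNorm f 4 μ ^ 4 = ∫⁻ x, ‖f x‖ₑ ^ 4 ∂μ := by
  have := eLpNorm_nnreal_pow_eq_lintegral (μ := μ) (f := f) (p := 4) (by norm_num)
  norm_num at this
  rw [← this, ← ENNReal.rpow_natCast]

/-- The fourth power of the `L⁴` norm of a trigonometric polynomial. -/
lemma norm_trig_four_pow (S : Finset ℤ) (d : ℤ → ℂ) :
    ((‖trig 4 S d‖ ^ 4 : ℝ) : ℂ) = 2 * Real.pi * quarticForm S (fun _ => 1) d d := by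
  have h1 : ‖trig 4 S d‖ ^ 4 = ∫ x : Torus, ‖(trig 4 S d : Torus → ℂ) x‖ ^ 4 := by
    rw [Lp.norm_def, ← ENNReal.toReal_pow, eLpNorm_four_pow,
      integral_eq_lintegral_of_nonneg_ae (ae_of_all _ fun x => pow_nonneg (norm_nonneg _) 4)
        ((continuous_norm.pow 4).comp_aestronglyMeasurable (Lp.aestronglyMeasurable _))]
    congr 1
    refine lintegral_congr fun x => ?_
    rw [ENNReal.ofReal_pow (norm_nonneg _), ofReal_norm]
  rw [h1, integral_congr_ae (g := fun x => ‖∑ k ∈ S, d k * fourier k x‖ ^ 4)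
    (by filter_upwards [coeFn_trig 4 S d] with x hx; rw [hx]), ← integral_complex_ofReal]
  have h2 : ∀ x : Torus, ((‖∑ k ∈ S, d k * fourier k x‖ ^ 4 : ℝ) : ℂ) =
      ∑ k ∈ S, ∑ l ∈ S, ∑ j ∈ S, ∑ n ∈ S,
        (d k * conj (d l) * conj (d j) * d n) * fourier (k + n - l - j) x := by
    intro x
    set s := ∑ k ∈ S, d k * fourier k x with hs
    have : ((‖s‖ ^ 4 : ℝ) : ℂ) = s * conj s * conj s * s := by
      have := Complex.mul_conj' s
      calc ((‖s‖ ^ 4 : ℝ) : ℂ) = ((‖s‖ : ℂ) ^ 2) ^ 2 := by push_cast; ring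
        _ = _ := by rw [← this]; ring
    rw [this]
    have hc : conj s = ∑ k ∈ S, conj (d k) * fourier (-k) x := by
      rw [hs, map_sum]
      exact Finset.sum_congr rfl fun k _ => by rw [map_mul, fourier_neg]
    rw [hc, hs]
    simp only [Finset.sum_mul]
    refine Finset.sum_congr rfl fun k _ => ?_
    simp only [Finset.mul_sum, Finset.sum_mul]
    rw [Finset.sum_comm_cycle]
    refine Finset.sum_congr rfl fun l _ => ?_
    rw [Finset.sum_comm]
    refine Finset.sum_congr rfl fun j _ => ?_
    refine Finset.sum_congr rfl fun n _ => ?_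
    have : k + n - l - j = k + (-l) + (-j) + n := by ring
    rw [this, fourier_add, fourier_add, fourier_add]
    ring
  simp only [h2]
  have hintegrable : ∀ k l j n : ℤ, Integrable (fun x : Torus =>
      (d k * conj (d l) * conj (d j) * d n) * fourier (k + n - l - j) x) :=
    fun k l j n => integrable_fourier_mul _ _
  unfold quarticForm
  rw [integral_finsetSum _ fun k _ => integrable_finsetSum _ fun l _ => integrable_finsetSum _
    fun j _ => integrable_finsetSum _ fun n _ => hintegrable k l j n, Finset.mul_sum]
  refine Finset.sum_congr rfl fun k _ => ?_
  rw [integral_finsetSum _ fun l _ => integrable_finsetSum _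
    fun j _ => integrable_finsetSum _ fun n _ => hintegrable k l j n, Finset.mul_sum]
  refine Finset.sum_congr rfl fun l _ => ?_
  rw [integral_finsetSum _ fun j _ => integrable_finsetSum _ fun n _ => hintegrable k l j n,
    Finset.mul_sum]
  refine Finset.sum_congr rfl fun j _ => ?_
  rw [integral_finsetSum _ fun n _ => hintegrable k l j n, Finset.mul_sum]
  refine Finset.sum_congr rfl fun n _ => ?_
  rw [integral_const_mul, integral_fourier]
  have : (k + n - l - j = 0) = (k + n = l + j) := by
    apply propext; constructor <;> intro h <;> linarith
  simp only [this]
  split_ifs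
  · push_cast; ring
  · simp

end WND
end

/-! ### Product rule for indefinite integrals in time, and the decay kernel. -/

noncomputable section
namespace WND

open ComplexConjugate Set Filter Topology

lemma measurableEmbedding_coe_nnreal : MeasurableEmbedding ((↑) : ℝ≥0 → ℝ) :=
  MeasurableEmbedding.subtype_coe measurableSet_Ici

lemma timeMeasure_apply (A : Set ℝ≥0) : timeMeasure A = volume (((↑) : ℝ≥0 → ℝ) '' A) :=
  measurableEmbedding_coe_nnreal.comap_apply _ _

lemma coe_image_Icc (s t : ℝ≥0) : ((↑) : ℝ≥0 → ℝ) '' Icc s t = Icc (s : ℝ) t := by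
  ext x
  constructor
  · rintro ⟨y, ⟨h1, h2⟩, rfl⟩
    exact ⟨by exact_mod_cast h1, by exact_mod_cast h2⟩
  · rintro ⟨h1, h2⟩
    exact ⟨⟨x, s.2.trans h1⟩, ⟨h1, h2⟩, rfl⟩

lemma timeMeasure_Icc (s t : ℝ≥0) : timeMeasure (Icc s t) = ENNReal.ofReal (t - s) := by
  rw [timeMeasure_apply, coe_image_Icc, Real.volume_Icc]

lemma timeMeasure_Icc_zero (t : ℝ≥0) : timeMeasure (Icc 0 t) = t := by
  rw [timeMeasure_Icc]; simp

instance : NullSingletonClass timeMeasure :=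
  ⟨fun x => by rw [timeMeasure_apply, image_singleton, Real.volume_singleton]⟩

instance : IsLocallyFiniteMeasure timeMeasure := by
  refine ⟨fun x => ⟨Iio (x + 1), Iio_mem_nhds (by simp), ?_⟩⟩
  refine (measure_mono (fun y hy => ?_ : Iio (x + 1) ⊆ Icc 0 (x + 1))).trans_lt ?_
  · exact ⟨zero_le, le_of_lt hy⟩
  · rw [timeMeasure_Icc_zero]; exact ENNReal.coe_lt_top

instance (T : ℝ≥0) : IsFiniteMeasure (timeMeasure.restrict (Icc 0 T)) :=
  ⟨by rw [Measure.restrict_apply_univ, timeMeasure_Icc_zero]; exact ENNReal.coe_lt_top⟩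

lemma setIntegral_Icc_timeMeasure {E : Type*} [NormedAddCommGroup E] [NormedSpace ℝ E]
    (s t : ℝ≥0) (g : ℝ → E) :
    ∫ r in Icc s t, g r ∂timeMeasure = ∫ r in Icc (s : ℝ) t, g r := by
  have h := measurableEmbedding_coe_nnreal.setIntegral_map (μ := timeMeasure) (g := g)
    (s := Icc (s : ℝ) t)
  have h2 : timeMeasure.map ((↑) : ℝ≥0 → ℝ) = volume.restrict (Ici 0) := by
    unfold timeMeasure
    rw [measurableEmbedding_coe_nnreal.map_comap]
    congr 1
    exact Subtype.range_coe
  rw [h2, Measure.restrict_restrict measurableSet_Icc, inter_eq_left.2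
    (fun x hx => mem_Ici.2 (s.2.trans hx.1) : Icc (s : ℝ) t ⊆ Ici 0)] at h
  rw [h]
  congr 2

/-- `A` is an indefinite integral of `α` on `[0, T]`. -/
def IsPrimitive (T : ℝ≥0) (A α : ℝ≥0 → ℂ) : Prop :=
  IntegrableOn α (Icc 0 T) timeMeasure ∧
    ∀ t ≤ T, A t = A 0 + ∫ s in Icc 0 t, α s ∂timeMeasure

lemma continuousOn_setIntegral_Icc {T : ℝ≥0} {α : ℝ≥0 → ℂ}
    (h : IntegrableOn α (Icc 0 T) timeMeasure) :
    ContinuousOn (fun t => ∫ s in Icc 0 t, α s ∂timeMeasure) (Icc 0 T) := by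
  have heq : ∀ t ∈ Icc 0 T, ∫ s in Icc 0 t, α s ∂timeMeasure =
      ∫ s in Icc 0 T, (Icc 0 t).indicator α s ∂timeMeasure := by
    intro t ht
    rw [setIntegral_indicator measurableSet_Icc, inter_eq_right.2 (Icc_subset_Icc_right ht.2)]
  refine ContinuousOn.congr ?_ heq
  intro t₀ _
  refine continuousWithinAt_of_dominated (bound := fun s => ‖α s‖) ?_ ?_ h.norm ?_
  · exact Eventually.of_forall fun t => h.aestronglyMeasurable.indicator measurableSet_Icc
  · exact Eventually.of_forall fun t => ae_of_all _ fun s => norm_indicator_le_norm_self _ _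
  · have hne : ∀ᵐ s ∂(timeMeasure.restrict (Icc 0 T)), s ≠ t₀ :=
      ae_restrict_of_ae (by simp [ae_iff])
    filter_upwards [hne] with s hs
    refine ContinuousAt.continuousWithinAt ?_
    rcases lt_or_gt_of_ne hs with hlt | hgt
    · refine (continuousAt_const (y := α s)).congr ?_
      filter_upwards [Ioi_mem_nhds hlt] with t ht
      rw [indicator_of_mem]
      exact ⟨zero_le, le_of_lt ht⟩
    · refine (continuousAt_const (y := 0)).congr ?_
      filter_upwards [Iio_mem_nhds hgt] with t ht
      rw [indicator_of_notMem]
      exact fun h => absurd h.2 (not_le.2 ht)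

namespace IsPrimitive

variable {T : ℝ≥0} {A B α β : ℝ≥0 → ℂ}

lemma continuousOn (h : IsPrimitive T A α) : ContinuousOn A (Icc 0 T) :=
  ((continuousOn_const (c := A 0)).add (continuousOn_setIntegral_Icc h.1)).congr
    fun t ht => h.2 t ht.2

lemma conjugate (h : IsPrimitive T A α) :
    IsPrimitive T (fun t => conj (A t)) (fun t => conj (α t)) := by
  refine ⟨Complex.conjCLE.toContinuousLinearMap.integrable_comp h.1, fun t ht => ?_⟩
  beta_reduce
  rw [h.2 t ht, map_add, integral_conj]

/-- Integration by parts for functions that are only absolutely continuous. It is Fubini on the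
square `[0, t]²`: the product of the two increments is split along the diagonal, and each triangle
is an iterated integral. -/
lemma mul (hA : IsPrimitive T A α) (hB : IsPrimitive T B β) :
    IsPrimitive T (fun t => A t * B t) (fun t => α t * B t + A t * β t) := by
  have h1 : IntegrableOn (fun t => α t * B t) (Icc 0 T) timeMeasure :=
    hA.1.mul_continuousOn hB.continuousOn isCompact_Icc
  have h2 : IntegrableOn (fun t => A t * β t) (Icc 0 T) timeMeasure :=
    hB.1.continuousOn_mul hA.continuousOn isCompact_Icc
  refine ⟨h1.add h2, fun t ht => ?_⟩
  have hsub : Icc 0 t ⊆ Icc 0 T := Icc_subset_Icc_right ht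
  set μ := timeMeasure.restrict (Icc 0 t) with hμ
  have iα : Integrable α μ := hA.1.mono_set hsub
  have iβ : Integrable β μ := hB.1.mono_set hsub
  have hΦ : Integrable (fun z : ℝ≥0 × ℝ≥0 => α z.1 * β z.2) (μ.prod μ) := iα.mul_prod iβ
  have hm : MeasurableSet {z : ℝ≥0 × ℝ≥0 | z.1 ≤ z.2} := measurableSet_le measurable_fst measurable_snd
  have key : (∫ s, α s ∂μ) * (∫ s, β s ∂μ) =
      (∫ s, (∫ r in Icc 0 s, α r ∂timeMeasure) * β s ∂μ) +
      ∫ r, α r * (∫ s in Icc 0 r, β s ∂timeMeasure) ∂μ := by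
    rw [← integral_prod_mul, ← integral_add_compl hm hΦ]
    congr 1
    · rw [← integral_indicator hm, integral_prod_symm _ (hΦ.indicator hm)]
      refine setIntegral_congr_fun measurableSet_Icc fun s hs => ?_
      rw [← integral_mul_const, ← integral_indicator measurableSet_Icc,
        ← integral_indicator measurableSet_Icc]
      refine integral_congr_ae (ae_of_all _ fun r => ?_)
      by_cases hr : r ≤ s
      · simp [indicator, hr, hr.trans hs.2]
      · simp [indicator, hr]
    · rw [← integral_indicator hm.compl, integral_prod _ (hΦ.indicator hm.compl)]
      refine setIntegral_congr_fun measurableSet_Icc fun r hr => ?_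
      rw [← integral_const_mul, ← integral_indicator measurableSet_Icc,
        ← integral_indicator measurableSet_Icc]
      refine integral_congr_ae ?_
      -- The complement of the closed triangle is the open one; the missing diagonal point is null.
      have hne : ∀ᵐ s ∂timeMeasure, s ≠ r := by simp [ae_iff]
      filter_upwards [hne] with s hs
      by_cases hsr : s < r
      · simp [indicator, hsr, hsr.le, hsr.le.trans hr.2]
      · have h3 : r ≤ s := not_lt.1 hsr
        have h4 : ¬ s ≤ r := fun h => hs (le_antisymm h h3)
        simp [indicator, h3, h4]
  have e1 : ∫ s, α s * B s ∂μ = (∫ s, α s ∂μ) * B 0 +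
      ∫ r, α r * (∫ s in Icc 0 r, β s ∂timeMeasure) ∂μ := by
    rw [← integral_mul_const, ← integral_add (iα.mul_const _)]
    · refine setIntegral_congr_fun measurableSet_Icc fun s hs => ?_
      rw [hB.2 s (hs.2.trans ht)]
      ring
    · exact IntegrableOn.mul_continuousOn iα ((continuousOn_setIntegral_Icc hB.1).mono hsub) isCompact_Icc
  have e2 : ∫ s, A s * β s ∂μ = A 0 * (∫ s, β s ∂μ) +
      ∫ s, (∫ r in Icc 0 s, α r ∂timeMeasure) * β s ∂μ := by
    rw [← integral_const_mul, ← integral_add (iβ.const_mul _)]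
    · refine setIntegral_congr_fun measurableSet_Icc fun s hs => ?_
      rw [hA.2 s (hs.2.trans ht)]
      ring
    · exact IntegrableOn.continuousOn_mul ((continuousOn_setIntegral_Icc hA.1).mono hsub) iβ isCompact_Icc
  rw [integral_add (h1.mono_set hsub) (h2.mono_set hsub), e1, e2]
  beta_reduce
  rw [hA.2 t ht, hB.2 t ht]
  linear_combination key

end IsPrimitive

/-- The time integral of the characteristic function of the Brownian increments after `s`. -/
def decayKernel (T s : ℝ≥0) (m : ℤ) : ℝ :=
  ∫ t in Icc s T, Real.exp (-(m : ℝ) ^ 2 * ((t : ℝ) - s) / 2) ∂timeMeasure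

lemma decayKernel_nonneg (T s : ℝ≥0) (m : ℤ) : 0 ≤ decayKernel T s m :=
  integral_nonneg fun _ => (Real.exp_pos _).le

lemma decayKernel_le (T s : ℝ≥0) (m : ℤ) : decayKernel T s m ≤ T := by
  unfold decayKernel
  have h : ∀ t ∈ Icc s T, ‖Real.exp (-(m : ℝ) ^ 2 * ((t : ℝ) - s) / 2)‖ ≤ 1 := by
    intro t ht
    rw [Real.norm_eq_abs, Real.abs_exp, Real.exp_le_one_iff]
    have : (s : ℝ) ≤ t := by exact_mod_cast ht.1
    have := mul_nonneg (sq_nonneg (m : ℝ)) (sub_nonneg.2 this)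
    linarith
  have hfin : timeMeasure (Icc s T) < ∞ := by
    rw [timeMeasure_Icc]; exact ENNReal.ofReal_lt_top
  have := norm_setIntegral_le_of_norm_le_const hfin h
  refine (le_abs_self _).trans (this.trans ?_)
  rw [one_mul, measureReal_def, timeMeasure_Icc, ENNReal.toReal_ofReal']
  exact max_le (by simp) (by simp)

lemma decayKernel_le_div (T s : ℝ≥0) {m : ℤ} (hm : m ≠ 0) :
    decayKernel T s m ≤ 2 / (m : ℝ) ^ 2 := by
  have hm2 : 0 < (m : ℝ) ^ 2 := by positivity
  unfold decayKernel
  rw [setIntegral_Icc_timeMeasure s T (fun t => Real.exp (-(m : ℝ) ^ 2 * (t - s) / 2))]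
  rcases lt_or_ge T s with h | h
  · rw [Icc_eq_empty (not_le.2 (by exact_mod_cast h))]
    simp; positivity
  have hd : ∀ x ∈ uIcc (s : ℝ) T, HasDerivAt
      (fun t : ℝ => -(2 / (m : ℝ) ^ 2) * Real.exp (-(m : ℝ) ^ 2 * (t - s) / 2))
      (Real.exp (-(m : ℝ) ^ 2 * (x - s) / 2)) x := by
    intro x _
    have h1 : HasDerivAt (fun t : ℝ => -(m : ℝ) ^ 2 * (t - s) / 2) (-(m : ℝ) ^ 2 * 1 / 2) x :=
      (((hasDerivAt_id x).sub_const _).const_mul _).div_const _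
    refine ((h1.exp).const_mul (-(2 / (m : ℝ) ^ 2))).congr_deriv ?_
    have : -(2 / (m : ℝ) ^ 2) * (-(m : ℝ) ^ 2 * 1 / 2) = 1 := by field_simp
    linear_combination (Real.exp (-(m : ℝ) ^ 2 * (x - s) / 2)) * this
  rw [integral_Icc_eq_integral_Ioc, ← intervalIntegral.integral_of_le (by exact_mod_cast h),
    intervalIntegral.integral_eq_sub_of_hasDerivAt hd (Continuous.intervalIntegrable (by fun_prop) _ _)]
  simp only [sub_self, mul_zero, zero_div, Real.exp_zero, mul_one]
  have : 0 < 2 / (m : ℝ) ^ 2 * Real.exp (-(m : ℝ) ^ 2 * (T - s) / 2) := by positivity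
  linarith

/-- Write `K = K^{1/4} K^{3/4}`: the bound by `T ≤ ε⁴` is used in the first factor and the bound by
`|ab|^{-2}` in the second. The exponent `3/2 > 1` that remains is summable in `a` and `b`
separately, while a positive power of `T` is gained. -/
lemma decayKernel_two_mul_le {T s : ℝ≥0} {ε : ℝ} (hε : 0 ≤ ε) (hT : (T : ℝ) ≤ ε ^ 4) {a b : ℤ}
    (ha : a ≠ 0) (hb : b ≠ 0) :
    |decayKernel T s (2 * a * b)| ≤ ε * (resWeight a * resWeight b) := by
  rw [abs_of_nonneg (decayKernel_nonneg _ _ _)]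
  set K := decayKernel T s (2 * a * b)
  have hK : 0 ≤ K := decayKernel_nonneg _ _ _
  have h1 : K ≤ ε ^ 4 := (decayKernel_le _ _ _).trans hT
  have ha' : (0 : ℝ) < |(a : ℝ)| := by positivity
  have hb' : (0 : ℝ) < |(b : ℝ)| := by positivity
  set x := |(a : ℝ)| * |(b : ℝ)| with hx
  have hxpos : 0 < x := mul_pos ha' hb'
  have h2 : K ≤ (x ^ 2)⁻¹ := by
    have := decayKernel_le_div T s (m := 2 * a * b) (by simp [ha, hb])
    refine this.trans ?_
    push_cast
    have hx2 : x ^ 2 = (a : ℝ) ^ 2 * (b : ℝ) ^ 2 := by rw [hx, mul_pow, sq_abs, sq_abs]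
    have e : (2 * (a : ℝ) * b) ^ 2 = 4 * x ^ 2 := by rw [hx2]; ring
    rw [e, inv_eq_one_div, div_le_div_iff₀ (by positivity) (by positivity)]
    nlinarith [sq_nonneg x]
  have h3 : resWeight a * resWeight b = x ^ (-(3 / 2) : ℝ) := by
    simp only [resWeight, ha, hb, if_false]
    rw [hx, Real.mul_rpow ha'.le hb'.le]
  rw [h3]
  have h4 : K = K ^ (1 / 4 : ℝ) * K ^ (3 / 4 : ℝ) := by
    rw [← Real.rpow_add' hK (by norm_num)]; norm_num
  rw [h4]
  have h5 : K ^ (1 / 4 : ℝ) ≤ ε := by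
    calc K ^ (1 / 4 : ℝ) ≤ (ε ^ 4) ^ (1 / 4 : ℝ) := Real.rpow_le_rpow hK h1 (by norm_num)
      _ = ε := by
        rw [← Real.rpow_natCast, ← Real.rpow_mul hε]; norm_num
  have h6 : K ^ (3 / 4 : ℝ) ≤ x ^ (-(3 / 2) : ℝ) := by
    calc K ^ (3 / 4 : ℝ) ≤ ((x ^ 2)⁻¹) ^ (3 / 4 : ℝ) := Real.rpow_le_rpow hK h2 (by norm_num)
      _ = x ^ (-(3 / 2) : ℝ) := by
        rw [← Real.rpow_natCast, ← Real.rpow_neg hxpos.le, ← Real.rpow_mul hxpos.le]; norm_num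
  gcongr

end WND
end

/-! ### Predictability, and Brownian increments given the past. -/

noncomputable section
namespace WND

open ComplexConjugate Set Filter Topology

section Predictable

variable {Ω : Type*} {mΩ : MeasurableSpace Ω} {𝓕 : Filtration ℝ≥0 mΩ}

lemma predictable_le_prod (𝓕 : Filtration ℝ≥0 mΩ) :
    𝓕.predictable ≤ (inferInstance : MeasurableSpace (ℝ≥0 × Ω)) := by
  refine measurableSpace_le_predictable_of_measurableSet (fun A hA => ?_) fun i A hA => ?_
  · exact (measurableSet_singleton _).prod (𝓕.le _ _ hA)
  · exact measurableSet_Ioi.prod (𝓕.le _ _ hA)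

/-- The largest point of the grid of mesh `1 / (n + 1)` strictly to the left of `t`. -/
def leftStep (n : ℕ) (t : ℝ≥0) : ℝ≥0 := ((⌈(n + 1 : ℝ≥0) * t⌉₊ - 1 : ℕ) : ℝ≥0) / (n + 1)

lemma leftStep_zero (n : ℕ) : leftStep n 0 = 0 := by simp [leftStep]

lemma leftStep_lt (n : ℕ) {t : ℝ≥0} (ht : 0 < t) : leftStep n t < t := by
  unfold leftStep
  have hn : (0 : ℝ≥0) < n + 1 := by positivity
  have hpos : 0 < ⌈(n + 1 : ℝ≥0) * t⌉₊ := Nat.ceil_pos.2 (mul_pos hn ht)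
  rw [div_lt_iff₀ hn, mul_comm t]
  exact Nat.lt_ceil.1 (Nat.sub_lt hpos one_pos)

lemma le_leftStep_add (n : ℕ) (t : ℝ≥0) : t ≤ leftStep n t + 1 / (n + 1) := by
  unfold leftStep
  have hn : (0 : ℝ≥0) < n + 1 := by positivity
  rw [← add_div, le_div_iff₀ hn, mul_comm]
  refine (Nat.le_ceil _).trans ?_
  exact_mod_cast (by omega : ⌈(n + 1 : ℝ≥0) * t⌉₊ ≤ ⌈(n + 1 : ℝ≥0) * t⌉₊ - 1 + 1)

lemma tendsto_leftStep {t : ℝ≥0} (ht : 0 < t) :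
    Tendsto (fun n => leftStep n t) atTop (𝓝[<] t) := by
  refine tendsto_nhdsWithin_iff.2 ⟨?_, Eventually.of_forall fun n => leftStep_lt n ht⟩
  have h1 : Tendsto (fun n : ℕ => t - 1 / ((n : ℝ≥0) + 1)) atTop (𝓝 (t - 0)) :=
    tendsto_const_nhds.sub tendsto_one_div_add_atTop_nhds_zero_nat
  rw [tsub_zero] at h1
  exact tendsto_of_tendsto_of_tendsto_of_le_of_le h1 tendsto_const_nhds
    (fun n => tsub_le_iff_right.2 (le_leftStep_add n t)) (fun n => (leftStep_lt n ht).le)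

/-- On each interval `(j/(n+1), (j+1)/(n+1)]` the process is frozen at the left end point, so a
preimage is a countable union of predictable rectangles. Time zero is a separate slice, where the
truncated subtraction makes `leftStep` equal to zero. -/
lemma measurable_predictable_leftStep {E : Type*} [MeasurableSpace E] {X : ℝ≥0 → Ω → E}
    (hX : ∀ t, Measurable[𝓕 t] (X t)) (n : ℕ) :
    Measurable[𝓕.predictable] fun z : ℝ≥0 × Ω => X (leftStep n z.1) z.2 := by
  intro A hA
  have hn : (0 : ℝ≥0) < n + 1 := by positivity
  have heq : (fun z : ℝ≥0 × Ω => X (leftStep n z.1) z.2) ⁻¹' A =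
      ({⊥} ×ˢ (X 0 ⁻¹' A)) ∪ ⋃ j : ℕ, Ioc ((j : ℝ≥0) / (n + 1)) (((j + 1 : ℕ) : ℝ≥0) / (n + 1)) ×ˢ
        (X ((j : ℝ≥0) / (n + 1)) ⁻¹' A) := by
    ext ⟨t, ω⟩
    simp only [mem_preimage, mem_union, mem_prod, mem_singleton_iff, mem_iUnion, mem_Ioc]
    have hstep : ∀ j : ℕ, (j : ℝ≥0) / (n + 1) < t → t ≤ ((j + 1 : ℕ) : ℝ≥0) / (n + 1) →
        leftStep n t = (j : ℝ≥0) / (n + 1) := by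
      intro j h1 h2
      rw [div_lt_iff₀ hn, mul_comm] at h1
      rw [le_div_iff₀ hn, mul_comm] at h2
      have : ⌈(n + 1 : ℝ≥0) * t⌉₊ = j + 1 := by
        rw [Nat.ceil_eq_iff (by omega)]
        exact ⟨by simpa using h1, h2⟩
      simp [leftStep, this]
    constructor
    · intro h
      rcases eq_zero_or_pos t with rfl | ht
      · left
        rw [leftStep_zero] at h
        exact ⟨rfl, h⟩
      · right
        have hpos : 0 < ⌈(n + 1 : ℝ≥0) * t⌉₊ := Nat.ceil_pos.2 (mul_pos hn ht)
        refine ⟨⌈(n + 1 : ℝ≥0) * t⌉₊ - 1, ⟨leftStep_lt n ht, ?_⟩, h⟩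
        have := le_leftStep_add n t
        rw [Nat.cast_add, add_div, Nat.cast_one]
        exact this
    · rintro (⟨h1, h2⟩ | ⟨j, ⟨h1, h2⟩, h3⟩)
      · have h1' : t = 0 := h1
        rw [h1', leftStep_zero]
        exact h2
      · rw [hstep j h1 h2]
        exact h3
  rw [heq]
  refine MeasurableSet.union ?_ (MeasurableSet.iUnion fun j => ?_)
  · exact measurableSet_predictable_singleton_bot_prod (hX 0 hA)
  · exact measurableSet_predictable_Ioc_prod _ _ (hX _ hA)

/-- Adapted and left-continuous processes are predictable; continuity along the grid is all that is
used. -/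
lemma measurable_predictable_of_tendsto_leftStep {E : Type*} [TopologicalSpace E]
    [TopologicalSpace.PseudoMetrizableSpace E] [MeasurableSpace E] [BorelSpace E]
    {X : ℝ≥0 → Ω → E} (hX : ∀ t, Measurable[𝓕 t] (X t))
    (hlim : ∀ t ω, 0 < t → Tendsto (fun n => X (leftStep n t) ω) atTop (𝓝 (X t ω))) :
    Measurable[𝓕.predictable] (Function.uncurry X) := by
  refine @measurable_of_tendsto_metrizable _ _ 𝓕.predictable _ _ _ _ _ _
    (measurable_predictable_leftStep hX) ?_
  rw [tendsto_pi_nhds]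
  rintro ⟨t, ω⟩
  rcases eq_zero_or_pos t with rfl | ht
  · simp only [leftStep_zero, Function.uncurry_apply_pair]
    exact tendsto_const_nhds
  · exact hlim t ω ht

lemma measurable_predictable_fst : Measurable[𝓕.predictable] (Prod.fst : ℝ≥0 × Ω → ℝ≥0) := by
  have := measurable_predictable_of_tendsto_leftStep (𝓕 := 𝓕) (X := fun (t : ℝ≥0) (_ : Ω) => t)
    (fun _ => measurable_const) (fun _ _ ht => (tendsto_leftStep ht).mono_right nhdsWithin_le_nhds)
  exact this

lemma measurable_predictable_snd {E : Type*} [MeasurableSpace E] {a : Ω → E}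
    (ha : Measurable[𝓕 0] a) : Measurable[𝓕.predictable] (fun z : ℝ≥0 × Ω => a z.2) :=
  measurable_predictable_leftStep (X := fun _ => a) (fun _ => ha.mono (𝓕.mono zero_le) le_rfl) 0

lemma sfinite_comap_subtype (t : ℝ≥0) :
    SFinite (timeMeasure.comap (Subtype.val : Iic t → ℝ≥0)) := by
  have : IsFiniteMeasure (timeMeasure.comap (Subtype.val : Iic t → ℝ≥0)) := by
    refine ⟨?_⟩
    rw [(MeasurableEmbedding.subtype_coe measurableSet_Iic).comap_apply, image_univ,
      Subtype.range_coe]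
    refine (measure_mono (show Iic t ⊆ Icc 0 t from fun y hy => ⟨zero_le, hy⟩)).trans_lt ?_
    rw [timeMeasure_Icc_zero]; exact ENNReal.coe_lt_top
  infer_instance

lemma isStronglyPredictable_of_measurable {E : Type*} [TopologicalSpace E]
    [TopologicalSpace.PseudoMetrizableSpace E] [SecondCountableTopology E] [MeasurableSpace E]
    [OpensMeasurableSpace E] {h : ℝ≥0 → Ω → E}
    (hh : Measurable[𝓕.predictable] (Function.uncurry h)) : IsStronglyPredictable 𝓕 h := by
  unfold IsStronglyPredictable
  generalize 𝓕.predictable = m at hh ⊢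
  exact hh.stronglyMeasurable

/-- The time integral of a predictable process is adapted. -/
lemma stronglyMeasurable_setIntegral_Icc {g : ℝ≥0 → Ω → ℂ} (hg : IsStronglyPredictable 𝓕 g)
    (t : ℝ≥0) :
    StronglyMeasurable[𝓕 t] fun ω => ∫ s in Icc 0 t, g s ω ∂timeMeasure := by
  have hp := hg.isStronglyProgressive t
  have h0 : ∀ ω, ∫ s in Icc 0 t, g s ω ∂timeMeasure =
      ∫ s : Iic t, g s ω ∂(timeMeasure.comap Subtype.val) := fun ω => by
    rw [integral_subtype_comap measurableSet_Iic (fun s => g s ω)]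
    congr 2
    ext x; simp
  simp only [h0]
  have : SFinite (timeMeasure.comap (Subtype.val : Iic t → ℝ≥0)) := sfinite_comap_subtype t
  exact @StronglyMeasurable.integral_prod_left _ _ _ _ (𝓕 t) _ _ _ _
    (fun (s : Iic t) ω => g s ω) hp

lemma measurable_setLIntegral_Iio {h : ℝ≥0 → Ω → ℝ≥0∞}
    (hh : Measurable[𝓕.predictable] (Function.uncurry h)) (t : ℝ≥0) :
    Measurable[𝓕 t] fun ω => ∫⁻ s in Iio t, h s ω ∂timeMeasure := by
  have hp := (isStronglyPredictable_of_measurable hh).isStronglyProgressive t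
  have h0 : ∀ ω, ∫⁻ s in Iio t, h s ω ∂timeMeasure =
      ∫⁻ s : Iic t, h s ω ∂(timeMeasure.comap Subtype.val) := fun ω => by
    rw [lintegral_subtype_comap measurableSet_Iic (fun s => h s ω)]
    exact setLIntegral_congr Iio_ae_eq_Iic
  simp only [h0]
  have : SFinite (timeMeasure.comap (Subtype.val : Iic t → ℝ≥0)) := sfinite_comap_subtype t
  have hp' : Measurable[Subtype.instMeasurableSpace.prod (𝓕 t)]
      fun p : Iic t × Ω => h p.1 p.2 := by
    generalize (Subtype.instMeasurableSpace.prod (𝓕 t) : MeasurableSpace (Iic t × Ω)) = m at hp ⊢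
    exact hp.measurable
  exact @Measurable.lintegral_prod_left _ _ _ (𝓕 t) _ _ (fun (s : Iic t) ω => h s ω)
    hp'

/-- Fatou bounds the lower limit and monotonicity the upper one. No integrability is needed, so
infinite running norms are covered. -/
lemma tendsto_setLIntegral_Iio_leftStep {h : ℝ≥0 → ℝ≥0∞} (hh : Measurable h) {t : ℝ≥0}
    (ht : 0 < t) :
    Tendsto (fun n => ∫⁻ s in Iio (leftStep n t), h s ∂timeMeasure) atTop
      (𝓝 (∫⁻ s in Iio t, h s ∂timeMeasure)) := by
  refine tendsto_of_le_liminf_of_limsup_le ?_ ?_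
  · simp only [← lintegral_indicator measurableSet_Iio]
    refine le_trans ?_ (lintegral_liminf_le fun n => hh.indicator measurableSet_Iio)
    refine lintegral_mono fun s => ?_
    by_cases hs : s < t
    · have : ∀ᶠ n in atTop, (Iio (leftStep n t)).indicator h s = h s := by
        have := ((tendsto_leftStep ht).mono_right nhdsWithin_le_nhds).eventually (lt_mem_nhds hs)
        filter_upwards [this] with n hn
        exact indicator_of_mem (mem_Iio.2 hn) _
      rw [liminf_congr this, indicator_of_mem (mem_Iio.2 hs)]
      simp
    · rw [indicator_of_notMem (by simpa using hs)]
      exact zero_le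
  · refine limsup_le_of_le (by isBoundedDefault) (Eventually.of_forall fun n => ?_)
    exact lintegral_mono_set (Iio_subset_Iio (leftStep_lt n ht).le)

lemma measurable_predictable_setLIntegral {h : ℝ≥0 → Ω → ℝ≥0∞}
    (hh : Measurable[𝓕.predictable] (Function.uncurry h)) :
    Measurable[𝓕.predictable] (Function.uncurry fun t ω => ∫⁻ s in Iio t, h s ω ∂timeMeasure) := by
  refine measurable_predictable_of_tendsto_leftStep (measurable_setLIntegral_Iio hh)
    fun t ω ht => tendsto_setLIntegral_Iio_leftStep ?_ ht
  have : Measurable (Function.uncurry h) := hh.mono (predictable_le_prod 𝓕) le_rfl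
  exact this.comp measurable_prodMk_right

lemma runningNorm_eq (u : ℝ≥0 → Ω → LTorus 4) (t : ℝ≥0) (ω : Ω) :
    runningNorm u t ω = (∫⁻ s in Iio t, ‖u s ω‖ₑ ^ 4 ∂timeMeasure) ^ (1 / 4 : ℝ) := by
  rw [runningNorm, ← eLpNorm_four_pow, ← ENNReal.rpow_natCast, ← ENNReal.rpow_mul]
  norm_num

/-- The running norm of a predictable process is predictable. -/
lemma measurable_runningNorm {u : ℝ≥0 → Ω → LTorus 4} (hu : IsStronglyPredictable 𝓕 u) :
    Measurable[𝓕.predictable] (Function.uncurry (runningNorm u)) := by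
  have hmeas : Measurable[𝓕.predictable] (Function.uncurry fun s ω => ‖u s ω‖ₑ ^ 4) := by
    unfold IsStronglyPredictable at hu
    generalize 𝓕.predictable = m at hu ⊢
    exact hu.enorm.pow_const 4
  have h1 := measurable_predictable_setLIntegral hmeas
  have h3 : Function.uncurry (runningNorm u) = fun z => (Function.uncurry fun t ω =>
      ∫⁻ s in Iio t, ‖u s ω‖ₑ ^ 4 ∂timeMeasure) z ^ (1 / 4 : ℝ) := by
    funext z; exact runningNorm_eq u z.1 z.2
  rw [h3]
  generalize 𝓕.predictable = m at h1 ⊢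
  exact h1.pow_const _

lemma measurable_predictable_setIntegral {g : ℝ≥0 → Ω → ℂ} (hg : IsStronglyPredictable 𝓕 g)
    (hintegrable : ∀ t ω, IntegrableOn (fun s => g s ω) (Icc 0 t) timeMeasure) :
    Measurable[𝓕.predictable] (Function.uncurry fun t ω => ∫ s in Icc 0 t, g s ω ∂timeMeasure) := by
  refine measurable_predictable_of_tendsto_leftStep
    (fun t => (stronglyMeasurable_setIntegral_Icc hg t).measurable) fun t ω ht => ?_
  have hc := continuousOn_setIntegral_Icc (hintegrable t ω) t ⟨zero_le, le_rfl⟩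
  refine hc.tendsto.comp (tendsto_nhdsWithin_iff.2 ⟨(tendsto_leftStep ht).mono_right
    nhdsWithin_le_nhds, Eventually.of_forall fun n => ⟨zero_le, (leftStep_lt n ht).le⟩⟩)

end Predictable

/-- A predictable process whose increments after time `s` have the characteristic function of
a Brownian motion, conditionally on the past. -/
structure IsDriver {Ω : Type*} {mΩ : MeasurableSpace Ω} (𝓕 : Filtration ℝ≥0 mΩ)
    (B : ℝ≥0 → Ω → ℝ) (P : Measure Ω) : Prop where
  predictable : Measurable[𝓕.predictable] (Function.uncurry B)
  zero : ∀ ω, B 0 ω = 0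
  integral_exp_mul : ∀ s t : ℝ≥0, s ≤ t → ∀ (m : ℤ) (G : Ω → ℂ), StronglyMeasurable[𝓕 s] G →
    ∫ ω, Complex.exp (Complex.I * m * ((B t ω - B s ω : ℝ) : ℂ)) * G ω ∂P =
      (Real.exp (-(m : ℝ) ^ 2 * ((t : ℝ) - s) / 2) : ℂ) * ∫ ω, G ω ∂P

section Driver

variable {Ω : Type*} {mΩ : MeasurableSpace Ω} {𝓕 : Filtration ℝ≥0 mΩ} {P : Measure Ω}
  {W : ℝ≥0 → Ω → ℝ}

/-- Independence of the increment from `𝓕 s` factors the expectation, and the first factor is the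
characteristic function of a centred Gaussian of variance `t - s`. -/
lemma IsBrownianFor.integral_exp_mul [IsProbabilityMeasure P] (hW : IsBrownianFor 𝓕 W P)
    {s t : ℝ≥0} (hst : s ≤ t) (m : ℤ) {G : Ω → ℂ} (hG : StronglyMeasurable[𝓕 s] G) :
    ∫ ω, Complex.exp (Complex.I * m * ((W t ω - W s ω : ℝ) : ℂ)) * G ω ∂P =
      (Real.exp (-(m : ℝ) ^ 2 * ((t : ℝ) - s) / 2) : ℂ) * ∫ ω, G ω ∂P := by
  have hmeasW : ∀ r, Measurable (W r) := fun r => ((hW.adapted r).mono (𝓕.le r)).measurable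
  have hsub : Measurable fun ω => W t ω - W s ω := (hmeasW t).sub (hmeasW s)
  set e : ℝ → ℂ := fun x => Complex.exp (Complex.I * m * (x : ℂ)) with he
  have hem : Measurable e := by fun_prop
  have hind : IndepFun (fun ω => W t ω - W s ω) G P := by
    have := (hW.indep s t hst).symm
    rw [IndepFun_iff_Indep]
    exact indep_of_indep_of_le_right this hG.measurable.comap_le
  have hGm : AEStronglyMeasurable G P := (hG.mono (𝓕.le s)).aestronglyMeasurable
  have h1 := (hind.comp hem measurable_id).integral_fun_mul_eq_mul_integral
    (hem.comp hsub).aestronglyMeasurable hGm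
  have h2 : ∫ ω, e (W t ω - W s ω) ∂P = (Real.exp (-(m : ℝ) ^ 2 * ((t : ℝ) - s) / 2) : ℂ) := by
    have hlaw := hW.isBrownian.toIsPreBrownianReal.hasLaw_sub t s
    have h3 := hlaw.integral_comp (f := e) hem.aestronglyMeasurable
    have h4 : ∫ ω, e (W t ω - W s ω) ∂P = ∫ x, e x ∂(gaussianReal 0 (nndist t.1 s.1)) := h3
    have h5 := charFun_gaussianReal (μ := 0) (v := nndist t.1 s.1) (m : ℝ)
    rw [charFun_apply_real] at h5
    rw [h4]
    have h6 : ∀ x : ℝ, e x = Complex.exp ((m : ℝ) * x * Complex.I) := fun x => by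
      simp only [he]; congr 1; push_cast; ring
    simp only [h6]
    rw [h5]
    have h7 : ((nndist t.1 s.1 : ℝ≥0) : ℝ) = (t : ℝ) - s := by
      rw [coe_nndist, Real.dist_eq, abs_of_nonneg (sub_nonneg.2 (by exact_mod_cast hst))]
      rfl
    rw [Complex.ofReal_exp]
    congr 1
    have h8 : (((nndist t.1 s.1 : ℝ≥0) : ℝ) : ℂ) = ((t : ℝ) : ℂ) - ((s : ℝ) : ℂ) := by
      rw [h7]; push_cast; rfl
    rw [h8]
    push_cast
    ring
  rw [← h2]
  exact h1

/-- A Brownian motion relative to a filtration has a predictable version. -/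
theorem IsBrownianFor.exists_driver [IsProbabilityMeasure P] (hW : IsBrownianFor 𝓕 W P) :
    ∃ B : ℝ≥0 → Ω → ℝ, IsDriver 𝓕 B P ∧ (∀ᵐ ω ∂P, ∀ t, B t ω = W t ω) := by
  -- The upper limit along the grid from the left is predictable on all of `Ω` and equals `W` on
  -- continuous paths. The value at time zero is set by hand, so that it vanishes for every `ω`.
  set B : ℝ≥0 → Ω → ℝ := fun t ω => if t = 0 then 0 else
    limsup (fun n => W (leftStep n t) ω) atTop with hB
  have hae : ∀ᵐ ω ∂P, ∀ t, B t ω = W t ω := by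
    filter_upwards [hW.isBrownian.cont, hW.isBrownian.toIsPreBrownianReal.eval_zero_ae_eq_zero]
      with ω hc h0 t
    by_cases ht : t = 0
    · simp [hB, ht, h0]
    · simp only [hB, ht, if_false]
      exact ((hc.tendsto t).comp ((tendsto_leftStep (pos_of_ne_zero ht)).mono_right
        nhdsWithin_le_nhds)).limsup_eq
  have limsup_meas : ∀ (m : MeasurableSpace (ℝ≥0 × Ω)) {f : ℕ → ℝ≥0 × Ω → ℝ},
      (∀ n, Measurable[m] (f n)) → Measurable[m] fun z => limsup (fun n => f n z) atTop :=
    fun m f hf => Measurable.limsup hf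
  refine ⟨B, ⟨?_, fun ω => by simp [hB], ?_⟩, hae⟩
  · have h1 : Measurable[𝓕.predictable] fun z : ℝ≥0 × Ω =>
        limsup (fun n => W (leftStep n z.1) z.2) atTop :=
      limsup_meas _ fun n => measurable_predictable_leftStep (fun t => (hW.adapted t).measurable) n
    have h2 : MeasurableSet[𝓕.predictable] {z : ℝ≥0 × Ω | z.1 = 0} :=
      measurable_predictable_fst (measurableSet_singleton 0)
    change Measurable[𝓕.predictable] fun z : ℝ≥0 × Ω =>
      if z.1 = 0 then 0 else limsup (fun n => W (leftStep n z.1) z.2) atTop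
    generalize 𝓕.predictable = m at h1 h2 ⊢
    exact Measurable.ite h2 measurable_const h1
  · intro s t hst m G hG
    rw [← hW.integral_exp_mul hst m hG]
    refine integral_congr_ae ?_
    filter_upwards [hae] with ω hω
    rw [hω t, hω s]

end Driver

end WND
end

/-! ### The linear problem in Fourier coefficients. -/

noncomputable section
namespace WND

open ComplexConjugate Set Filter Topology

lemma norm_propagatorSymbol (b : ℝ) (k : ℤ) : ‖propagatorSymbol b k‖ = 1 := by
  have : Complex.I * (k : ℂ) ^ 2 * (b : ℂ) = ((k ^ 2 * b : ℝ) : ℂ) * Complex.I := by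
    push_cast; ring
  rw [propagatorSymbol, this, Complex.norm_exp_ofReal_mul_I]

lemma propagatorSymbol_add (b c : ℝ) (k : ℤ) :
    propagatorSymbol (b + c) k = propagatorSymbol b k * propagatorSymbol c k := by
  rw [propagatorSymbol, propagatorSymbol, propagatorSymbol, ← Complex.exp_add]
  congr 1; push_cast; ring

lemma propagatorSymbol_zero (k : ℤ) : propagatorSymbol 0 k = 1 := by simp [propagatorSymbol]

lemma propagatorSymbol_mul_neg (b : ℝ) (k : ℤ) :
    propagatorSymbol b k * propagatorSymbol (-b) k = 1 := by
  rw [← propagatorSymbol_add, add_neg_cancel, propagatorSymbol_zero]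

lemma conj_propagatorSymbol (b : ℝ) (k : ℤ) :
    conj (propagatorSymbol b k) = propagatorSymbol (-b) k := by
  rw [propagatorSymbol, propagatorSymbol, ← Complex.exp_conj]
  congr 1
  simp

/-- On `k + n = l + j` one has `k² - l² - j² + n² = 2(k-l)(k-j)`. The phase thus degenerates only if
`l = k` or `j = k`. -/
lemma propagatorSymbol_resonance (b : ℝ) {k l j n : ℤ} (h : k + n = l + j) :
    propagatorSymbol b k * propagatorSymbol (-b) l * propagatorSymbol (-b) j *
      propagatorSymbol b n = Complex.exp (Complex.I * (2 * (k - l) * (k - j) : ℤ) * (b : ℂ)) := by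
  have hn : n = l + j - k := by linarith
  subst hn
  simp only [propagatorSymbol, ← Complex.exp_add]
  congr 1
  push_cast
  ring

@[fun_prop]
lemma continuous_propagatorSymbol (k : ℤ) : Continuous fun b => propagatorSymbol b k := by
  unfold propagatorSymbol; fun_prop

lemma norm_mode_four_le (k : ℤ) : ‖mode 4 k‖ ≤ 2 := by
  have h := norm_trig_four_pow {k} (fun _ => 1)
  have h1 : trig 4 {k} (fun _ => 1) = mode 4 k := by simp [trig]
  rw [h1] at h
  simp only [quarticForm, Finset.sum_singleton] at h
  have h2 : ‖mode 4 k‖ ^ 4 = 2 * Real.pi := by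
    have : ((‖mode 4 k‖ ^ 4 : ℝ) : ℂ) = ((2 * Real.pi : ℝ) : ℂ) := by
      rw [h]; simp
    exact_mod_cast this
  have h3 : ‖mode 4 k‖ ^ 4 ≤ 2 ^ 4 := by
    rw [h2]; linarith [Real.pi_lt_four]
  exact le_of_pow_le_pow_left₀ (by norm_num) (by norm_num) h3

section Amplitude

variable {Ω : Type*} {mΩ : MeasurableSpace Ω} {𝓕 : Filtration ℝ≥0 mΩ} {P : Measure Ω}

/-- The `k`-th coefficient of the solution of the linear problem with data `a` and forcing `f`,
pulled back along the propagator. -/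
def profile (B : ℝ≥0 → Ω → ℝ) (a : ℤ → Ω → ℂ) (f : ℤ → ℝ≥0 → Ω → ℂ) (k : ℤ) (t : ℝ≥0) (ω : Ω) : ℂ :=
  a k ω + ∫ s in Icc 0 t, propagatorSymbol (-(B s ω)) k * f k s ω ∂timeMeasure

/-- The `k`-th Fourier coefficient of the solution of the linear problem with data `a` and
forcing `f`. -/
def amplitude (B : ℝ≥0 → Ω → ℝ) (a : ℤ → Ω → ℂ) (f : ℤ → ℝ≥0 → Ω → ℂ) (k : ℤ) (t : ℝ≥0) (ω : Ω) :
    ℂ :=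
  propagatorSymbol (B t ω) k * profile B a f k t ω

/-- The assumptions of the linear estimate: `f` is a predictable forcing whose restriction to the
frequencies in `S` has dual `L⁴` norm at most `ρ`. -/
structure IsLinearData (𝓕 : Filtration ℝ≥0 mΩ) (P : Measure Ω) (T : ℝ≥0) (B : ℝ≥0 → Ω → ℝ)
    (S : Finset ℤ) (a : ℤ → Ω → ℂ) (f : ℤ → ℝ≥0 → Ω → ℂ) (ρ : ℝ≥0 → Ω → ℝ) : Prop where
  driver : IsDriver 𝓕 B P
  a_meas : ∀ k, Measurable[𝓕 0] (a k)
  a_memLp : ∀ k, MemLp (a k) 4 P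
  f_pred : ∀ k, Measurable[𝓕.predictable] (Function.uncurry (f k))
  f_int : ∀ k t ω, IntegrableOn (fun s => f k s ω) (Icc 0 t) timeMeasure
  ρ_meas : Measurable (Function.uncurry ρ)
  ρ_nonneg : ∀ s ω, 0 ≤ ρ s ω
  pair : ∀ s ω (d : ℤ → ℂ), ‖∑ k ∈ S, f k s ω * conj (d k)‖ ≤ ρ s ω * ‖trig 4 S d‖
  ρ_le : ∃ M : ℝ≥0, ∀ ω, eLpNorm (fun s => ρ s ω) (4 / 3) (timeMeasure.restrict (Icc 0 T)) ≤ M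

variable {T : ℝ≥0} {B : ℝ≥0 → Ω → ℝ} {a : ℤ → Ω → ℂ} {f : ℤ → ℝ≥0 → Ω → ℂ}

lemma measurable_predictable_mul {m : MeasurableSpace (ℝ≥0 × Ω)} {g h : ℝ≥0 × Ω → ℂ}
    (hg : Measurable[m] g) (hh : Measurable[m] h) : Measurable[m] fun z => g z * h z :=
  hg.mul hh

lemma measurable_predictable_add {m : MeasurableSpace (ℝ≥0 × Ω)} {g h : ℝ≥0 × Ω → ℂ}
    (hg : Measurable[m] g) (hh : Measurable[m] h) : Measurable[m] fun z => g z + h z :=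
  hg.add hh

lemma measurable_propagator (hB : Measurable[𝓕.predictable] (Function.uncurry B)) (k : ℤ) :
    Measurable[𝓕.predictable] fun z : ℝ≥0 × Ω => propagatorSymbol (B z.1 z.2) k :=
  (continuous_propagatorSymbol k).measurable.comp hB

lemma measurable_propagator_neg (hB : Measurable[𝓕.predictable] (Function.uncurry B)) (k : ℤ) :
    Measurable[𝓕.predictable] fun z : ℝ≥0 × Ω => propagatorSymbol (-(B z.1 z.2)) k :=
  ((continuous_propagatorSymbol k).comp continuous_neg).measurable.comp hB

lemma integrableOn_propagator_mul (hB : Measurable[𝓕.predictable] (Function.uncurry B))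
    (f_int : ∀ k t ω, IntegrableOn (fun s => f k s ω) (Icc 0 t) timeMeasure)
    (k : ℤ) (t : ℝ≥0) (ω : Ω) :
    IntegrableOn (fun s => propagatorSymbol (-(B s ω)) k * f k s ω) (Icc 0 t) timeMeasure := by
  refine (f_int k t ω).bdd_mul (c := 1) ?_ (ae_of_all _ fun s => (norm_propagatorSymbol _ k).le)
  have := ((measurable_propagator_neg hB k).mono (predictable_le_prod 𝓕) le_rfl).comp
    (measurable_prodMk_right (y := ω))
  exact this.aestronglyMeasurable

lemma measurable_profile (hB : Measurable[𝓕.predictable] (Function.uncurry B))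
    (a_meas : ∀ k, Measurable[𝓕 0] (a k))
    (f_pred : ∀ k, Measurable[𝓕.predictable] (Function.uncurry (f k)))
    (f_int : ∀ k t ω, IntegrableOn (fun s => f k s ω) (Icc 0 t) timeMeasure) (k : ℤ) :
    Measurable[𝓕.predictable] (Function.uncurry (profile B a f k)) := by
  have h1 : Measurable[𝓕.predictable] (Function.uncurry fun s ω =>
      propagatorSymbol (-(B s ω)) k * f k s ω) :=
    measurable_predictable_mul (measurable_propagator_neg hB k) (f_pred k)
  have h2 := measurable_predictable_setIntegral (isStronglyPredictable_of_measurable h1)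
    (integrableOn_propagator_mul hB f_int k)
  exact measurable_predictable_add (measurable_predictable_snd (a_meas k)) h2

lemma measurable_amplitude (hB : Measurable[𝓕.predictable] (Function.uncurry B))
    (a_meas : ∀ k, Measurable[𝓕 0] (a k))
    (f_pred : ∀ k, Measurable[𝓕.predictable] (Function.uncurry (f k)))
    (f_int : ∀ k t ω, IntegrableOn (fun s => f k s ω) (Icc 0 t) timeMeasure) (k : ℤ) :
    Measurable[𝓕.predictable] (Function.uncurry (amplitude B a f k)) :=
  measurable_predictable_mul (measurable_propagator hB k)
    (measurable_profile hB a_meas f_pred f_int k)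

lemma profile_eq (k : ℤ) (t : ℝ≥0) (ω : Ω) :
    profile B a f k t ω = propagatorSymbol (-(B t ω)) k * amplitude B a f k t ω := by
  rw [amplitude, ← mul_assoc, mul_comm (propagatorSymbol (-(B t ω)) k),
    propagatorSymbol_mul_neg, one_mul]

lemma norm_amplitude (k : ℤ) (t : ℝ≥0) (ω : Ω) :
    ‖amplitude B a f k t ω‖ = ‖profile B a f k t ω‖ := by
  rw [amplitude, norm_mul, norm_propagatorSymbol, one_mul]

lemma profile_zero (k : ℤ) (ω : Ω) : profile B a f k 0 ω = a k ω := by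
  simp [profile]

lemma isPrimitive_profile (hB : Measurable[𝓕.predictable] (Function.uncurry B))
    (f_int : ∀ k t ω, IntegrableOn (fun s => f k s ω) (Icc 0 t) timeMeasure)
    (T : ℝ≥0) (k : ℤ) (ω : Ω) :
    IsPrimitive T (fun t => profile B a f k t ω)
      (fun s => propagatorSymbol (-(B s ω)) k * f k s ω) :=
  ⟨integrableOn_propagator_mul hB f_int k T ω, fun t _ => by
    beta_reduce; rw [profile_zero]; rfl⟩

/-- The energy identity: the mass on a finite set of frequencies. -/
lemma sum_sq_amplitude (hB : Measurable[𝓕.predictable] (Function.uncurry B))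
    (f_int : ∀ k t ω, IntegrableOn (fun s => f k s ω) (Icc 0 t) timeMeasure)
    (S : Finset ℤ) (t : ℝ≥0) (ω : Ω) :
    ∑ k ∈ S, ‖amplitude B a f k t ω‖ ^ 2 = ∑ k ∈ S, ‖a k ω‖ ^ 2 +
      2 * ∫ s in Icc 0 t, (∑ k ∈ S, f k s ω * conj (amplitude B a f k s ω)).re ∂timeMeasure ∧
    IntegrableOn (fun s => (∑ k ∈ S, f k s ω * conj (amplitude B a f k s ω)).re) (Icc 0 t)
      timeMeasure := by
  have hk : ∀ k, IntegrableOn (fun s => f k s ω * conj (amplitude B a f k s ω)) (Icc 0 t)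
      timeMeasure ∧ ‖amplitude B a f k t ω‖ ^ 2 = ‖a k ω‖ ^ 2 +
      2 * ∫ s in Icc 0 t, (f k s ω * conj (amplitude B a f k s ω)).re ∂timeMeasure := by
    intro k
    -- The amplitude carries the rough phase of the Brownian path; its unimodular multiple `profile`
    -- has the same modulus and is absolutely continuous.
    have hp := isPrimitive_profile (a := a) hB f_int t k ω
    have e1 : ∀ s, f k s ω * conj (amplitude B a f k s ω) =
        (propagatorSymbol (-(B s ω)) k * f k s ω) * conj (profile B a f k s ω) := by
      intro s
      rw [amplitude, map_mul, conj_propagatorSymbol]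
      ring
    have hi : IntegrableOn (fun s => f k s ω * conj (amplitude B a f k s ω)) (Icc 0 t)
        timeMeasure := by
      simp only [e1]
      exact hp.1.mul_continuousOn hp.conjugate.continuousOn isCompact_Icc
    refine ⟨hi, ?_⟩
    have h := (hp.mul hp.conjugate).2 t le_rfl
    simp only [profile_zero] at h
    rw [Complex.mul_conj', Complex.mul_conj'] at h
    have h2 : ∫ s in Icc 0 t, (propagatorSymbol (-(B s ω)) k * f k s ω * conj (profile B a f k s ω) +
        profile B a f k s ω * conj (propagatorSymbol (-(B s ω)) k * f k s ω)) ∂timeMeasure =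
        ((2 * ∫ s in Icc 0 t, (f k s ω * conj (amplitude B a f k s ω)).re ∂timeMeasure : ℝ) : ℂ) := by
      rw [← integral_const_mul, ← integral_complex_ofReal]
      refine integral_congr_ae (ae_of_all _ fun s => ?_)
      simp only
      rw [e1 s]
      set x := propagatorSymbol (-(B s ω)) k * f k s ω
      set y := profile B a f k s ω
      have : y * conj x = conj (x * conj y) := by simp [mul_comm]
      rw [this, Complex.add_conj]
    rw [h2] at h
    rw [norm_amplitude]
    exact_mod_cast h
  have hre : ∀ k, IntegrableOn (fun s => (f k s ω * conj (amplitude B a f k s ω)).re) (Icc 0 t)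
      timeMeasure := fun k => (hk k).1.re
  simp only [Complex.re_sum]
  refine ⟨?_, integrable_finsetSum _ fun k _ => hre k⟩
  rw [integral_finsetSum _ fun k _ => hre k, Finset.mul_sum, ← Finset.sum_add_distrib]
  exact Finset.sum_congr rfl fun k _ => (hk k).2

/-- The time derivative of a resonant product of four coefficients, up to the phase. -/
def quadSource (B : ℝ≥0 → Ω → ℝ) (a : ℤ → Ω → ℂ) (f : ℤ → ℝ≥0 → Ω → ℂ) (k l j n : ℤ) (s : ℝ≥0)
    (ω : Ω) : ℂ :=
  let d := fun k => amplitude B a f k s ω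
  let g := fun k => f k s ω
  g k * conj (d l) * conj (d j) * d n + d k * conj (g l) * conj (d j) * d n +
    d k * conj (d l) * conj (g j) * d n + d k * conj (d l) * conj (d j) * g n

/-- The product of four coefficients. -/
def quadProd (d : ℤ → ℂ) (k l j n : ℤ) : ℂ := d k * conj (d l) * conj (d j) * d n

/-- The product rule is applied to the four profiles. On a resonant quadruple the phases recombine
into one that depends only on the increment after `s`, while the source depends only on the path up
to `s`. -/
lemma quadProd_amplitude (hB : Measurable[𝓕.predictable] (Function.uncurry B))
    (f_int : ∀ k t ω, IntegrableOn (fun s => f k s ω) (Icc 0 t) timeMeasure)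
    {k l j n : ℤ} (h : k + n = l + j) (t : ℝ≥0) (ω : Ω) :
    quadProd (fun k => amplitude B a f k t ω) k l j n =
      Complex.exp (Complex.I * (2 * (k - l) * (k - j) : ℤ) * (B t ω : ℂ)) *
        quadProd (fun k => a k ω) k l j n +
      ∫ s in Icc 0 t, Complex.exp (Complex.I * (2 * (k - l) * (k - j) : ℤ) *
        ((B t ω - B s ω : ℝ) : ℂ)) * quadSource B a f k l j n s ω ∂timeMeasure := by
  have hp := fun k => isPrimitive_profile (a := a) hB f_int t k ω
  have hq := (((hp k).mul (hp l).conjugate).mul (hp j).conjugate).mul (hp n)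
  have h1 := hq.2 t le_rfl
  simp only [profile_zero] at h1
  have h2 : quadProd (fun k => amplitude B a f k t ω) k l j n =
      Complex.exp (Complex.I * (2 * (k - l) * (k - j) : ℤ) * (B t ω : ℂ)) *
      (profile B a f k t ω * conj (profile B a f l t ω) * conj (profile B a f j t ω) *
        profile B a f n t ω) := by
    rw [← propagatorSymbol_resonance (B t ω) h]
    simp only [quadProd, amplitude, map_mul, conj_propagatorSymbol]
    ring
  rw [h2, h1, mul_add, ← integral_const_mul]
  congr 1
  refine integral_congr_ae (ae_of_all _ fun s => ?_)
  simp only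
  have h3 : Complex.exp (Complex.I * (2 * (k - l) * (k - j) : ℤ) * ((B t ω - B s ω : ℝ) : ℂ)) =
      Complex.exp (Complex.I * (2 * (k - l) * (k - j) : ℤ) * (B t ω : ℂ)) *
      (propagatorSymbol (-(B s ω)) k * propagatorSymbol (B s ω) l * propagatorSymbol (B s ω) j *
        propagatorSymbol (-(B s ω)) n) := by
    have := propagatorSymbol_resonance (-(B s ω)) h
    rw [neg_neg] at this
    rw [this, ← Complex.exp_add]
    congr 1
    push_cast
    ring
  rw [h3, mul_assoc (Complex.exp _)]
  congr 1
  simp only [quadSource, map_mul, conj_propagatorSymbol, neg_neg]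
  have hpd : ∀ k, profile B a f k s ω = propagatorSymbol (-(B s ω)) k * amplitude B a f k s ω :=
    fun k => profile_eq k s ω
  rw [hpd k, hpd l, hpd j, hpd n]
  simp only [map_mul, conj_propagatorSymbol, neg_neg]
  ring

end Amplitude

end WND
end

/-! ### Expectations of resonant products. -/

noncomputable section
namespace WND

open ComplexConjugate Set Filter Topology

instance instFactFourThirds : Fact ((1 : ℝ≥0∞) ≤ 4 / 3) :=
  ⟨by rw [ENNReal.le_div_iff_mul_le (by simp) (by simp)]; norm_num⟩

instance instHolderFourThirds : ENNReal.HolderTriple (4 / 3) 4 1 := by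
  refine ⟨?_⟩
  rw [ENNReal.inv_div (by simp) (by simp), inv_one, ← one_div, ← ENNReal.add_div]
  norm_num
  exact ENNReal.div_self (by simp) (by simp)

section Holder

variable {α : Type*} [MeasurableSpace α] {μ : Measure α}

lemma integral_mul_le_of_memLp {ρ g : α → ℝ} (hρ : MemLp ρ (4 / 3) μ) (hg : MemLp g 4 μ) :
    ∫ x, ρ x * g x ∂μ ≤ (eLpNorm ρ (4 / 3) μ).toReal * (eLpNorm g 4 μ).toReal := by
  have h1 := eLpNorm_smul_le_mul_eLpNorm (p := 4 / 3) (q := 4) (r := 1) hg.1 hρ.1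
  have h2 : ∫ x, ρ x * g x ∂μ ≤ (eLpNorm (ρ • g) 1 μ).toReal := by
    rw [eLpNorm_one_eq_lintegral_enorm]
    have := norm_integral_le_lintegral_norm (μ := μ) (ρ • g)
    refine (le_abs_self _).trans ?_
    simp only [ofReal_norm] at this
    exact this
  refine h2.trans ?_
  rw [← ENNReal.toReal_mul]
  exact ENNReal.toReal_mono (ENNReal.mul_ne_top hρ.2.ne hg.2.ne) h1

lemma toReal_eLpNorm_four_pow {E : Type*} [NormedAddCommGroup E] {g : α → E}
    (hg : AEStronglyMeasurable g μ) :
    (eLpNorm g 4 μ).toReal ^ 4 = ∫ x, ‖g x‖ ^ 4 ∂μ := by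
  rw [← ENNReal.toReal_pow, eLpNorm_four_pow,
    integral_eq_lintegral_of_nonneg_ae (ae_of_all _ fun x => pow_nonneg (norm_nonneg _) 4)
      ((continuous_norm.pow 4).comp_aestronglyMeasurable hg)]
  congr 1
  refine lintegral_congr fun x => ?_
  rw [ENNReal.ofReal_pow (norm_nonneg _), ofReal_norm]

end Holder

/-- A domain of integration that does not depend on `s` makes joint measurability and Fubini
available. -/
lemma decayKernel_eq_integral (T s : ℝ≥0) (m : ℤ) :
    decayKernel T s m = ∫ t in Icc 0 T,
      (if s ≤ t then Real.exp (-(m : ℝ) ^ 2 * ((t : ℝ) - s) / 2) else 0) ∂timeMeasure := by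
  rw [decayKernel, ← integral_indicator measurableSet_Icc, ← integral_indicator measurableSet_Icc]
  refine integral_congr_ae (ae_of_all _ fun t => ?_)
  by_cases h1 : s ≤ t <;> by_cases h2 : t ≤ T <;> simp [indicator, h1, h2]

lemma measurable_decay_integrand (m : ℤ) : Measurable fun z : ℝ≥0 × ℝ≥0 =>
    if z.1 ≤ z.2 then Real.exp (-(m : ℝ) ^ 2 * ((z.2 : ℝ) - z.1) / 2) else 0 :=
  Measurable.ite (measurableSet_le measurable_fst measurable_snd) (by fun_prop) measurable_const

lemma measurable_decayKernel (T : ℝ≥0) (m : ℤ) : Measurable fun s => decayKernel T s m := by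
  simp only [decayKernel_eq_integral]
  exact (measurable_decay_integrand m).stronglyMeasurable.integral_prod_right'.measurable

lemma ae_timeProb_fst_le {Ω : Type*} [MeasurableSpace Ω] (T : ℝ≥0) (P : Measure Ω) [SFinite P] :
    ∀ᵐ z ∂(timeProb T P), z.1 ≤ T := by
  have h : ∀ᵐ t ∂(timeMeasure.restrict (Icc 0 T)), t ≤ T := by
    filter_upwards [ae_restrict_mem measurableSet_Icc] with t ht using ht.2
  exact Measure.quasiMeasurePreserving_fst.ae h

section LinearData

variable {Ω : Type*} {mΩ : MeasurableSpace Ω} {𝓕 : Filtration ℝ≥0 mΩ} {P : Measure Ω}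
  {T : ℝ≥0} {B : ℝ≥0 → Ω → ℝ} {S : Finset ℤ} {a : ℤ → Ω → ℂ} {f : ℤ → ℝ≥0 → Ω → ℂ}
  {ρ : ℝ≥0 → Ω → ℝ}

namespace IsLinearData

/-- The duality bound `pair` is tested on a single mode, whose `L⁴` norm is at most two. -/
lemma norm_f_le (H : IsLinearData 𝓕 P T B S a f ρ) {k : ℤ} (hk : k ∈ S) (s : ℝ≥0) (ω : Ω) : ‖f k s ω‖ ≤ 2 * ρ s ω := by
  have h := H.pair s ω (Pi.single k 1)
  have h1 : ∑ l ∈ S, f l s ω * conj ((Pi.single k 1 : ℤ → ℂ) l) = f k s ω := by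
    rw [Finset.sum_eq_single k]
    · simp
    · intro l _ hl; simp [hl]
    · intro h; exact absurd hk h
  have h2 : trig 4 S (Pi.single k 1) = mode 4 k := by
    rw [trig, Finset.sum_eq_single k]
    · simp
    · intro l _ hl; simp [hl]
    · intro h; exact absurd hk h
  rw [h1, h2] at h
  refine h.trans ?_
  refine (mul_le_mul_of_nonneg_left (norm_mode_four_le k) (H.ρ_nonneg s ω)).trans_eq ?_
  ring

lemma memLp_ρ (H : IsLinearData 𝓕 P T B S a f ρ) (ω : Ω) :
    MemLp (fun s => ρ s ω) (4 / 3) (timeMeasure.restrict (Icc 0 T)) := by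
  obtain ⟨M, hM⟩ := H.ρ_le
  exact ⟨(H.ρ_meas.comp measurable_prodMk_right).aestronglyMeasurable,
    (hM ω).trans_lt ENNReal.coe_lt_top⟩

lemma integrable_ρ (H : IsLinearData 𝓕 P T B S a f ρ) (ω : Ω) :
    Integrable (fun s => ρ s ω) (timeMeasure.restrict (Icc 0 T)) :=
  (H.memLp_ρ ω).integrable instFactFourThirds.out

lemma exists_integral_ρ_le (H : IsLinearData 𝓕 P T B S a f ρ) : ∃ M : ℝ, 0 ≤ M ∧ ∀ ω, ∫ s in Icc 0 T, ρ s ω ∂timeMeasure ≤ M := by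
  obtain ⟨M, hM⟩ := H.ρ_le
  have h1 : MemLp (fun _ : ℝ≥0 => (1 : ℝ)) 4 (timeMeasure.restrict (Icc 0 T)) := memLp_const 1
  refine ⟨M * (eLpNorm (fun _ : ℝ≥0 => (1 : ℝ)) 4 (timeMeasure.restrict (Icc 0 T))).toReal,
    by positivity, fun ω => ?_⟩
  have h2 := integral_mul_le_of_memLp (H.memLp_ρ ω) h1
  simp only [mul_one] at h2
  refine h2.trans ?_
  gcongr
  exact ENNReal.toReal_le_coe_of_le_coe (hM ω)

/-- A crude majorant that grows with `S`. It only serves to make integrals finite and to justify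
Fubini; no quantitative estimate depends on it. -/
lemma exists_norm_amplitude_le (H : IsLinearData 𝓕 P T B S a f ρ) [IsFiniteMeasure P] :
    ∃ h : Ω → ℝ, MemLp h 4 P ∧ (∀ ω, 0 ≤ h ω) ∧
      ∀ ω, ∀ k ∈ S, ∀ t ≤ T, ‖amplitude B a f k t ω‖ ≤ h ω := by
  obtain ⟨M, hM0, hM⟩ := H.exists_integral_ρ_le
  refine ⟨fun ω => ∑ k ∈ S, ‖a k ω‖ + 2 * M, ?_, fun ω => by positivity, fun ω k hk t ht => ?_⟩
  · exact (memLp_finsetSum S fun k _ => (H.a_memLp k).norm).add (memLp_const _)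
  · rw [norm_amplitude, profile]
    refine (norm_add_le _ _).trans (add_le_add ?_ ?_)
    · exact Finset.single_le_sum (f := fun k => ‖a k ω‖) (fun k _ => norm_nonneg _) hk
    · refine (norm_integral_le_integral_norm _).trans ?_
      calc ∫ s in Icc 0 t, ‖propagatorSymbol (-(B s ω)) k * f k s ω‖ ∂timeMeasure
          ≤ ∫ s in Icc 0 t, 2 * ρ s ω ∂timeMeasure := by
            refine integral_mono_of_nonneg (ae_of_all _ fun s => norm_nonneg _)
              (((H.integrable_ρ ω).const_mul 2).mono_measure
                (Measure.restrict_mono (Icc_subset_Icc_right ht) le_rfl))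
              (ae_of_all _ fun s => ?_)
            simp only [norm_mul, norm_propagatorSymbol, one_mul]
            exact H.norm_f_le hk s ω
        _ ≤ ∫ s in Icc 0 T, 2 * ρ s ω ∂timeMeasure := by
            refine setIntegral_mono_set ((H.integrable_ρ ω).const_mul 2)
              (ae_of_all _ fun s => mul_nonneg zero_le_two (H.ρ_nonneg s ω))
              (Icc_subset_Icc_right ht).eventuallyLE
        _ ≤ 2 * M := by
            rw [integral_const_mul]
            exact mul_le_mul_of_nonneg_left (hM ω) zero_le_two

lemma measurable_amplitude_prod (H : IsLinearData 𝓕 P T B S a f ρ) (k : ℤ) :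
    Measurable fun z : ℝ≥0 × Ω => amplitude B a f k z.1 z.2 :=
  (measurable_amplitude H.driver.predictable H.a_meas H.f_pred H.f_int k).mono
    (predictable_le_prod 𝓕) le_rfl

lemma predictable_quadSource (H : IsLinearData 𝓕 P T B S a f ρ) (k l j n : ℤ) :
    IsStronglyPredictable 𝓕 (quadSource B a f k l j n) := by
  refine isStronglyPredictable_of_measurable ?_
  have hd := measurable_amplitude H.driver.predictable H.a_meas H.f_pred H.f_int
  have hf := H.f_pred
  have hc : Measurable (conj : ℂ → ℂ) := Complex.continuous_conj.measurable
  change Measurable[𝓕.predictable] fun z => quadSource B a f k l j n z.1 z.2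
  unfold quadSource
  generalize 𝓕.predictable = m at hd hf ⊢
  exact (((((hf k).mul (hc.comp (hd l))).mul (hc.comp (hd j))).mul (hd n)).add
    ((((hd k).mul (hc.comp (hf l))).mul (hc.comp (hd j))).mul (hd n))).add
    ((((hd k).mul (hc.comp (hd l))).mul (hc.comp (hf j))).mul (hd n)) |>.add
    ((((hd k).mul (hc.comp (hd l))).mul (hc.comp (hd j))).mul (hf n))

lemma measurable_quadSource (H : IsLinearData 𝓕 P T B S a f ρ) (k l j n : ℤ) :
    Measurable fun z : ℝ≥0 × Ω => quadSource B a f k l j n z.1 z.2 :=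
  ((H.predictable_quadSource k l j n).mono (predictable_le_prod 𝓕)).measurable

lemma integrable_quadProd (H : IsLinearData 𝓕 P T B S a f ρ) [IsProbabilityMeasure P] {k l j n : ℤ} (hk : k ∈ S) (hl : l ∈ S)
    (hj : j ∈ S) (hn : n ∈ S) :
    Integrable (fun z : ℝ≥0 × Ω => quadProd (fun k => amplitude B a f k z.1 z.2) k l j n)
      (timeProb T P) := by
  obtain ⟨h, hh, h0, hle⟩ := H.exists_norm_amplitude_le
  have hi : Integrable (fun z : ℝ≥0 × Ω => ‖h z.2‖ ^ 4) (timeProb T P) :=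
    (hh.integrable_norm_pow (by norm_num)).comp_snd _
  have hd := H.measurable_amplitude_prod
  have hc : Measurable (conj : ℂ → ℂ) := Complex.continuous_conj.measurable
  refine hi.mono' ?_ ?_
  · exact ((((hd k).mul (hc.comp (hd l))).mul (hc.comp (hd j))).mul (hd n)).aestronglyMeasurable
  · filter_upwards [ae_timeProb_fst_le T P] with z hz
    simp only [quadProd, norm_mul, RCLike.norm_conj, Real.norm_eq_abs, abs_of_nonneg (h0 z.2)]
    have h1 := fun k hk => hle z.2 k hk z.1 hz
    calc _ ≤ h z.2 * h z.2 * h z.2 * h z.2 := by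
          gcongr
          all_goals first | exact h0 _ | exact mul_nonneg (mul_nonneg (h0 _) (h0 _)) (h0 _) | exact mul_nonneg (h0 _) (h0 _) | skip
          exacts [h1 k hk, h1 l hl, h1 j hj, h1 n hn]
      _ = _ := by ring

lemma integrable_quadSource (H : IsLinearData 𝓕 P T B S a f ρ) [IsProbabilityMeasure P] {k l j n : ℤ} (hk : k ∈ S) (hl : l ∈ S)
    (hj : j ∈ S) (hn : n ∈ S) :
    Integrable (fun z : ℝ≥0 × Ω => quadSource B a f k l j n z.1 z.2) (timeProb T P) := by
  obtain ⟨h, hh, h0, hle⟩ := H.exists_norm_amplitude_le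
  obtain ⟨M, hM0, hM⟩ := H.exists_integral_ρ_le
  have hh3 : Integrable (fun ω => h ω ^ 3) P := by
    have := (hh.mono_exponent (p := 3) (by norm_num)).integrable_norm_pow (by norm_num)
    simpa [abs_of_nonneg (h0 _)] using this
  have hh' : Integrable (fun ω => h ω ^ 3 * M) P := hh3.mul_const M
  -- The source has four terms, each with one factor at most `2 ρ` and three at most `h`.
  have hi : Integrable (fun z : ℝ≥0 × Ω => 8 * (ρ z.1 z.2 * h z.2 ^ 3)) (timeProb T P) := by
    refine Integrable.const_mul ?_ 8
    have hm : AEStronglyMeasurable (fun z : ℝ≥0 × Ω => ρ z.1 z.2 * h z.2 ^ 3) (timeProb T P) :=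
      H.ρ_meas.aestronglyMeasurable.mul hh3.aestronglyMeasurable.comp_snd
    refine (integrable_prod_iff' hm).2 ⟨ae_of_all _ fun ω => (H.integrable_ρ ω).mul_const (h ω ^ 3), ?_⟩
    refine hh'.mono' hm.norm.prod_swap.integral_prod_right' (ae_of_all _ fun ω => ?_)
    have h1 : ∀ s, ‖ρ s ω * h ω ^ 3‖ = ρ s ω * h ω ^ 3 := fun s =>
      Real.norm_of_nonneg (mul_nonneg (H.ρ_nonneg s ω) (pow_nonneg (h0 ω) 3))
    simp only [h1]
    rw [integral_mul_const, mul_comm, Real.norm_of_nonneg (mul_nonneg (pow_nonneg (h0 ω) 3)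
      (integral_nonneg fun s => H.ρ_nonneg s ω))]
    exact mul_le_mul_of_nonneg_left (hM ω) (pow_nonneg (h0 ω) 3)
  refine hi.mono' (H.measurable_quadSource k l j n).aestronglyMeasurable ?_
  filter_upwards [ae_timeProb_fst_le T P] with z hz
  have h1 := fun k hk => hle z.2 k hk z.1 hz
  have h2 := fun k (hk : k ∈ S) => H.norm_f_le hk z.1 z.2
  have hρ := H.ρ_nonneg z.1 z.2
  have h00 := h0 z.2
  have key : ∀ x₁ x₂ x₃ x₄ : ℂ, ‖x₁‖ ≤ 2 * ρ z.1 z.2 → ‖x₂‖ ≤ h z.2 → ‖x₃‖ ≤ h z.2 →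
      ‖x₄‖ ≤ h z.2 → ‖x₁‖ * ‖x₂‖ * ‖x₃‖ * ‖x₄‖ ≤ 2 * (ρ z.1 z.2 * h z.2 ^ 3) := by
    intro x₁ x₂ x₃ x₄ e1 e2 e3 e4
    calc _ ≤ (2 * ρ z.1 z.2) * h z.2 * h z.2 * h z.2 := by gcongr
      _ = _ := by ring
  have k1 := key _ _ _ _ (h2 k hk) (h1 l hl) (h1 j hj) (h1 n hn)
  have k2 := key _ _ _ _ (h2 l hl) (h1 k hk) (h1 j hj) (h1 n hn)
  have k3 := key _ _ _ _ (h2 j hj) (h1 k hk) (h1 l hl) (h1 n hn)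
  have k4 := key _ _ _ _ (h2 n hn) (h1 k hk) (h1 l hl) (h1 j hj)
  unfold quadSource
  refine (norm_add₄_le).trans ?_
  simp only [norm_mul, RCLike.norm_conj]
  nlinarith [k1, k2, k3, k4]

lemma integrable_quadProd_data (H : IsLinearData 𝓕 P T B S a f ρ) [IsProbabilityMeasure P] {k l j n : ℤ} (hk : k ∈ S) (hl : l ∈ S)
    (hj : j ∈ S) (hn : n ∈ S) : Integrable (fun ω => quadProd (fun k => a k ω) k l j n) P := by
  obtain ⟨h, hh, h0, hle⟩ := H.exists_norm_amplitude_le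
  have ha : ∀ k ∈ S, ∀ ω, ‖a k ω‖ ≤ h ω := fun k hk ω => by
    have := hle ω k hk 0 zero_le
    rwa [norm_amplitude, profile_zero] at this
  have hc : Measurable (conj : ℂ → ℂ) := Complex.continuous_conj.measurable
  have hm : ∀ k, Measurable (a k) := fun k => (H.a_meas k).mono (𝓕.le 0) le_rfl
  refine (hh.integrable_norm_pow (by norm_num)).mono'
    ((((hm k).mul (hc.comp (hm l))).mul (hc.comp (hm j))).mul (hm n)).aestronglyMeasurable
    (ae_of_all _ fun ω => ?_)
  simp only [quadProd, norm_mul, RCLike.norm_conj, Real.norm_eq_abs, abs_of_nonneg (h0 ω)]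
  have h00 := h0 ω
  calc _ ≤ h ω * h ω * h ω * h ω := by
        gcongr
        exacts [ha k hk ω, ha l hl ω, ha j hj ω, ha n hn ω]
    _ = h ω ^ 4 := by ring

/-- Expectation of a resonant product of four coefficients, integrated in time. -/
lemma integral_quadProd (H : IsLinearData 𝓕 P T B S a f ρ) [IsProbabilityMeasure P] {k l j n : ℤ} (hk : k ∈ S) (hl : l ∈ S)
    (hj : j ∈ S) (hn : n ∈ S) (hres : k + n = l + j) :
    ∫ z, quadProd (fun k => amplitude B a f k z.1 z.2) k l j n ∂(timeProb T P) =
      (decayKernel T 0 (2 * (k - l) * (k - j)) : ℂ) * ∫ ω, quadProd (fun k => a k ω) k l j n ∂P +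
      ∫ z : ℝ≥0 × Ω, (decayKernel T z.1 (2 * (k - l) * (k - j)) : ℂ) *
        quadSource B a f k l j n z.1 z.2 ∂(timeProb T P) := by
  set m : ℤ := 2 * (k - l) * (k - j) with hm
  set μ := timeMeasure.restrict (Icc 0 T) with hμ
  set G : ℝ≥0 → Ω → ℂ := quadSource B a f k l j n with hGdef
  have hG : Integrable (fun z : ℝ≥0 × Ω => G z.1 z.2) (μ.prod P) :=
    H.integrable_quadSource hk hl hj hn
  have hBm : Measurable (Function.uncurry B) :=
    H.driver.predictable.mono (predictable_le_prod 𝓕) le_rfl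
  set Z : Ω → ℂ := fun ω => quadProd (fun k => a k ω) k l j n with hZ
  have hZm : Measurable[𝓕 0] Z := by
    have hc : Measurable (conj : ℂ → ℂ) := Complex.continuous_conj.measurable
    exact (((H.a_meas k).mul (hc.comp (H.a_meas l))).mul (hc.comp (H.a_meas j))).mul (H.a_meas n)
  have hGs : ∀ s, StronglyMeasurable[𝓕 s] (G s) :=
    (H.predictable_quadSource k l j n).stronglyAdapted
  have hZint : Integrable Z P := H.integrable_quadProd_data hk hl hj hn
  set e : ℝ≥0 → ℝ≥0 → ℝ := fun s t => Real.exp (-(m : ℝ) ^ 2 * ((t : ℝ) - s) / 2) with he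
  set g : ℝ≥0 → ℂ := fun s => ∫ ω, G s ω ∂P with hg
  have hgint : Integrable g μ := hG.integral_prod_left
  have hquad := H.integrable_quadProd hk hl hj hn
  -- expectation at a fixed time
  have hfix : ∀ t ∈ Icc 0 T, ∫ ω, quadProd (fun k => amplitude B a f k t ω) k l j n ∂P =
      (e 0 t : ℂ) * ∫ ω, Z ω ∂P + ∫ s, ((if s ≤ t then e s t else 0 : ℝ) : ℂ) * g s ∂μ := by
    intro t ht
    -- The cutoff `s ≤ t` moves into the integrand, so that time and expectation can be exchanged on
    -- a fixed interval.
    set c : ℝ≥0 → Ω → ℂ := fun s ω =>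
      if s ≤ t then Complex.exp (Complex.I * m * ((B t ω - B s ω : ℝ) : ℂ)) else 0 with hc
    have hBt : Measurable (B t) := hBm.comp measurable_prodMk_left
    have hcm : Measurable fun z : ℝ≥0 × Ω => c z.1 z.2 := by
      have hBm' : Measurable fun z : ℝ≥0 × Ω => B z.1 z.2 := hBm
      exact Measurable.ite (measurableSet_le measurable_fst measurable_const)
        (by fun_prop) measurable_const
    have hexp : ∀ x : ℝ, ‖Complex.exp (Complex.I * m * (x : ℂ))‖ = 1 := fun x => by
      have : Complex.I * m * (x : ℂ) = ((m * x : ℝ) : ℂ) * Complex.I := by push_cast; ring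
      rw [this, Complex.norm_exp_ofReal_mul_I]
    have hc1 : ∀ s ω, ‖c s ω‖ ≤ 1 := fun s ω => by
      simp only [hc]
      split_ifs
      · exact (hexp _).le
      · simp
    have hcG : Integrable (fun z : ℝ≥0 × Ω => c z.1 z.2 * G z.1 z.2) (μ.prod P) :=
      hG.bdd_mul (c := 1) hcm.aestronglyMeasurable (ae_of_all _ fun z => hc1 z.1 z.2)
    have hform : ∀ ω, quadProd (fun k => amplitude B a f k t ω) k l j n =
        Complex.exp (Complex.I * m * ((B t ω - B 0 ω : ℝ) : ℂ)) * Z ω +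
          ∫ s, c s ω * G s ω ∂μ := by
      intro ω
      rw [quadProd_amplitude H.driver.predictable H.f_int hres t ω, H.driver.zero ω, sub_zero]
      congr 1
      rw [← integral_indicator measurableSet_Icc, ← integral_indicator measurableSet_Icc]
      refine integral_congr_ae (ae_of_all _ fun s => ?_)
      by_cases h1 : s ≤ t
      · simp [indicator, h1, h1.trans ht.2, hc, hm, hGdef]
      · simp [indicator, h1, hc]
    simp only [hform]
    rw [integral_add _ hcG.integral_prod_right]
    · congr 1
      · exact H.driver.integral_exp_mul 0 t zero_le m Z hZm.stronglyMeasurable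
      · rw [integral_integral_swap (f := fun ω s => c s ω * G s ω) hcG.swap]
        refine integral_congr_ae (ae_of_all _ fun s => ?_)
        by_cases h1 : s ≤ t
        · simp only [hc, h1, if_true, hg]
          -- The source at time `s` is `𝓕 s`-measurable, so the increment after `s` averages to its
          -- Gaussian decay.
          exact H.driver.integral_exp_mul s t h1 m (G s) (hGs s)
        · simp [hc, h1]
    · have hB0 : Measurable (B 0) := hBm.comp measurable_prodMk_left
      exact hZint.bdd_mul (c := 1) (Measurable.aestronglyMeasurable (by fun_prop))
        (ae_of_all _ fun ω => (hexp _).le)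
  rw [timeProb, integral_prod _ hquad, setIntegral_congr_fun measurableSet_Icc hfix]
  have he1 : ∀ s t : ℝ≥0, s ≤ t → ‖e s t‖ ≤ 1 := by
    intro s t h
    rw [Real.norm_eq_abs, Real.abs_exp, Real.exp_le_one_iff]
    have : (s : ℝ) ≤ t := by exact_mod_cast h
    have := mul_nonneg (sq_nonneg (m : ℝ)) (sub_nonneg.2 this)
    linarith
  have hswap : Integrable (fun z : ℝ≥0 × ℝ≥0 =>
      ((if z.2 ≤ z.1 then e z.2 z.1 else 0 : ℝ) : ℂ) * g z.2) (μ.prod μ) := by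
    have h1 : Integrable (fun z : ℝ≥0 × ℝ≥0 => g z.2) (μ.prod μ) := hgint.comp_snd μ
    have h2 : Measurable fun z : ℝ≥0 × ℝ≥0 =>
        ((if z.2 ≤ z.1 then e z.2 z.1 else 0 : ℝ) : ℂ) :=
      Complex.measurable_ofReal.comp ((measurable_decay_integrand m).comp measurable_swap)
    refine h1.bdd_mul (c := 1) h2.aestronglyMeasurable (ae_of_all _ fun z => ?_)
    rw [Complex.norm_real]
    split_ifs with h
    · exact he1 _ _ h
    · simp
  have he0 : Integrable (fun t => (e 0 t : ℂ)) μ :=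
    Integrable.of_bound (C := 1) (Measurable.aestronglyMeasurable (by fun_prop))
      (ae_of_all _ fun t => by rw [Complex.norm_real]; exact he1 _ _ zero_le)
  rw [integral_add (he0.mul_const _) hswap.integral_prod_left, integral_mul_const]
  congr 1
  · congr 1
    rw [integral_complex_ofReal, decayKernel]
  -- Integrating first over the later time `t` collects the decay into `decayKernel T s m`.
  · rw [integral_integral_swap hswap, integral_prod]
    · refine integral_congr_ae (ae_of_all _ fun s => ?_)
      simp only
      rw [integral_mul_const, integral_const_mul, integral_complex_ofReal, decayKernel_eq_integral]
    · refine hG.bdd_mul (c := T) ?_ (ae_of_all _ fun z => ?_)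
      · exact (Complex.measurable_ofReal.comp
          ((measurable_decayKernel T m).comp measurable_fst)).aestronglyMeasurable
      · rw [Complex.norm_real, Real.norm_of_nonneg (decayKernel_nonneg _ _ _)]
        exact decayKernel_le _ _ _

end IsLinearData

end LinearData

end WND
end

/-! ### The fourth moment of the Galerkin solution through quartic forms. -/

noncomputable section
namespace WND

open ComplexConjugate Set Filter Topology

lemma sum_swap_first_last (S : Finset ℤ) (A : ℤ → ℤ → ℤ → ℤ → ℂ) :
    ∑ k ∈ S, ∑ l ∈ S, ∑ j ∈ S, ∑ n ∈ S, A k l j n =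
      ∑ k ∈ S, ∑ l ∈ S, ∑ j ∈ S, ∑ n ∈ S, A n l j k := by
  have h : ∀ A : ℤ → ℤ → ℤ → ℤ → ℂ, ∑ k ∈ S, ∑ l ∈ S, ∑ j ∈ S, ∑ n ∈ S, A k l j n =
      ∑ l ∈ S, ∑ j ∈ S, ∑ k ∈ S, ∑ n ∈ S, A k l j n := by
    intro A
    rw [Finset.sum_comm]
    exact Finset.sum_congr rfl fun l _ => Finset.sum_comm
  rw [h A, h fun k l j n => A n l j k]
  exact Finset.sum_congr rfl fun l _ => Finset.sum_congr rfl fun j _ => Finset.sum_comm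

lemma sum_swap_pairs (S : Finset ℤ) (A : ℤ → ℤ → ℤ → ℤ → ℂ) :
    ∑ k ∈ S, ∑ l ∈ S, ∑ j ∈ S, ∑ n ∈ S, A k l j n =
      ∑ k ∈ S, ∑ l ∈ S, ∑ j ∈ S, ∑ n ∈ S, A l k n j := by
  rw [Finset.sum_comm]
  exact Finset.sum_congr rfl fun l _ => Finset.sum_congr rfl fun j _ => Finset.sum_comm

lemma sum_swap_middle (S : Finset ℤ) (A : ℤ → ℤ → ℤ → ℤ → ℂ) :
    ∑ k ∈ S, ∑ l ∈ S, ∑ j ∈ S, ∑ n ∈ S, A k l j n =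
      ∑ k ∈ S, ∑ l ∈ S, ∑ j ∈ S, ∑ n ∈ S, A k j l n :=
  Finset.sum_congr rfl fun _ _ => Finset.sum_comm

/-- The quartic form of the time derivative of four coefficients. -/
def sourceForm (S : Finset ℤ) (κ : ℤ → ℝ) (g d : ℤ → ℂ) : ℂ :=
  ∑ k ∈ S, ∑ l ∈ S, ∑ j ∈ S, ∑ n ∈ S,
    if k + n = l + j then (κ (2 * (k - l) * (k - j)) : ℂ) *
      (g k * conj (d l) * conj (d j) * d n + d k * conj (g l) * conj (d j) * d n +
        d k * conj (d l) * conj (g j) * d n + d k * conj (d l) * conj (d j) * g n)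
    else 0

/-- All four terms come from a single one. Exchanging `k` with `n`, or `l` with `j`, preserves the
resonance and the value of `2(k-l)(k-j)`. Conjugation together with `k ↔ l` and `j ↔ n` changes its
sign, which an even kernel does not see. Hence it suffices to estimate the form with the forcing in
the first slot. -/
lemma sourceForm_eq (S : Finset ℤ) (κ : ℤ → ℝ) (hκ : ∀ m, κ (-m) = κ m) (g d : ℤ → ℂ) :
    sourceForm S κ g d = 2 * quarticForm S κ g d + 2 * conj (quarticForm S κ g d) := by
  have h4 : quarticForm S κ g d = ∑ k ∈ S, ∑ l ∈ S, ∑ j ∈ S, ∑ n ∈ S,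
      if k + n = l + j then (κ (2 * (k - l) * (k - j)) : ℂ) *
        (d k * conj (d l) * conj (d j) * g n) else 0 := by
    rw [quarticForm, sum_swap_first_last]
    refine Finset.sum_congr rfl fun k _ => Finset.sum_congr rfl fun l _ =>
      Finset.sum_congr rfl fun j _ => Finset.sum_congr rfl fun n _ => ?_
    by_cases h : k + n = l + j
    · have e : 2 * (n - l) * (n - j) = 2 * (k - l) * (k - j) := by
        have : n = l + j - k := by linarith
        subst this; ring
      rw [if_pos h, if_pos (by linarith), e]
      ring
    · rw [if_neg h, if_neg (fun h' => h (by linarith))]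
  have h2 : conj (quarticForm S κ g d) = ∑ k ∈ S, ∑ l ∈ S, ∑ j ∈ S, ∑ n ∈ S,
      if k + n = l + j then (κ (2 * (k - l) * (k - j)) : ℂ) *
        (d k * conj (g l) * conj (d j) * d n) else 0 := by
    rw [quarticForm, sum_swap_pairs]
    simp only [map_sum]
    refine Finset.sum_congr rfl fun k _ => Finset.sum_congr rfl fun l _ =>
      Finset.sum_congr rfl fun j _ => Finset.sum_congr rfl fun n _ => ?_
    by_cases h : k + n = l + j
    · have e : 2 * (l - k) * (l - n) = -(2 * (k - l) * (k - j)) := by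
        have : n = l + j - k := by linarith
        subst this; ring
      rw [if_pos h, if_pos (by linarith), e, hκ]
      simp only [map_mul, Complex.conj_conj, Complex.conj_ofReal]
      ring
    · rw [if_neg h, if_neg (fun h' => h (by linarith)), map_zero]
  have h3 : conj (quarticForm S κ g d) = ∑ k ∈ S, ∑ l ∈ S, ∑ j ∈ S, ∑ n ∈ S,
      if k + n = l + j then (κ (2 * (k - l) * (k - j)) : ℂ) *
        (d k * conj (d l) * conj (g j) * d n) else 0 := by
    rw [h2, sum_swap_middle]
    refine Finset.sum_congr rfl fun k _ => Finset.sum_congr rfl fun l _ =>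
      Finset.sum_congr rfl fun j _ => Finset.sum_congr rfl fun n _ => ?_
    have e : 2 * (k - j) * (k - l) = 2 * (k - l) * (k - j) := by ring
    rw [e, add_comm j l]
    split_ifs
    · ring
    · rfl
  have h1 : sourceForm S κ g d = quarticForm S κ g d +
      (∑ k ∈ S, ∑ l ∈ S, ∑ j ∈ S, ∑ n ∈ S,
        if k + n = l + j then (κ (2 * (k - l) * (k - j)) : ℂ) *
          (d k * conj (g l) * conj (d j) * d n) else 0) +
      (∑ k ∈ S, ∑ l ∈ S, ∑ j ∈ S, ∑ n ∈ S,
        if k + n = l + j then (κ (2 * (k - l) * (k - j)) : ℂ) *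
          (d k * conj (d l) * conj (g j) * d n) else 0) +
      (∑ k ∈ S, ∑ l ∈ S, ∑ j ∈ S, ∑ n ∈ S,
        if k + n = l + j then (κ (2 * (k - l) * (k - j)) : ℂ) *
          (d k * conj (d l) * conj (d j) * g n) else 0) := by
    rw [quarticForm, sourceForm]
    simp only [← Finset.sum_add_distrib]
    refine Finset.sum_congr rfl fun k _ => Finset.sum_congr rfl fun l _ =>
      Finset.sum_congr rfl fun j _ => Finset.sum_congr rfl fun n _ => ?_
    split_ifs
    · ring
    · simp
  rw [h1, ← h2, ← h3, ← h4]
  ring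

lemma norm_sourceForm_le (S : Finset ℤ) (κ : ℤ → ℝ) (hκ : ∀ m, κ (-m) = κ m) (g d : ℤ → ℂ) :
    ‖sourceForm S κ g d‖ ≤ 4 * ‖quarticForm S κ g d‖ := by
  rw [sourceForm_eq S κ hκ]
  refine (norm_add_le _ _).trans ?_
  rw [norm_mul, norm_mul, RCLike.norm_conj, Complex.norm_ofNat]
  linarith

lemma decayKernel_neg (T s : ℝ≥0) (m : ℤ) : decayKernel T s (-m) = decayKernel T s m := by
  simp [decayKernel]

/-- The kernel at zero phase has no decay, but it is at most `T ≤ ε⁴ ≤ ε`; hence degenerate and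
oscillating quadruples gain the same factor. -/
lemma norm_quarticForm_decayKernel_le {T s : ℝ≥0} {ε : ℝ} (hε : 0 ≤ ε) (hε1 : ε ≤ 1)
    (hT : (T : ℝ) ≤ ε ^ 4) (S : Finset ℤ) (f d : ℤ → ℂ) {φ δ : ℝ} (hf : ∀ k ∈ S, ‖f k‖ ≤ φ)
    (hφ : 0 ≤ φ) (hδ : 0 ≤ δ) (hd : ∑ k ∈ S, ‖d k‖ ^ 2 ≤ δ ^ 2) :
    ‖quarticForm S (decayKernel T s) f d‖ ≤
      ε * (2 * ‖∑ k ∈ S, f k * conj (d k)‖ * δ ^ 2 + resConst ^ 2 * φ * δ ^ 3) := by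
  refine norm_quarticForm_le S _ ?_ (fun a b ha hb => decayKernel_two_mul_le hε hT ha hb) f d hf hφ
    hδ hd
  rw [abs_of_nonneg (decayKernel_nonneg _ _ _)]
  refine (decayKernel_le _ _ _).trans (hT.trans ?_)
  calc ε ^ 4 = ε * ε ^ 3 := by ring
    _ ≤ ε * 1 := by gcongr; exact pow_le_one₀ hε hε1
    _ = ε := mul_one _

section LinearData

variable {Ω : Type*} {mΩ : MeasurableSpace Ω} {𝓕 : Filtration ℝ≥0 mΩ} {P : Measure Ω}
  {T : ℝ≥0} {B : ℝ≥0 → Ω → ℝ} {S : Finset ℤ} {a : ℤ → Ω → ℂ} {f : ℤ → ℝ≥0 → Ω → ℂ}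
  {ρ : ℝ≥0 → Ω → ℝ}

/-- The trigonometric polynomial with the coefficients `amplitude` on the frequencies `S`. -/
def galerkin (B : ℝ≥0 → Ω → ℝ) (S : Finset ℤ) (a : ℤ → Ω → ℂ) (f : ℤ → ℝ≥0 → Ω → ℂ) (t : ℝ≥0)
    (ω : Ω) : LTorus 4 :=
  trig 4 S fun k => amplitude B a f k t ω

lemma norm_trig_four_le (S : Finset ℤ) (d : ℤ → ℂ) : ‖trig 4 S d‖ ≤ ∑ k ∈ S, ‖d k‖ * 2 := by
  refine (norm_sum_le _ _).trans (Finset.sum_le_sum fun k _ => ?_)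
  rw [norm_smul]
  exact mul_le_mul_of_nonneg_left (norm_mode_four_le k) (norm_nonneg _)

namespace IsLinearData

lemma predictable_galerkin (H : IsLinearData 𝓕 P T B S a f ρ) : IsStronglyPredictable 𝓕 (galerkin B S a f) := by
  have hd := measurable_amplitude H.driver.predictable H.a_meas H.f_pred H.f_int
  change StronglyMeasurable[𝓕.predictable] fun z : ℝ≥0 × Ω => galerkin B S a f z.1 z.2
  unfold galerkin trig
  generalize 𝓕.predictable = m at hd ⊢
  exact Finset.stronglyMeasurable_fun_sum _ fun k _ => (hd k).stronglyMeasurable.smul_const _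

lemma stronglyMeasurable_galerkin (H : IsLinearData 𝓕 P T B S a f ρ) :
    StronglyMeasurable fun z : ℝ≥0 × Ω => galerkin B S a f z.1 z.2 :=
  H.predictable_galerkin.mono (predictable_le_prod 𝓕)

lemma integrable_norm_galerkin_pow (H : IsLinearData 𝓕 P T B S a f ρ) [IsProbabilityMeasure P] :
    Integrable (fun z : ℝ≥0 × Ω => ‖galerkin B S a f z.1 z.2‖ ^ 4) (timeProb T P) := by
  obtain ⟨h, hh, h0, hle⟩ := H.exists_norm_amplitude_le
  have hi : Integrable (fun z : ℝ≥0 × Ω => ‖∑ _k ∈ S, h z.2 * 2‖ ^ 4) (timeProb T P) :=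
    ((memLp_finsetSum S fun k _ => hh.mul_const 2).integrable_norm_pow (by norm_num)).comp_snd _
  refine hi.mono' (H.stronglyMeasurable_galerkin.norm.pow 4).aestronglyMeasurable ?_
  filter_upwards [ae_timeProb_fst_le T P] with z hz
  rw [Real.norm_of_nonneg (by positivity)]
  gcongr
  refine (norm_trig_four_le S _).trans ((Finset.sum_le_sum fun k hk => ?_).trans (le_abs_self _))
  have := hle z.2 k hk z.1 hz
  gcongr

lemma memLp_galerkin (H : IsLinearData 𝓕 P T B S a f ρ) [IsFiniteMeasure P] (ω : Ω) :
    MemLp (fun t => galerkin B S a f t ω) 4 (timeMeasure.restrict (Icc 0 T)) := by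
  obtain ⟨h, hh, h0, hle⟩ := H.exists_norm_amplitude_le
  refine MemLp.of_bound (H.stronglyMeasurable_galerkin.comp_measurable
    measurable_prodMk_right).aestronglyMeasurable (∑ _k ∈ S, h ω * 2) ?_
  filter_upwards [ae_restrict_mem measurableSet_Icc] with t ht
  refine (norm_trig_four_le S _).trans (Finset.sum_le_sum fun k hk => ?_)
  have := hle ω k hk t ht.2
  gcongr

/-- The identity behind the linear estimate, with the triangle inequality applied to it. -/
lemma integral_norm_galerkin_pow_le (H : IsLinearData 𝓕 P T B S a f ρ) [IsProbabilityMeasure P] :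
    ∫ z, ‖galerkin B S a f z.1 z.2‖ ^ 4 ∂(timeProb T P) ≤
      2 * Real.pi * (∫ ω, ‖quarticForm S (decayKernel T 0) (fun k => a k ω) (fun k => a k ω)‖ ∂P +
      ∫ z : ℝ≥0 × Ω, ‖sourceForm S (decayKernel T z.1) (fun k => f k z.1 z.2)
        (fun k => amplitude B a f k z.1 z.2)‖ ∂(timeProb T P)) := by
  -- The identity holds for each resonant quadruple by `integral_quadProd`. It is summed before any
  -- norm is taken, since the symmetric structure of the source is needed to recover the pairing
  -- with the forcing.
  have key : ((∫ z, ‖galerkin B S a f z.1 z.2‖ ^ 4 ∂(timeProb T P) : ℝ) : ℂ) =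
      2 * Real.pi * (∫ ω, quarticForm S (decayKernel T 0) (fun k => a k ω) (fun k => a k ω) ∂P +
      ∫ z : ℝ≥0 × Ω, sourceForm S (decayKernel T z.1) (fun k => f k z.1 z.2)
        (fun k => amplitude B a f k z.1 z.2) ∂(timeProb T P)) := by
    have e0 : ∀ z : ℝ≥0 × Ω, ((‖galerkin B S a f z.1 z.2‖ ^ 4 : ℝ) : ℂ) =
        2 * Real.pi * ∑ q ∈ S ×ˢ S ×ˢ S ×ˢ S, if q.1 + q.2.2.2 = q.2.1 + q.2.2.1 then
          quadProd (fun k => amplitude B a f k z.1 z.2) q.1 q.2.1 q.2.2.1 q.2.2.2 else 0 := by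
      intro z
      rw [galerkin, norm_trig_four_pow, quarticForm]
      simp only [Finset.sum_product, quadProd, Complex.ofReal_one, one_mul]
    have e1 : ∀ ω, quarticForm S (decayKernel T 0) (fun k => a k ω) (fun k => a k ω) =
        ∑ q ∈ S ×ˢ S ×ˢ S ×ˢ S, if q.1 + q.2.2.2 = q.2.1 + q.2.2.1 then
          (decayKernel T 0 (2 * (q.1 - q.2.1) * (q.1 - q.2.2.1)) : ℂ) *
            quadProd (fun k => a k ω) q.1 q.2.1 q.2.2.1 q.2.2.2 else 0 := by
      intro ω
      simp only [Finset.sum_product, quadProd, quarticForm]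
    have e2 : ∀ z : ℝ≥0 × Ω, sourceForm S (decayKernel T z.1) (fun k => f k z.1 z.2)
          (fun k => amplitude B a f k z.1 z.2) =
        ∑ q ∈ S ×ˢ S ×ˢ S ×ˢ S, if q.1 + q.2.2.2 = q.2.1 + q.2.2.1 then
          (decayKernel T z.1 (2 * (q.1 - q.2.1) * (q.1 - q.2.2.1)) : ℂ) *
            quadSource B a f q.1 q.2.1 q.2.2.1 q.2.2.2 z.1 z.2 else 0 := by
      intro z
      simp only [Finset.sum_product, quadSource, sourceForm]
    rw [← integral_complex_ofReal]
    simp only [e0, e1, e2]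
    rw [integral_const_mul]
    congr 1
    have hmem : ∀ q ∈ S ×ˢ S ×ˢ S ×ˢ S, q.1 ∈ S ∧ q.2.1 ∈ S ∧ q.2.2.1 ∈ S ∧ q.2.2.2 ∈ S := by
      intro q hq
      simpa [Finset.mem_product] using hq
    rw [integral_finsetSum, integral_finsetSum, integral_finsetSum, ← Finset.sum_add_distrib]
    · refine Finset.sum_congr rfl fun q hq => ?_
      obtain ⟨h1, h2, h3, h4⟩ := hmem q hq
      split_ifs with h
      · rw [H.integral_quadProd h1 h2 h3 h4 h, integral_const_mul]
      · simp
    · intro q hq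
      obtain ⟨h1, h2, h3, h4⟩ := hmem q hq
      split_ifs with h
      · refine (H.integrable_quadSource h1 h2 h3 h4).bdd_mul (c := T) ?_ (ae_of_all _ fun z => ?_)
        · exact (Complex.measurable_ofReal.comp
            ((measurable_decayKernel T _).comp measurable_fst)).aestronglyMeasurable
        · rw [Complex.norm_real, Real.norm_of_nonneg (decayKernel_nonneg _ _ _)]
          exact decayKernel_le _ _ _
      · exact integrable_zero _ _ _
    · intro q hq
      obtain ⟨h1, h2, h3, h4⟩ := hmem q hq
      split_ifs with h
      · exact (H.integrable_quadProd_data h1 h2 h3 h4).const_mul _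
      · exact integrable_zero _ _ _
    · intro q hq
      obtain ⟨h1, h2, h3, h4⟩ := hmem q hq
      split_ifs with h
      · exact H.integrable_quadProd h1 h2 h3 h4
      · exact integrable_zero _ _ _
  have h1 := congrArg norm key
  rw [Complex.norm_real, Real.norm_of_nonneg (integral_nonneg fun z => by positivity)] at h1
  rw [h1, norm_mul, norm_mul, Complex.norm_ofNat, Complex.norm_real,
    Real.norm_of_nonneg Real.pi_pos.le]
  gcongr
  refine (norm_add_le _ _).trans (add_le_add ?_ ?_)
  · exact norm_integral_le_integral_norm _
  · exact norm_integral_le_integral_norm _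

end IsLinearData

end LinearData

end WND
end

/-! ### The stochastic Strichartz inequality. -/

noncomputable section
namespace WND

open ComplexConjugate Set Filter Topology

section Slices

variable {Ω : Type*} {mΩ : MeasurableSpace Ω} {P : Measure Ω} {T : ℝ≥0}

lemma measurable_eLpNorm_slice {E : Type*} [NormedAddCommGroup E] {g : ℝ≥0 → Ω → E}
    (hg : StronglyMeasurable fun z : ℝ≥0 × Ω => g z.1 z.2) {p : ℝ≥0∞} (hp0 : p ≠ 0) (hp : p ≠ ∞)
    (μ : Measure ℝ≥0) [SFinite μ] : Measurable fun ω => eLpNorm (fun s => g s ω) p μ := by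
  simp only [eLpNorm_eq_lintegral_rpow_enorm_toReal hp0 hp]
  exact (Measurable.lintegral_prod_left' (hg.enorm.pow_const _)).pow_const _

lemma integral_timeProb_le [SFinite P] {R : ℝ≥0 × Ω → ℝ}
    (hm : AEStronglyMeasurable R (timeProb T P)) (h0 : ∀ z, 0 ≤ R z)
    (hintegrable : ∀ ω, Integrable (fun t => R (t, ω)) (timeMeasure.restrict (Icc 0 T)))
    {g : Ω → ℝ} (hg : Integrable g P) (hle : ∀ ω, ∫ t in Icc 0 T, R (t, ω) ∂timeMeasure ≤ g ω) :
    Integrable R (timeProb T P) ∧ ∫ z, R z ∂(timeProb T P) ≤ ∫ ω, g ω ∂P := by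
  have h1 : Integrable R (timeProb T P) := by
    refine (integrable_prod_iff' hm).2 ⟨ae_of_all _ hintegrable, ?_⟩
    refine hg.mono' hm.norm.prod_swap.integral_prod_right' (ae_of_all _ fun ω => ?_)
    rw [Real.norm_of_nonneg (integral_nonneg fun _ => norm_nonneg _)]
    simp only [Real.norm_of_nonneg (h0 _)]
    exact hle ω
  refine ⟨h1, ?_⟩
  rw [timeProb, integral_prod_symm _ h1]
  exact integral_mono h1.integral_prod_right hg hle

end Slices

/-- The constant in the linear estimate. -/
def strichartzConst : ℝ := 2 * Real.pi * (218 * (1 + resConst ^ 2))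

lemma strichartzConst_pos : 0 < strichartzConst := by
  unfold strichartzConst; positivity

section LinearData

variable {Ω : Type*} {mΩ : MeasurableSpace Ω} {𝓕 : Filtration ℝ≥0 mΩ} {P : Measure Ω}
  {T : ℝ≥0} {B : ℝ≥0 → Ω → ℝ} {S : Finset ℤ} {a : ℤ → Ω → ℂ} {f : ℤ → ℝ≥0 → Ω → ℂ}
  {ρ : ℝ≥0 → Ω → ℝ}

/-- The `L⁴` norm in time and space of the Galerkin solution. -/
def solNorm (T : ℝ≥0) (B : ℝ≥0 → Ω → ℝ) (S : Finset ℤ) (a : ℤ → Ω → ℂ) (f : ℤ → ℝ≥0 → Ω → ℂ)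
    (ω : Ω) : ℝ :=
  (eLpNorm (fun t => galerkin B S a f t ω) 4 (timeMeasure.restrict (Icc 0 T))).toReal

/-- The `L^{4/3}` norm in time of the size of the forcing. -/
def forceNorm (T : ℝ≥0) (ρ : ℝ≥0 → Ω → ℝ) (ω : Ω) : ℝ :=
  (eLpNorm (fun s => ρ s ω) (4 / 3) (timeMeasure.restrict (Icc 0 T))).toReal

/-- The `ℓ²` norm of the data on the frequencies `S`. -/
def dataNorm (S : Finset ℤ) (a : ℤ → Ω → ℂ) (ω : Ω) : ℝ := √(∑ k ∈ S, ‖a k ω‖ ^ 2)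

lemma solNorm_nonneg (ω : Ω) : 0 ≤ solNorm T B S a f ω := ENNReal.toReal_nonneg

lemma forceNorm_nonneg (ω : Ω) : 0 ≤ forceNorm T ρ ω := ENNReal.toReal_nonneg

lemma dataNorm_nonneg (ω : Ω) : 0 ≤ dataNorm S a ω := Real.sqrt_nonneg _

lemma dataNorm_sq (ω : Ω) : dataNorm S a ω ^ 2 = ∑ k ∈ S, ‖a k ω‖ ^ 2 :=
  Real.sq_sqrt (Finset.sum_nonneg fun _ _ => sq_nonneg _)

namespace IsLinearData

lemma integrable_ρ_mul (H : IsLinearData 𝓕 P T B S a f ρ) [IsFiniteMeasure P] (ω : Ω) :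
    Integrable (fun s => ρ s ω * ‖galerkin B S a f s ω‖) (timeMeasure.restrict (Icc 0 T)) :=
  memLp_one_iff_integrable.1 ((H.memLp_galerkin ω).norm.mul (H.memLp_ρ ω))

lemma integral_ρ_mul_le (H : IsLinearData 𝓕 P T B S a f ρ) [IsFiniteMeasure P] (ω : Ω) :
    ∫ s in Icc 0 T, ρ s ω * ‖galerkin B S a f s ω‖ ∂timeMeasure ≤
      forceNorm T ρ ω * solNorm T B S a f ω := by
  have := integral_mul_le_of_memLp (H.memLp_ρ ω) (H.memLp_galerkin ω).norm
  rwa [eLpNorm_norm] at this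

lemma integral_ρ_le (H : IsLinearData 𝓕 P T B S a f ρ) (hT : T ≤ 1) (ω : Ω) :
    ∫ s in Icc 0 T, ρ s ω ∂timeMeasure ≤ forceNorm T ρ ω := by
  have h1 : MemLp (fun _ : ℝ≥0 => (1 : ℝ)) 4 (timeMeasure.restrict (Icc 0 T)) := memLp_const 1
  have h2 := integral_mul_le_of_memLp (H.memLp_ρ ω) h1
  simp only [mul_one] at h2
  refine h2.trans (mul_le_of_le_one_right (forceNorm_nonneg ω) ?_)
  have h3 := toReal_eLpNorm_four_pow h1.1
  have h4 : (eLpNorm (fun _ : ℝ≥0 => (1 : ℝ)) 4 (timeMeasure.restrict (Icc 0 T))).toReal ^ 4 ≤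
      1 ^ 4 := by
    rw [h3]
    simp only [norm_one, one_pow, integral_const, smul_eq_mul, mul_one]
    rw [measureReal_def, Measure.restrict_apply_univ, timeMeasure_Icc_zero]
    exact_mod_cast hT
  exact le_of_pow_le_pow_left₀ (by norm_num) (by norm_num) h4

/-- The energy inequality. -/
lemma sum_sq_amplitude_le (H : IsLinearData 𝓕 P T B S a f ρ) [IsFiniteMeasure P] {t : ℝ≥0} (ht : t ≤ T) (ω : Ω) :
    ∑ k ∈ S, ‖amplitude B a f k t ω‖ ^ 2 ≤
      dataNorm S a ω ^ 2 + 2 * (forceNorm T ρ ω * solNorm T B S a f ω) := by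
  obtain ⟨h1, h2⟩ := sum_sq_amplitude (a := a) H.driver.predictable H.f_int S t ω
  rw [h1, dataNorm_sq]
  gcongr
  calc ∫ s in Icc 0 t, (∑ k ∈ S, f k s ω * conj (amplitude B a f k s ω)).re ∂timeMeasure
      ≤ ∫ s in Icc 0 t, ρ s ω * ‖galerkin B S a f s ω‖ ∂timeMeasure := by
        refine integral_mono h2 ((H.integrable_ρ_mul ω).mono_measure
          (Measure.restrict_mono (Icc_subset_Icc_right ht) le_rfl)) fun s => ?_
        exact (Complex.re_le_norm _).trans (H.pair s ω _)
    _ ≤ ∫ s in Icc 0 T, ρ s ω * ‖galerkin B S a f s ω‖ ∂timeMeasure :=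
        setIntegral_mono_set (H.integrable_ρ_mul ω)
          (ae_of_all _ fun s => mul_nonneg (H.ρ_nonneg s ω) (norm_nonneg _))
          (Icc_subset_Icc_right ht).eventuallyLE
    _ ≤ _ := H.integral_ρ_mul_le ω

lemma measurable_solNorm (H : IsLinearData 𝓕 P T B S a f ρ) : Measurable (solNorm T B S a f) :=
  (measurable_eLpNorm_slice H.stronglyMeasurable_galerkin (by norm_num) (by norm_num)
    _).ennreal_toReal

lemma measurable_forceNorm (H : IsLinearData 𝓕 P T B S a f ρ) : Measurable (forceNorm T ρ) :=
  (measurable_eLpNorm_slice H.ρ_meas.stronglyMeasurable (ne_of_gt (zero_lt_one.trans_le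
    instFactFourThirds.out)) (ENNReal.div_ne_top (by norm_num) (by norm_num)) _).ennreal_toReal

lemma measurable_dataNorm (H : IsLinearData 𝓕 P T B S a f ρ) : Measurable (dataNorm S a) :=
  (Finset.measurable_fun_sum _ fun k _ =>
    ((H.a_meas k).mono (𝓕.le 0) le_rfl).norm.pow_const 2).sqrt

lemma solNorm_pow (H : IsLinearData 𝓕 P T B S a f ρ) (ω : Ω) :
    solNorm T B S a f ω ^ 4 = ∫ t in Icc 0 T, ‖galerkin B S a f t ω‖ ^ 4 ∂timeMeasure :=
  toReal_eLpNorm_four_pow (H.stronglyMeasurable_galerkin.comp_measurable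
    measurable_prodMk_right).aestronglyMeasurable

lemma integrable_solNorm_pow (H : IsLinearData 𝓕 P T B S a f ρ) [IsProbabilityMeasure P] :
    Integrable (fun ω => solNorm T B S a f ω ^ 4) P := by
  simp only [H.solNorm_pow]
  exact H.integrable_norm_galerkin_pow.integral_prod_right

lemma integral_solNorm_pow (H : IsLinearData 𝓕 P T B S a f ρ) [IsProbabilityMeasure P] :
    ∫ ω, solNorm T B S a f ω ^ 4 ∂P =
      ∫ z, ‖galerkin B S a f z.1 z.2‖ ^ 4 ∂(timeProb T P) := by
  simp only [H.solNorm_pow]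
  rw [timeProb, integral_prod_symm _ H.integrable_norm_galerkin_pow]

lemma integrable_forceNorm_pow (H : IsLinearData 𝓕 P T B S a f ρ) [IsProbabilityMeasure P] :
    Integrable (fun ω => forceNorm T ρ ω ^ 4) P := by
  obtain ⟨M, hM⟩ := H.ρ_le
  refine Integrable.of_bound (C := (M : ℝ) ^ 4)
    (H.measurable_forceNorm.pow_const 4).aestronglyMeasurable (ae_of_all _ fun ω => ?_)
  rw [Real.norm_of_nonneg (pow_nonneg (forceNorm_nonneg ω) 4)]
  exact pow_le_pow_left₀ (forceNorm_nonneg ω) (ENNReal.toReal_le_coe_of_le_coe (hM ω)) 4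

lemma integrable_dataNorm_pow (H : IsLinearData 𝓕 P T B S a f ρ) [IsProbabilityMeasure P] :
    Integrable (fun ω => dataNorm S a ω ^ 4) P := by
  have h1 : MemLp (fun ω => ∑ k ∈ S, ‖a k ω‖) 4 P :=
    memLp_finsetSum S fun k _ => (H.a_memLp k).norm
  refine (h1.integrable_norm_pow (by norm_num)).mono'
    (H.measurable_dataNorm.pow_const 4).aestronglyMeasurable (ae_of_all _ fun ω => ?_)
  rw [Real.norm_of_nonneg (pow_nonneg (dataNorm_nonneg ω) 4), Real.norm_of_nonneg (by positivity)]
  refine pow_le_pow_left₀ (dataNorm_nonneg ω) ?_ 4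
  refine Real.sqrt_le_iff.2 ⟨by positivity, ?_⟩
  exact Finset.sum_sq_le_sq_sum_of_nonneg fun k _ => norm_nonneg _

/-- The linear estimate: a stochastic Strichartz inequality with a small constant. -/
theorem integral_solNorm_pow_le (H : IsLinearData 𝓕 P T B S a f ρ) [IsProbabilityMeasure P] {ε : ℝ} (hε : 0 ≤ ε) (hε1 : ε ≤ 1)
    (hT : (T : ℝ) ≤ ε ^ 4) (hK : strichartzConst * ε ≤ 1 / 2) :
    ∫ ω, solNorm T B S a f ω ^ 4 ∂P ≤ 2 * strichartzConst * ε *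
      (∫ ω, dataNorm S a ω ^ 4 ∂P + ∫ ω, forceNorm T ρ ω ^ 4 ∂P) := by
  set X := solNorm T B S a f with hX
  set Y := forceNorm T ρ with hY
  set α := dataNorm S a with hα
  set c := resConst ^ 2 with hc
  have hc0 : 0 ≤ c := sq_nonneg _
  have hX0 : ∀ ω, 0 ≤ X ω := fun ω => solNorm_nonneg ω
  have hY0 : ∀ ω, 0 ≤ Y ω := fun ω => forceNorm_nonneg ω
  have hα0 : ∀ ω, 0 ≤ α ω := fun ω => dataNorm_nonneg ω
  have hT1 : T ≤ 1 := by
    have : (T : ℝ) ≤ 1 := hT.trans (pow_le_one₀ hε hε1)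
    exact_mod_cast this
  -- By the energy inequality, `α² + 2 Y X ≤ (α + Y + X)²` bounds the mass at all times along the
  -- path.
  set h : Ω → ℝ := fun ω => α ω + Y ω + X ω with hh
  have hh0 : ∀ ω, 0 ≤ h ω := fun ω => add_nonneg (add_nonneg (hα0 ω) (hY0 ω)) (hX0 ω)
  have hhm : Measurable h := (H.measurable_dataNorm.add H.measurable_forceNorm).add
    H.measurable_solNorm
  have iX := H.integrable_solNorm_pow
  have iY := H.integrable_forceNorm_pow
  have iα := H.integrable_dataNorm_pow
  have henergy : ∀ ω, ∀ t ≤ T, ∑ k ∈ S, ‖amplitude B a f k t ω‖ ^ 2 ≤ h ω ^ 2 := by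
    intro ω t ht
    refine (H.sum_sq_amplitude_le ht ω).trans ?_
    have := hX0 ω; have := hY0 ω; have := hα0 ω
    simp only [hh]
    nlinarith [mul_nonneg (hX0 ω) (hα0 ω), mul_nonneg (hY0 ω) (hα0 ω), sq_nonneg (X ω),
      sq_nonneg (Y ω)]
  -- Cauchy–Schwarz for three terms is used twice, and `27 = 3² · 3`.
  have hh4 : ∀ ω, h ω ^ 4 ≤ 27 * (α ω ^ 4 + Y ω ^ 4 + X ω ^ 4) := by
    intro ω
    have h1 : h ω ^ 2 ≤ 3 * (α ω ^ 2 + Y ω ^ 2 + X ω ^ 2) := by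
      simp only [hh]
      nlinarith [sq_nonneg (α ω - Y ω), sq_nonneg (α ω - X ω), sq_nonneg (Y ω - X ω)]
    calc h ω ^ 4 = (h ω ^ 2) ^ 2 := by ring
      _ ≤ (3 * (α ω ^ 2 + Y ω ^ 2 + X ω ^ 2)) ^ 2 := pow_le_pow_left₀ (sq_nonneg _) h1 2
      _ ≤ _ := by
        nlinarith [sq_nonneg (α ω ^ 2 - Y ω ^ 2), sq_nonneg (α ω ^ 2 - X ω ^ 2),
          sq_nonneg (Y ω ^ 2 - X ω ^ 2)]
  have isum : Integrable (fun ω => α ω ^ 4 + Y ω ^ 4 + X ω ^ 4) P := (iα.add iY).add iX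
  -- the contribution of the data
  have hdata : ∫ ω, ‖quarticForm S (decayKernel T 0) (fun k => a k ω) (fun k => a k ω)‖ ∂P ≤
      ∫ ω, ε * ((2 + c) * α ω ^ 4) ∂P := by
    refine integral_mono_of_nonneg (ae_of_all _ fun ω => norm_nonneg _)
      ((iα.const_mul _).const_mul _) (ae_of_all _ fun ω => ?_)
    have hk : ∀ k ∈ S, ‖a k ω‖ ≤ α ω := by
      intro k hk
      refine Real.le_sqrt_of_sq_le ?_
      exact Finset.single_le_sum (f := fun k => ‖a k ω‖ ^ 2) (fun k _ => sq_nonneg _) hk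
    have h1 := norm_quarticForm_decayKernel_le (s := 0) hε hε1 hT S (fun k => a k ω)
      (fun k => a k ω) hk (hα0 ω) (hα0 ω) (dataNorm_sq ω).ge
    refine h1.trans_eq ?_
    have h2 : ‖∑ k ∈ S, a k ω * conj (a k ω)‖ = α ω ^ 2 := by
      simp only [Complex.mul_conj']
      have e : ∑ k ∈ S, (‖a k ω‖ : ℂ) ^ 2 = ((∑ k ∈ S, ‖a k ω‖ ^ 2 : ℝ) : ℂ) := by
        push_cast
        rfl
      rw [dataNorm_sq, e, Complex.norm_real,
        Real.norm_of_nonneg (Finset.sum_nonneg fun _ _ => sq_nonneg _)]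
    rw [h2]
    ring
  -- the contribution of the forcing
  set R : ℝ≥0 × Ω → ℝ := fun z => 4 * (ε * (2 * (ρ z.1 z.2 * ‖galerkin B S a f z.1 z.2‖) *
    h z.2 ^ 2 + c * (2 * ρ z.1 z.2) * h z.2 ^ 3)) with hR
  have hR0 : ∀ z, 0 ≤ R z := by
    intro z
    have := hh0 z.2
    have := H.ρ_nonneg z.1 z.2
    simp only [hR]; positivity
  have hρm : Measurable fun z : ℝ≥0 × Ω => ρ z.1 z.2 := H.ρ_meas
  have hRm : AEStronglyMeasurable R (timeProb T P) := by
    refine Measurable.aestronglyMeasurable ?_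
    have h1 := H.stronglyMeasurable_galerkin.norm.measurable
    exact (((((hρm.mul h1).const_mul 2).mul ((hhm.comp measurable_snd).pow_const 2)).add
      (((hρm.const_mul 2).const_mul c).mul ((hhm.comp measurable_snd).pow_const 3))).const_mul
        ε).const_mul 4
  have i1 : ∀ ω, Integrable (fun t => 2 * (ρ t ω * ‖galerkin B S a f t ω‖) * h ω ^ 2)
      (timeMeasure.restrict (Icc 0 T)) := fun ω =>
    ((H.integrable_ρ_mul ω).const_mul 2).mul_const _
  have i2 : ∀ ω, Integrable (fun t => c * (2 * ρ t ω) * h ω ^ 3)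
      (timeMeasure.restrict (Icc 0 T)) := fun ω =>
    (((H.integrable_ρ ω).const_mul 2).const_mul c).mul_const _
  -- The degenerate part is bounded through the pairing, `Y X ≤ h²`, and the rest through `∫ ρ ≤ Y ≤
  -- h`, which needs `T ≤ 1`. The constant is `216 = 8 · 27`.
  have hRle : ∀ ω, ∫ t in Icc 0 T, R (t, ω) ∂timeMeasure ≤
      216 * (1 + c) * (ε * (α ω ^ 4 + Y ω ^ 4 + X ω ^ 4)) := by
    intro ω
    have e1 : ∫ t in Icc 0 T, R (t, ω) ∂timeMeasure =
        4 * (ε * (2 * (∫ t in Icc 0 T, ρ t ω * ‖galerkin B S a f t ω‖ ∂timeMeasure) * h ω ^ 2 +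
          c * (2 * ∫ t in Icc 0 T, ρ t ω ∂timeMeasure) * h ω ^ 3)) := by
      simp only [hR]
      rw [integral_const_mul, integral_const_mul, integral_add (i1 ω) (i2 ω), integral_mul_const,
        integral_const_mul, integral_mul_const, integral_const_mul, integral_const_mul]
    have b1 := H.integral_ρ_mul_le ω
    have b2 := H.integral_ρ_le hT1 ω
    have hx := hX0 ω; have hy := hY0 ω; have ha := hα0 ω; have hhω := hh0 ω
    have hyh : Y ω ≤ h ω := by simp only [hh]; linarith
    have hxh : X ω ≤ h ω := by simp only [hh]; linarith
    calc ∫ t in Icc 0 T, R (t, ω) ∂timeMeasure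
        ≤ 4 * (ε * (2 * (h ω * h ω) * h ω ^ 2 + c * (2 * h ω) * h ω ^ 3)) := by
          rw [e1]
          gcongr
          · exact b1.trans (mul_le_mul hyh hxh hx hhω)
          · exact b2.trans hyh
      _ = 8 * (1 + c) * (ε * h ω ^ 4) := by ring
      _ ≤ 8 * (1 + c) * (ε * (27 * (α ω ^ 4 + Y ω ^ 4 + X ω ^ 4))) := by
          gcongr
          exact hh4 ω
      _ = _ := by ring
  obtain ⟨iR, hRint⟩ := integral_timeProb_le hRm hR0
    (fun ω => (((i1 ω).add (i2 ω)).const_mul ε).const_mul 4)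
    ((isum.const_mul ε).const_mul (216 * (1 + c))) hRle
  have hforce : ∫ z : ℝ≥0 × Ω, ‖sourceForm S (decayKernel T z.1) (fun k => f k z.1 z.2)
        (fun k => amplitude B a f k z.1 z.2)‖ ∂(timeProb T P) ≤ ∫ z, R z ∂(timeProb T P) := by
    refine integral_mono_of_nonneg (ae_of_all _ fun z => norm_nonneg _) iR ?_
    filter_upwards [ae_timeProb_fst_le T P] with z hz
    refine (norm_sourceForm_le S _ (decayKernel_neg T z.1) _ _).trans ?_
    have hρ := H.ρ_nonneg z.1 z.2
    have h1 := norm_quarticForm_decayKernel_le (s := z.1) hε hε1 hT S (fun k => f k z.1 z.2)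
      (fun k => amplitude B a f k z.1 z.2) (fun k hk => H.norm_f_le hk z.1 z.2)
      (mul_nonneg zero_le_two hρ) (hh0 z.2) (henergy z.2 z.1 hz)
    simp only [hR]
    have := hh0 z.2
    refine mul_le_mul_of_nonneg_left (h1.trans ?_) (by norm_num)
    gcongr
    exact H.pair z.1 z.2 _
  have hmain := H.integral_norm_galerkin_pow_le
  rw [← H.integral_solNorm_pow] at hmain
  rw [integral_const_mul, integral_const_mul] at hdata
  have hRint' : ∫ z, R z ∂(timeProb T P) ≤ 216 * (1 + c) *
      (ε * ((∫ ω, α ω ^ 4 ∂P) + (∫ ω, Y ω ^ 4 ∂P) + ∫ ω, X ω ^ 4 ∂P)) := by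
    refine hRint.trans_eq ?_
    rw [integral_const_mul, integral_const_mul]
    congr 2
    have e := integral_add (iα.add iY) iX
    simp only [Pi.add_apply] at e
    rw [e, integral_add iα iY]
  set IX := ∫ ω, X ω ^ 4 ∂P
  set IY := ∫ ω, Y ω ^ 4 ∂P
  set Iα := ∫ ω, α ω ^ 4 ∂P
  have pX : 0 ≤ IX := integral_nonneg fun ω => pow_nonneg (hX0 ω) 4
  have pY : 0 ≤ IY := integral_nonneg fun ω => pow_nonneg (hY0 ω) 4
  have pα : 0 ≤ Iα := integral_nonneg fun ω => pow_nonneg (hα0 ω) 4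
  -- Here `218 = 2 + 216`: the data contribute `2 + c ≤ 2 (1 + c)` and the forcing contributes the
  -- rest.
  have hfin : IX ≤ strichartzConst * ε * (Iα + IY + IX) := by
    refine hmain.trans ?_
    rw [strichartzConst, mul_assoc (2 * Real.pi), mul_assoc (2 * Real.pi)]
    refine mul_le_mul_of_nonneg_left ?_ (by positivity)
    refine (add_le_add hdata (hforce.trans hRint')).trans ?_
    have e : 218 * (1 + c) * ε * (Iα + IY + IX) =
        2 * (1 + c) * ε * (Iα + IY + IX) + 216 * (1 + c) * (ε * (Iα + IY + IX)) := by ring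
    rw [e]
    gcongr ?_ + _
    have : 0 ≤ ε * c * Iα := by positivity
    have : 0 ≤ 2 * (1 + c) * ε * (IY + IX) := by positivity
    nlinarith
  -- The fourth moment of the solution is finite by `iX`, so half of it can be absorbed on the left.
  have : strichartzConst * ε * IX ≤ 1 / 2 * IX := mul_le_mul_of_nonneg_right hK pX
  nlinarith

end IsLinearData

end LinearData

end WND
end

/-! ### Fourier coefficients on the torus, and distance to low frequencies. -/

noncomputable section
namespace WND

open ComplexConjugate Set Filter Topology AddCircle

section FourierSeries

lemma haarAddCircle_le_volume : (haarAddCircle : Measure Torus) ≤ volume := by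
  rw [volume_eq_smul_haarAddCircle]
  refine Measure.le_iff.2 fun s _ => ?_
  rw [Measure.smul_apply, smul_eq_mul]
  refine le_mul_of_one_le_left zero_le ?_
  rw [← ENNReal.ofReal_one]
  exact ENNReal.ofReal_le_ofReal (by nlinarith [Real.pi_gt_three])

lemma haarAddCircle_absolutelyContinuous : (haarAddCircle : Measure Torus) ≪ volume :=
  Measure.absolutelyContinuous_of_le haarAddCircle_le_volume

lemma fourierCoeff_congr {f g : Torus → ℂ} (h : f =ᵐ[volume] g) (k : ℤ) :
    fourierCoeff f k = fourierCoeff g k :=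
  congrFun (fourierCoeff_congr_ae (haarAddCircle_absolutelyContinuous.ae_eq h)) k

lemma memLp_haar {q : ℝ≥0∞} (F : LTorus q) : MemLp F q haarAddCircle :=
  (Lp.memLp F).mono_measure haarAddCircle_le_volume

variable {q : ℝ≥0∞} [hq : Fact (1 ≤ q)]

lemma integrable_haar (F : LTorus q) : Integrable F (haarAddCircle : Measure Torus) :=
  (memLp_haar F).integrable hq.out

lemma norm_fourierCoeff_le (F : LTorus q) (k : ℤ) : ‖fourierCoeff F k‖ ≤ ‖F‖ := by
  have h1 : ‖fourierCoeff F k‖ₑ ≤ eLpNorm F q volume := by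
    refine (enorm_integral_le_lintegral_enorm _).trans ?_
    have e : ∀ x : Torus, ‖fourier (-k) x • F x‖ₑ = ‖F x‖ₑ := by
      intro x
      have : ‖fourier (-k) x‖ = 1 := Circle.norm_coe _
      rw [enorm_smul, ← ofReal_norm (fourier (-k) x), this, ENNReal.ofReal_one, one_mul]
    simp only [e]
    rw [← eLpNorm_one_eq_lintegral_enorm]
    exact (eLpNorm_le_eLpNorm_of_exponent_le hq.out (memLp_haar F).1).trans
      (eLpNorm_mono_measure _ haarAddCircle_le_volume)
  rw [Lp.norm_def, ← toReal_enorm]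
  exact ENNReal.toReal_mono (Lp.eLpNorm_ne_top F) h1

/-- The `k`-th Fourier coefficient as a continuous linear functional on `L^q`. -/
def coeff (q : ℝ≥0∞) [Fact (1 ≤ q)] (k : ℤ) : LTorus q →L[ℂ] ℂ :=
  LinearMap.mkContinuous
    { toFun := fun F => fourierCoeff F k
      map_add' := fun F G => by
        rw [fourierCoeff_congr (Lp.coeFn_add F G) k,
          fourierCoeff.add (integrable_haar F) (integrable_haar G)]
        rfl
      map_smul' := fun c F => by
        rw [fourierCoeff_congr (Lp.coeFn_smul c F) k]
        exact fourierCoeff.const_smul _ c k } 1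
    fun F => by rw [one_mul]; exact norm_fourierCoeff_le F k

lemma coeff_apply (F : LTorus q) (k : ℤ) : coeff q k F = fourierCoeff F k := rfl

lemma norm_coeff_le (F : LTorus q) (k : ℤ) : ‖coeff q k F‖ ≤ ‖F‖ := norm_fourierCoeff_le F k

lemma coeff_mode (j k : ℤ) : coeff q k (mode q j) = if k = j then 1 else 0 := by
  rw [coeff_apply, fourierCoeff_congr (coeFn_mode q j), fourierCoeff_fourier]
  simp [Pi.single_apply]

lemma coeff_trig (S : Finset ℤ) (d : ℤ → ℂ) (k : ℤ) :
    coeff q k (trig q S d) = if k ∈ S then d k else 0 := by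
  simp only [trig, map_sum, map_smul, coeff_mode, smul_eq_mul, mul_ite, mul_one, mul_zero]
  rw [Finset.sum_ite_eq]

lemma trig_sub (S : Finset ℤ) (d e : ℤ → ℂ) :
    trig q S d - trig q S e = trig q S (fun k => d k - e k) := by
  simp only [trig, sub_smul, Finset.sum_sub_distrib]

lemma trig_sub_trig {S S' : Finset ℤ} (h : S' ⊆ S) (d : ℤ → ℂ) :
    trig q S d - trig q S' d = trig q (S \ S') d := by
  rw [sub_eq_iff_eq_add, trig, trig, trig, Finset.sum_sdiff h]

/-- The pairing of an `L^{4/3}` function with an `L⁴` function, for normalised Haar measure. -/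
lemma norm_integral_mul_conj_le (F : LTorus (4 / 3)) (g : LTorus 4) :
    ‖∫ x : Torus, F x * conj (g x) ∂haarAddCircle‖ ≤ ‖F‖ * ‖g‖ := by
  refine (norm_integral_le_integral_norm _).trans ?_
  simp only [norm_mul, RCLike.norm_conj]
  refine (integral_mul_le_of_memLp (memLp_haar F).norm (memLp_haar g).norm).trans ?_
  rw [Lp.norm_def, Lp.norm_def, eLpNorm_norm, eLpNorm_norm]
  gcongr
  · exact Lp.eLpNorm_ne_top F
  · exact haarAddCircle_le_volume
  · exact Lp.eLpNorm_ne_top g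
  · exact haarAddCircle_le_volume

lemma integrable_mul_conj (F : LTorus (4 / 3)) (g : LTorus 4) :
    Integrable (fun x : Torus => F x * conj (g x)) haarAddCircle := by
  have hg : MemLp (fun x => conj (g x)) 4 (haarAddCircle : Measure Torus) :=
    (memLp_haar g).star
  exact memLp_one_iff_integrable.1 (hg.mul (memLp_haar F))

lemma sum_coeff_mul_conj (F : LTorus (4 / 3)) (S : Finset ℤ) (d : ℤ → ℂ) :
    ∑ k ∈ S, coeff (4 / 3) k F * conj (d k) =
      ∫ x : Torus, F x * conj (trig 4 S d x) ∂haarAddCircle := by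
  have h1 : ∫ x : Torus, F x * conj (trig 4 S d x) ∂haarAddCircle =
      ∫ x : Torus, ∑ k ∈ S, conj (d k) * (fourier (-k) x • F x) ∂haarAddCircle := by
    refine integral_congr_ae ?_
    filter_upwards [haarAddCircle_absolutelyContinuous.ae_eq (coeFn_trig 4 S d)] with x hx
    rw [hx, map_sum, Finset.mul_sum]
    refine Finset.sum_congr rfl fun k _ => ?_
    rw [map_mul, fourier_neg, smul_eq_mul]
    ring
  rw [h1, integral_finsetSum _ fun k _ => ((integrable_haar F).fourier_smul (-k)).const_mul _]
  refine Finset.sum_congr rfl fun k _ => ?_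
  rw [integral_const_mul, coeff_apply, fourierCoeff, mul_comm]

lemma norm_sum_coeff_le (F : LTorus (4 / 3)) (S : Finset ℤ) (d : ℤ → ℂ) :
    ‖∑ k ∈ S, coeff (4 / 3) k F * conj (d k)‖ ≤ ‖F‖ * ‖trig 4 S d‖ := by
  rw [sum_coeff_mul_conj]
  exact norm_integral_mul_conj_le F _

/-- The trigonometric polynomials of `L^{4/3}` with frequencies in `S`. -/
def trigSpan (S : Finset ℤ) : Submodule ℂ (LTorus (4 / 3)) :=
  Submodule.span ℂ (mode (4 / 3) '' S)

/-- The distance in `L^{4/3}` to the trigonometric polynomials with frequencies in `S`. -/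
def trigDist (S : Finset ℤ) (F : LTorus (4 / 3)) : ℝ :=
  Metric.infDist F (trigSpan S : Set (LTorus (4 / 3)))

lemma trigDist_nonneg (S : Finset ℤ) (F : LTorus (4 / 3)) : 0 ≤ trigDist S F :=
  Metric.infDist_nonneg

lemma trigDist_le_norm (S : Finset ℤ) (F : LTorus (4 / 3)) : trigDist S F ≤ ‖F‖ := by
  have := Metric.infDist_le_dist_of_mem (x := F) (trigSpan S).zero_mem
  rwa [dist_zero_right] at this

lemma trigDist_empty (F : LTorus (4 / 3)) : trigDist ∅ F = ‖F‖ := by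
  simp [trigDist, trigSpan]

lemma continuous_trigDist (S : Finset ℤ) : Continuous (trigDist S) :=
  Metric.continuous_infDist_pt _

lemma coeff_eq_zero_of_mem_trigSpan {S : Finset ℤ} {h : LTorus (4 / 3)} (hh : h ∈ trigSpan S)
    {k : ℤ} (hk : k ∉ S) : coeff (4 / 3) k h = 0 := by
  have : trigSpan S ≤ LinearMap.ker (coeff (4 / 3) k : LTorus (4 / 3) →ₗ[ℂ] ℂ) := by
    refine Submodule.span_le.2 ?_
    rintro _ ⟨j, hj, rfl⟩
    have hkj : k ≠ j := fun e => hk (e ▸ hj)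
    simp [coeff_mode, hkj]
  simpa using this hh

/-- High frequencies only see the distance to the low frequencies. -/
lemma norm_sum_coeff_le_trigDist {S S' : Finset ℤ} (hS : Disjoint S S') (F : LTorus (4 / 3))
    (d : ℤ → ℂ) :
    ‖∑ k ∈ S, coeff (4 / 3) k F * conj (d k)‖ ≤ trigDist S' F * ‖trig 4 S d‖ := by
  rcases (norm_nonneg (trig 4 S d)).eq_or_lt with h0 | h0
  · have := norm_sum_coeff_le F S d
    rw [← h0, mul_zero] at this ⊢
    exact this
  rw [← div_le_iff₀ h0]
  -- Subtracting from `F` a polynomial with frequencies in `S'` does not change the sum over `S`;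
  -- the duality bound is then optimised over such polynomials.
  refine (Metric.le_infDist ⟨0, (trigSpan S').zero_mem⟩).2 fun h hh => ?_
  rw [div_le_iff₀ h0, dist_eq_norm]
  refine le_trans (le_of_eq ?_) (norm_sum_coeff_le (F - h) S d)
  congr 1
  refine Finset.sum_congr rfl fun k hk => ?_
  rw [map_sub, coeff_eq_zero_of_mem_trigSpan hh (Finset.disjoint_left.1 hS hk), sub_zero]

/-- The symmetric frequency window `[-n, n]`. -/
def window (n : ℕ) : Finset ℤ := Finset.Icc (-(n : ℤ)) n

lemma window_mono : Monotone window := fun m n h =>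
  Finset.Icc_subset_Icc (by omega) (by omega)

lemma mem_window_natAbs (k : ℤ) : k ∈ window k.natAbs := by
  simp only [window, Finset.mem_Icc]; omega

lemma eventually_mem_window (k : ℤ) : ∀ᶠ n in atTop, k ∈ window n := by
  filter_upwards [eventually_ge_atTop k.natAbs] with n hn
  exact window_mono hn (mem_window_natAbs k)

lemma tendsto_window : Tendsto window atTop atTop :=
  tendsto_atTop_finset_of_monotone window_mono fun k => ⟨_, mem_window_natAbs k⟩

lemma span_mode_closure_eq_top (hq' : q ≠ ∞) :
    (Submodule.span ℂ (range (mode q))).topologicalClosure = ⊤ := by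
  convert! (ContinuousMap.toLp_denseRange ℂ (volume : Measure Torus) ℂ
    hq').topologicalClosure_map_submodule (span_fourier_closure_eq_top (T := 2 * Real.pi))
  rw [Submodule.map_span]
  unfold mode
  rw [range_comp']
  simp only [ContinuousLinearMap.coe_coe]

lemma trigSpan_mono {S S' : Finset ℤ} (h : S ⊆ S') : trigSpan S ≤ trigSpan S' :=
  Submodule.span_mono (image_mono h)

lemma exists_mem_trigSpan_window {h : LTorus (4 / 3)}
    (hh : h ∈ Submodule.span ℂ (range (mode (4 / 3)))) : ∃ n, h ∈ trigSpan (window n) := by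
  induction hh using Submodule.span_induction with
  | mem x hx =>
    obtain ⟨k, rfl⟩ := hx
    exact ⟨_, Submodule.subset_span ⟨k, mem_window_natAbs k, rfl⟩⟩
  | zero => exact ⟨0, Submodule.zero_mem _⟩
  | add x y _ _ hx hy =>
    obtain ⟨n, hn⟩ := hx
    obtain ⟨m, hm⟩ := hy
    exact ⟨max n m, Submodule.add_mem _ (trigSpan_mono (window_mono (le_max_left n m)) hn)
      (trigSpan_mono (window_mono (le_max_right n m)) hm)⟩
  | smul c x _ hx =>
    obtain ⟨n, hn⟩ := hx
    exact ⟨n, Submodule.smul_mem _ c hn⟩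

/-- Only the density of trigonometric polynomials is used. This is why tails are measured by a
distance: boundedness of the partial sums in `L^{4/3}` is not needed. -/
lemma tendsto_trigDist (F : LTorus (4 / 3)) :
    Tendsto (fun n => trigDist (window n) F) atTop (𝓝 0) := by
  rw [Metric.tendsto_atTop]
  intro ε hε
  have hF : F ∈ (Submodule.span ℂ (range (mode (4 / 3)))).topologicalClosure := by
    rw [span_mode_closure_eq_top (ENNReal.div_ne_top (by norm_num) (by norm_num))]
    trivial
  obtain ⟨h, hh, hd⟩ := Metric.mem_closure_iff.1 hF ε hε
  obtain ⟨n, hn⟩ := exists_mem_trigSpan_window hh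
  refine ⟨n, fun m hm => ?_⟩
  rw [Real.dist_0_eq_abs, abs_of_nonneg (trigDist_nonneg _ _)]
  exact (Metric.infDist_le_dist_of_mem (trigSpan_mono (window_mono hm) hn)).trans_lt hd

lemma integral_norm_sq_eq (F : LTorus 2) : ∫ x : Torus, ‖F x‖ ^ 2 = ‖F‖ ^ 2 := by
  have h := congrArg RCLike.re (L2.inner_def (𝕜 := ℂ) F F)
  rw [inner_self_eq_norm_sq, ← integral_re (L2.integrable_inner F F)] at h
  simp only [← norm_sq_eq_re_inner] at h
  exact h.symm

/-- Parseval's identity for Lebesgue measure on `𝕋`. -/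
lemma hasSum_sq_coeff (F : LTorus 2) :
    HasSum (fun k => ‖coeff 2 k F‖ ^ 2) ((2 * Real.pi)⁻¹ * ‖F‖ ^ 2) := by
  have h := hasSum_sq_fourierCoeff (memLp_haar F).toLp
  have e1 : ∀ k, fourierCoeff ((memLp_haar F).toLp : Torus → ℂ) k = coeff 2 k F := fun k =>
    congrFun (fourierCoeff_congr_ae (memLp_haar F).coeFn_toLp) k
  have e2 : ∫ x : Torus, ‖((memLp_haar F).toLp : Torus → ℂ) x‖ ^ 2 ∂haarAddCircle =
      (2 * Real.pi)⁻¹ * ‖F‖ ^ 2 := by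
    have e3 : ∫ x : Torus, ‖F x‖ ^ 2 ∂haarAddCircle = (2 * Real.pi)⁻¹ * ∫ x : Torus, ‖F x‖ ^ 2 :=
      AddCircle.integral_haarAddCircle
    rw [← integral_norm_sq_eq, ← e3]
    refine integral_congr_ae ?_
    filter_upwards [(memLp_haar F).coeFn_toLp] with x hx
    rw [hx]
  simp only [e1] at h
  rwa [e2] at h

lemma eq_of_coeff_eq {F G : LTorus 2} (h : ∀ k, coeff 2 k F = coeff 2 k G) : F = G := by
  have h1 := hasSum_sq_coeff (F - G)
  simp only [map_sub, h, sub_self, norm_zero, ne_eq, OfNat.ofNat_ne_zero, not_false_eq_true,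
    zero_pow] at h1
  have h2 := h1.unique hasSum_zero
  rw [mul_eq_zero, pow_eq_zero_iff two_ne_zero, norm_eq_zero, sub_eq_zero] at h2
  exact h2.resolve_left (inv_ne_zero Real.two_pi_pos.ne')

lemma memLp_two_of_four (u : LTorus 4) : MemLp u 2 (volume : Measure Torus) :=
  (Lp.memLp u).mono_exponent (by norm_num)

/-- The torus has finite measure, so `L⁴` embeds in `L²`, where Parseval gives uniqueness. -/
lemma ae_eq_of_coeff_eq {u : LTorus 4} {w : LTorus 2} (h : ∀ k, coeff 4 k u = coeff 2 k w) :
    (u : Torus → ℂ) =ᵐ[volume] w := by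
  have e : (memLp_two_of_four u).toLp = w := by
    refine eq_of_coeff_eq fun k => ?_
    rw [← h k, coeff_apply, coeff_apply]
    exact fourierCoeff_congr (memLp_two_of_four u).coeFn_toLp k
  rw [← e]
  exact (memLp_two_of_four u).coeFn_toLp.symm

lemma eq_of_coeff_four_eq {u v : LTorus 4} (h : ∀ k, coeff 4 k u = coeff 4 k v) : u = v := by
  refine Lp.ext ((ae_eq_of_coeff_eq (w := (memLp_two_of_four v).toLp) fun k => ?_).trans
    (memLp_two_of_four v).coeFn_toLp)
  rw [h k, coeff_apply, coeff_apply]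
  exact (fourierCoeff_congr (memLp_two_of_four v).coeFn_toLp k).symm

lemma norm_trig_two_sq (S : Finset ℤ) (d : ℤ → ℂ) :
    ‖trig 2 S d‖ ^ 2 = 2 * Real.pi * ∑ k ∈ S, ‖d k‖ ^ 2 := by
  have h1 := hasSum_sq_coeff (trig 2 S d)
  have h2 : HasSum (fun k => ‖coeff 2 k (trig 2 S d)‖ ^ 2) (∑ k ∈ S, ‖d k‖ ^ 2) := by
    have : ∑ k ∈ S, ‖d k‖ ^ 2 = ∑ k ∈ S, ‖coeff 2 k (trig 2 S d)‖ ^ 2 :=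
      Finset.sum_congr rfl fun k hk => by rw [coeff_trig, if_pos hk]
    rw [this]
    exact hasSum_sum_of_ne_finset_zero fun k hk => by rw [coeff_trig, if_neg hk]; simp
  have h3 := h1.unique h2
  rw [← h3, ← mul_assoc, mul_inv_cancel₀ Real.two_pi_pos.ne', one_mul]

end FourierSeries

end WND
end

/-! ### The power nonlinearity from `L⁴` to `L^{4/3}`. -/

noncomputable section
namespace WND

open ComplexConjugate Set Filter Topology AddCircle

section Power

/-- The power nonlinearity `|z|^{p-1} z`. -/
def power (p : ℝ) (z : ℂ) : ℂ := ((‖z‖ ^ (p - 1) : ℝ) : ℂ) * z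

lemma power_zero (p : ℝ) : power p 0 = 0 := by simp [power]

/-- With `q = p - 1`, this uses `p ≤ 3` to replace every admissible power by the cubic one plus a
linear term. -/
lemma rpow_le_one_add_sq {q r : ℝ} (hq0 : 0 < q) (hq2 : q ≤ 2) (hr : 0 ≤ r) :
    r ^ q ≤ 1 + r ^ 2 := by
  rcases le_total r 1 with h | h
  · exact (Real.rpow_le_one hr h hq0.le).trans (by nlinarith [sq_nonneg r])
  · have := Real.rpow_le_rpow_of_exponent_le h hq2
    rw [Real.rpow_two] at this
    linarith

/-- By homogeneity only `x = s / r` in `[0, 1]` matters, and `x^q ≥ x²` gives `1 - x^q ≤ 1 - x² ≤ 2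
(1 - x)`. This avoids the derivative of `r^q`, which is singular at zero for `q < 1`. -/
lemma rpow_sub_rpow_mul_le {q r s : ℝ} (hq0 : 0 < q) (hq2 : q ≤ 2) (hs : 0 ≤ s) (hsr : s ≤ r) :
    (r ^ q - s ^ q) * r ≤ 2 * (r - s) * r ^ q := by
  rcases hs.trans hsr |>.eq_or_lt with h | h
  · rw [← h]
    have : s = 0 := le_antisymm (hsr.trans h.symm.le) hs
    simp [this, Real.zero_rpow hq0.ne']
  have hx0 : 0 ≤ s / r := div_nonneg hs h.le
  have hx1 : s / r ≤ 1 := (div_le_one h).2 hsr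
  have e1 : s ^ q = (s / r) ^ q * r ^ q := by
    rw [← Real.mul_rpow hx0 h.le, div_mul_cancel₀ _ h.ne']
  have e2 : (s / r) ^ 2 ≤ (s / r) ^ q := by
    rw [← Real.rpow_two]
    exact Real.rpow_le_rpow_of_exponent_ge' hx0 hx1 hq0.le hq2
  have e3 : s = s / r * r := (div_mul_cancel₀ _ h.ne').symm
  set x := s / r
  have hrq : 0 ≤ r ^ q := Real.rpow_nonneg h.le q
  rw [e1, e3]
  have : 1 - x ^ q ≤ 2 * (1 - x) := by nlinarith
  calc (r ^ q - x ^ q * r ^ q) * r = (1 - x ^ q) * (r ^ q * r) := by ring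
    _ ≤ 2 * (1 - x) * (r ^ q * r) := mul_le_mul_of_nonneg_right this (mul_nonneg hrq h.le)
    _ = _ := by ring

/-- For `‖w‖ ≤ ‖z‖`, the difference is `‖w‖^{p-1} (z - w)` plus a difference of powers of the moduli
times `z`. The second part is controlled by `rpow_sub_rpow_mul_le`. -/
lemma norm_power_sub_le {p : ℝ} (hp : p ∈ Ioc 1 3) (z w : ℂ) :
    ‖power p z - power p w‖ ≤ 3 * (‖z - w‖ * (1 + ‖z‖ ^ 2 + ‖w‖ ^ 2)) := by
  wlog h : ‖w‖ ≤ ‖z‖ generalizing z w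
  · have := this w z (le_of_not_ge h)
    rw [norm_sub_rev, norm_sub_rev z w]
    refine this.trans_eq ?_
    ring
  have hq0 : 0 < p - 1 := by linarith [hp.1]
  have hq2 : p - 1 ≤ 2 := by linarith [hp.2]
  have e : power p z - power p w = ((‖w‖ ^ (p - 1) : ℝ) : ℂ) * (z - w) +
      (((‖z‖ ^ (p - 1) - ‖w‖ ^ (p - 1)) : ℝ) : ℂ) * z := by
    simp only [power]; push_cast; ring
  have hr : ‖z‖ - ‖w‖ ≤ ‖z - w‖ := norm_sub_norm_le z w
  have hz := rpow_le_one_add_sq hq0 hq2 (norm_nonneg z)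
  have hw := rpow_le_one_add_sq hq0 hq2 (norm_nonneg w)
  have hmono : ‖w‖ ^ (p - 1) ≤ ‖z‖ ^ (p - 1) := Real.rpow_le_rpow (norm_nonneg w) h hq0.le
  have h2 := rpow_sub_rpow_mul_le hq0 hq2 (norm_nonneg w) h
  have hz0 : 0 ≤ ‖z‖ ^ (p - 1) := Real.rpow_nonneg (norm_nonneg z) _
  have hw0 : 0 ≤ ‖w‖ ^ (p - 1) := Real.rpow_nonneg (norm_nonneg w) _
  rw [e]
  refine (norm_add_le _ _).trans ?_
  rw [norm_mul, norm_mul, Complex.norm_real, Complex.norm_real, Real.norm_of_nonneg hw0,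
    Real.norm_of_nonneg (sub_nonneg.2 hmono)]
  have h3 : 2 * (‖z‖ - ‖w‖) * ‖z‖ ^ (p - 1) ≤ 2 * ‖z - w‖ * ‖z‖ ^ (p - 1) := by gcongr
  calc ‖w‖ ^ (p - 1) * ‖z - w‖ + (‖z‖ ^ (p - 1) - ‖w‖ ^ (p - 1)) * ‖z‖
      ≤ ‖z - w‖ * (‖w‖ ^ (p - 1) + 2 * ‖z‖ ^ (p - 1)) := by linarith
    _ ≤ ‖z - w‖ * (3 * (1 + ‖z‖ ^ 2 + ‖w‖ ^ 2)) := by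
        gcongr
        nlinarith [sq_nonneg ‖w‖, sq_nonneg ‖z‖]
    _ = _ := by ring

lemma continuous_power {p : ℝ} (hp : 1 < p) : Continuous (power p) :=
  (Complex.continuous_ofReal.comp
    (continuous_norm.rpow_const fun _ => Or.inr (by linarith))).mul continuous_id

instance instHolderFourTwo : ENNReal.HolderTriple 4 2 (4 / 3) := by
  refine ⟨?_⟩
  rw [ENNReal.inv_div (by simp) (by simp)]
  have h : (2 : ℝ≥0∞)⁻¹ = 2 / 4 := by
    rw [ENNReal.eq_div_iff (by simp) (by simp)]
    have : (4 : ℝ≥0∞) = 2 * 2 := by norm_num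
    rw [this, mul_assoc, ENNReal.mul_inv_cancel (by simp) (by simp), mul_one]
  rw [h, ← one_div, ← ENNReal.add_div]
  norm_num

lemma eLpNorm_sq {α : Type*} [MeasurableSpace α] {μ : Measure α} (b : α → ℝ) :
    eLpNorm (fun x => b x ^ 2) 2 μ = eLpNorm b 4 μ ^ 2 := by
  have h := eLpNorm_norm_rpow (p := 2) (μ := μ) b (q := 2) two_pos
  simp only [Real.rpow_two, ENNReal.rpow_two, Real.norm_eq_abs, sq_abs] at h
  rw [h]
  congr 2
  rw [ENNReal.ofReal_ofNat]
  norm_num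

/-- Hölder with `3/4 = 1/4 + 1/2`, then Minkowski in `L²`. The same inequality serves in space, for
the power, and in time, for the truncated forcing. -/
lemma eLpNorm_mul_one_add_sq_le {α : Type*} [MeasurableSpace α] {μ : Measure α} {a b c : α → ℝ}
    (ha : AEStronglyMeasurable a μ) (hb : AEStronglyMeasurable b μ)
    (hc : AEStronglyMeasurable c μ) :
    eLpNorm (fun x => a x * (1 + b x ^ 2 + c x ^ 2)) (4 / 3) μ ≤
      eLpNorm a 4 μ * (eLpNorm (fun _ => (1 : ℝ)) 2 μ + eLpNorm b 4 μ ^ 2 + eLpNorm c 4 μ ^ 2) := by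
  have h1 : AEStronglyMeasurable (fun _ : α => (1 : ℝ)) μ := aestronglyMeasurable_const
  have hb2 : AEStronglyMeasurable (fun x => b x ^ 2) μ := hb.pow 2
  have hc2 : AEStronglyMeasurable (fun x => c x ^ 2) μ := hc.pow 2
  refine (eLpNorm_smul_le_mul_eLpNorm (p := 4) (q := 2) (r := 4 / 3)
    ((h1.add hb2).add hc2) ha).trans ?_
  gcongr
  refine (eLpNorm_add_le (h1.add hb2) hc2 one_le_two).trans ?_
  rw [← eLpNorm_sq b, ← eLpNorm_sq c]
  gcongr
  exact eLpNorm_add_le h1 hb2 one_le_two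

lemma eLpNorm_one_torus_le : eLpNorm (fun _ => (1 : ℝ)) 2 (volume : Measure Torus) ≤ 3 := by
  have h : (volume : Measure Torus) univ = ENNReal.ofReal (2 * Real.pi) := AddCircle.measure_univ _
  rw [eLpNorm_const _ two_ne_zero (by
    intro h0
    have : ENNReal.ofReal (2 * Real.pi) = 0 := by rw [← h, h0]; rfl
    rw [ENNReal.ofReal_eq_zero] at this
    linarith [Real.two_pi_pos]), h]
  simp only [enorm_one, one_mul, ENNReal.toReal_ofNat]
  have h9 : ENNReal.ofReal (2 * Real.pi) ≤ 3 ^ (2 : ℝ) := by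
    rw [ENNReal.rpow_two, ← ENNReal.ofReal_ofNat, ← ENNReal.ofReal_pow (by norm_num)]
    exact ENNReal.ofReal_le_ofReal (by nlinarith [Real.pi_lt_four])
  refine (ENNReal.rpow_le_rpow h9 (by norm_num)).trans_eq ?_
  rw [← ENNReal.rpow_mul]
  norm_num

variable {p : ℝ}

lemma eLpNorm_power_sub_le (hp : p ∈ Ioc 1 3) (u v : LTorus 4) :
    eLpNorm (fun x => power p (u x) - power p (v x)) (4 / 3) (volume : Measure Torus) ≤
      ENNReal.ofReal (9 * (‖u - v‖ * (1 + ‖u‖ ^ 2 + ‖v‖ ^ 2))) := by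
  have h1 := eLpNorm_mul_one_add_sq_le (μ := (volume : Measure Torus))
    (Lp.aestronglyMeasurable (u - v)).norm (Lp.aestronglyMeasurable u).norm
    (Lp.aestronglyMeasurable v).norm
  have h2 : eLpNorm (fun x => power p (u x) - power p (v x)) (4 / 3) (volume : Measure Torus) ≤
      ENNReal.ofReal 3 * eLpNorm (fun x => ‖(u - v : LTorus 4) x‖ *
        (1 + ‖u x‖ ^ 2 + ‖v x‖ ^ 2)) (4 / 3) volume := by
    refine eLpNorm_le_mul_eLpNorm_of_ae_le_mul ?_ _
    filter_upwards [Lp.coeFn_sub u v] with x hx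
    rw [hx, Real.norm_of_nonneg (by positivity)]
    exact norm_power_sub_le hp _ _
  refine h2.trans ?_
  simp only [eLpNorm_norm] at h1
  have e : ∀ w : LTorus 4, eLpNorm w 4 volume = ENNReal.ofReal ‖w‖ := fun w => by
    rw [Lp.norm_def, ENNReal.ofReal_toReal (Lp.eLpNorm_ne_top w)]
  rw [e, e, e] at h1
  calc ENNReal.ofReal 3 * _ ≤ ENNReal.ofReal 3 * (ENNReal.ofReal ‖u - v‖ *
        (3 + ENNReal.ofReal ‖u‖ ^ 2 + ENNReal.ofReal ‖v‖ ^ 2)) := by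
        gcongr
        exact h1.trans (by gcongr; exact eLpNorm_one_torus_le)
    _ = ENNReal.ofReal (3 * (‖u - v‖ * (3 + ‖u‖ ^ 2 + ‖v‖ ^ 2))) := by
        rw [ENNReal.ofReal_mul (by norm_num), ENNReal.ofReal_mul (norm_nonneg _),
          ENNReal.ofReal_add (by positivity) (by positivity),
          ENNReal.ofReal_add (by positivity) (by positivity), ENNReal.ofReal_pow (norm_nonneg _),
          ENNReal.ofReal_pow (norm_nonneg _), ENNReal.ofReal_ofNat]
    _ ≤ _ := by
        apply ENNReal.ofReal_le_ofReal
        have : 0 ≤ ‖u - v‖ * (‖u‖ ^ 2 + ‖v‖ ^ 2) := by positivity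
        nlinarith

lemma memLp_power (hp : p ∈ Ioc 1 3) (u : LTorus 4) :
    MemLp (fun x => power p (u x)) (4 / 3) (volume : Measure Torus) := by
  refine ⟨(continuous_power hp.1).comp_aestronglyMeasurable (Lp.aestronglyMeasurable u), ?_⟩
  have h := eLpNorm_power_sub_le hp u 0
  have e : (fun x => power p (u x) - power p ((0 : LTorus 4) x)) =ᵐ[volume]
      fun x => power p (u x) := by
    filter_upwards [Lp.coeFn_zero ℂ 4 (volume : Measure Torus)] with x hx
    rw [hx, Pi.zero_apply, power_zero, sub_zero]
  rw [eLpNorm_congr_ae e] at h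
  exact h.trans_lt ENNReal.ofReal_lt_top

/-- The power nonlinearity as a map from `L⁴` to `L^{4/3}`. -/
def powerLp (hp : p ∈ Ioc 1 3) (u : LTorus 4) : LTorus (4 / 3) := (memLp_power hp u).toLp

lemma coeFn_powerLp (hp : p ∈ Ioc 1 3) (u : LTorus 4) :
    powerLp hp u =ᵐ[volume] fun x => power p (u x) := (memLp_power hp u).coeFn_toLp

lemma norm_powerLp_sub_le (hp : p ∈ Ioc 1 3) (u v : LTorus 4) :
    ‖powerLp hp u - powerLp hp v‖ ≤ 9 * (‖u - v‖ * (1 + ‖u‖ ^ 2 + ‖v‖ ^ 2)) := by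
  rw [powerLp, powerLp, ← MemLp.toLp_sub, Lp.norm_toLp]
  exact ENNReal.toReal_le_of_le_ofReal (by positivity) (eLpNorm_power_sub_le hp u v)

lemma powerLp_zero (hp : p ∈ Ioc 1 3) : powerLp hp 0 = 0 := by
  refine Lp.ext ?_
  filter_upwards [coeFn_powerLp hp 0, Lp.coeFn_zero ℂ 4 (volume : Measure Torus),
    Lp.coeFn_zero ℂ (4 / 3) (volume : Measure Torus)] with x h1 h2 h3
  rw [h1, h2, h3, Pi.zero_apply, power_zero]

lemma norm_powerLp_le (hp : p ∈ Ioc 1 3) (u : LTorus 4) :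
    ‖powerLp hp u‖ ≤ 9 * (‖u‖ * (1 + ‖u‖ ^ 2)) := by
  have := norm_powerLp_sub_le hp u 0
  rw [powerLp_zero, sub_zero, sub_zero] at this
  simpa using this

lemma continuous_powerLp (hp : p ∈ Ioc 1 3) : Continuous (powerLp hp) := by
  refine continuous_iff_continuousAt.2 fun u => ?_
  rw [ContinuousAt, tendsto_iff_norm_sub_tendsto_zero]
  have h : Tendsto (fun v : LTorus 4 => 9 * (‖v - u‖ * (1 + ‖v‖ ^ 2 + ‖u‖ ^ 2))) (𝓝 u) (𝓝 0) := by
    have : Continuous fun v : LTorus 4 => 9 * (‖v - u‖ * (1 + ‖v‖ ^ 2 + ‖u‖ ^ 2)) := by fun_prop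
    have h := this.tendsto u
    simpa using h
  exact squeeze_zero (fun _ => norm_nonneg _) (fun v => norm_powerLp_sub_le hp v u) h

end Power

end WND
end

/-! ### The cutoff and the truncated nonlinearity along a single path. -/

noncomputable section
namespace WND

open ComplexConjugate Set Filter Topology AddCircle

section Cutoff

lemma IsCutoff.exists_lipschitzWith {θ : ℝ → ℝ} (hθ : IsCutoff θ) : ∃ L : ℝ≥0, LipschitzWith L θ := by
  refine ContDiff.lipschitzWith_of_hasCompactSupport (𝕂 := ℝ) (n := ((⊤ : ℕ∞) : WithTop ℕ∞)) ?_
    hθ.smooth (by simp)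
  refine HasCompactSupport.of_support_subset_isCompact (isCompact_Icc (a := (-2 : ℝ)) (b := 2)) ?_
  intro x hx
  by_contra h
  refine hx (hθ.eq_zero x ?_)
  rw [mem_Icc, ← abs_le, not_le] at h
  exact h.le

/-- The truncation as a function of the running norm, with the value zero from `2` up to `∞`. -/
def cut (θ : ℝ → ℝ) (n : ℝ≥0∞) : ℝ := θ (min n 2).toReal

variable {θ : ℝ → ℝ} {L : ℝ≥0}

lemma toReal_min_two_le (n : ℝ≥0∞) : (min n 2).toReal ≤ 2 :=
  ENNReal.toReal_le_of_le_ofReal zero_le_two (by simp)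

lemma cut_eq_zero (hθ : IsCutoff θ) {n : ℝ≥0∞} (hn : 2 ≤ n) : cut θ n = 0 := by
  rw [cut, min_eq_right hn]
  exact hθ.eq_zero _ (by simp)

/-- The two truncations differ only at an infinite norm, which `toReal` sends to zero, where `θ` is
one. With `cut` the forcing vanishes there instead, so the path estimates need no exceptional set.
-/
lemma cut_eq (hθ : IsCutoff θ) {n : ℝ≥0∞} (hn : n ≠ ∞) : cut θ n = θ n.toReal := by
  rcases le_total n 2 with h | h
  · rw [cut, min_eq_left h]
  · rw [cut_eq_zero hθ h, hθ.eq_zero]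
    rw [abs_of_nonneg ENNReal.toReal_nonneg]
    exact ENNReal.ofReal_le_iff_le_toReal hn |>.1 (by simpa using h)

lemma abs_cut_le (hθ : IsCutoff θ) (hL : LipschitzWith L θ) (n : ℝ≥0∞) : |cut θ n| ≤ 2 * L := by
  have h := hL.dist_le_mul (min n 2).toReal 2
  rw [hθ.eq_zero 2 (by simp), dist_zero_right, Real.norm_eq_abs, Real.dist_eq] at h
  refine h.trans ?_
  rw [mul_comm]
  gcongr
  rw [abs_le]
  constructor <;> linarith [toReal_min_two_le n, ENNReal.toReal_nonneg (a := min n 2)]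

lemma abs_cut_sub_cut_le (hL : LipschitzWith L θ) {m n : ℝ≥0∞} {δ : ℝ≥0} (h1 : m ≤ n + δ)
    (h2 : n ≤ m + δ) : |cut θ m - cut θ n| ≤ L * δ := by
  have key : ∀ {m n : ℝ≥0∞}, m ≤ n + δ → (min m 2).toReal ≤ (min n 2).toReal + δ := by
    intro m n h
    have : min m 2 ≤ min n 2 + δ := by
      rw [← min_add_add_right]
      exact min_le_min h le_self_add
    have h3 := ENNReal.toReal_mono (by simp) this
    rwa [ENNReal.toReal_add (by simp) (by simp), ENNReal.coe_toReal] at h3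
  refine (hL.dist_le_mul _ _).trans ?_
  gcongr
  rw [Real.dist_eq, abs_le]
  constructor <;> linarith [key h1, key h2]

end Cutoff

section Paths

/-- The running `L⁴` norm of a path. -/
def pathNorm (x : ℝ≥0 → LTorus 4) (t : ℝ≥0) : ℝ≥0∞ := eLpNorm x 4 (timeMeasure.restrict (Iio t))

lemma pathNorm_mono (x : ℝ≥0 → LTorus 4) : Monotone (pathNorm x) := fun _ _ h =>
  eLpNorm_mono_measure _ (Measure.restrict_mono (Iio_subset_Iio h) le_rfl)

/-- The times at which the running norm is below the truncation level. -/
def activeTimes (x : ℝ≥0 → LTorus 4) : Set ℝ≥0 := {s | pathNorm x s < 2}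

lemma isLowerSet_activeTimes (x : ℝ≥0 → LTorus 4) : IsLowerSet (activeTimes x) :=
  fun _ _ h hs => (pathNorm_mono x h).trans_lt hs

lemma measurableSet_activeTimes (x : ℝ≥0 → LTorus 4) : MeasurableSet (activeTimes x) :=
  (isLowerSet_activeTimes x).ordConnected.measurableSet

/-- The path, stopped when its running norm reaches the truncation level. -/
def stopped (x : ℝ≥0 → LTorus 4) : ℝ≥0 → LTorus 4 := (activeTimes x).indicator x

/-- The active times form an initial segment. Apart from at most one end point it is a countable
union of intervals that end at active times. -/
lemma ae_activeTimes_eq (x : ℝ≥0 → LTorus 4) :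
    activeTimes x =ᵐ[timeMeasure] ⋃ n : {n : ℕ // TopologicalSpace.denseSeq ℝ≥0 n ∈ activeTimes x},
      Iio (TopologicalSpace.denseSeq ℝ≥0 n) := by
  set U := ⋃ n : {n : ℕ // TopologicalSpace.denseSeq ℝ≥0 n ∈ activeTimes x},
      Iio (TopologicalSpace.denseSeq ℝ≥0 n) with hU
  have hsub : U ⊆ activeTimes x := by
    refine iUnion_subset fun q s hs => isLowerSet_activeTimes x (le_of_lt hs) q.2
  have hmem : ∀ s t, s < t → t ∈ activeTimes x → s ∈ U := by
    intro s t hst ht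
    obtain ⟨_, ⟨n, rfl⟩, hn⟩ :=
      (TopologicalSpace.denseRange_denseSeq ℝ≥0).exists_between hst
    exact mem_iUnion.2 ⟨⟨n, isLowerSet_activeTimes x hn.2.le ht⟩, hn.1⟩
  have hss : (activeTimes x \ U).Subsingleton := by
    intro s hs t ht
    by_contra hne
    rcases lt_or_gt_of_ne hne with h | h
    · exact hs.2 (hmem s t h ht.1)
    · exact ht.2 (hmem t s h hs.1)
  refine (ae_eq_set.2 ⟨hss.measure_zero _, ?_⟩)
  rw [sdiff_eq_empty.2 hsub, measure_empty]

/-- On each interval that ends at an active time the norm is below two, and monotone convergence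
passes to their union. The bound holds for every path, even one of infinite norm, and is the source
of all uniformity below. -/
lemma eLpNorm_stopped_le (x : ℝ≥0 → LTorus 4) (μ : Measure ℝ≥0) (hμ : μ ≤ timeMeasure) :
    eLpNorm (stopped x) 4 μ ≤ 2 := by
  refine (eLpNorm_mono_measure _ hμ).trans ?_
  refine (ENNReal.pow_right_strictMono (n := 4) (by norm_num)).le_iff_le.1 ?_
  rw [stopped, eLpNorm_indicator_eq_eLpNorm_restrict (measurableSet_activeTimes x),
    Measure.restrict_congr_set (ae_activeTimes_eq x), eLpNorm_four_pow,
    setLIntegral_iUnion_of_directed]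
  · refine iSup_le fun q => ?_
    rw [← eLpNorm_four_pow]
    exact pow_le_pow_left' (le_of_lt q.2) 4
  · intro q r
    rcases le_total (TopologicalSpace.denseSeq ℝ≥0 q) (TopologicalSpace.denseSeq ℝ≥0 r) with h | h
    · exact ⟨r, Iio_subset_Iio h, subset_rfl⟩
    · exact ⟨q, subset_rfl, Iio_subset_Iio h⟩

variable {p : ℝ} {θ : ℝ → ℝ} {L : ℝ≥0}

/-- The truncated nonlinearity along a path. -/
def pathForce (hp : p ∈ Ioc 1 3) (θ : ℝ → ℝ) (x : ℝ≥0 → LTorus 4) (s : ℝ≥0) : LTorus (4 / 3) :=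
  (cut θ (pathNorm x s) : ℂ) • powerLp hp (x s)

lemma stopped_of_mem {x : ℝ≥0 → LTorus 4} {s : ℝ≥0} (h : s ∈ activeTimes x) : stopped x s = x s :=
  indicator_of_mem h x

lemma pathForce_of_notMem (hp : p ∈ Ioc 1 3) (hθ : IsCutoff θ) {x : ℝ≥0 → LTorus 4} {s : ℝ≥0}
    (h : s ∉ activeTimes x) : pathForce hp θ x s = 0 := by
  rw [pathForce, cut_eq_zero hθ (not_lt.1 h), Complex.ofReal_zero, zero_smul]

lemma norm_pathForce_le (hp : p ∈ Ioc 1 3) (hθ : IsCutoff θ) (hL : LipschitzWith L θ)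
    (x : ℝ≥0 → LTorus 4) (s : ℝ≥0) :
    ‖pathForce hp θ x s‖ ≤ 18 * L * (‖stopped x s‖ * (1 + ‖stopped x s‖ ^ 2 + ‖(0 : ℝ)‖ ^ 2)) := by
  by_cases h : s ∈ activeTimes x
  · rw [stopped_of_mem h, pathForce, norm_smul, Complex.norm_real, Real.norm_eq_abs]
    calc _ ≤ 2 * L * (9 * (‖x s‖ * (1 + ‖x s‖ ^ 2))) := by
          gcongr
          · exact abs_cut_le hθ hL _
          · exact norm_powerLp_le hp _
      _ = _ := by simp; ring
  · rw [pathForce_of_notMem hp hθ h, norm_zero]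
    positivity

/-- If both paths are active, the Lipschitz bounds for the power and for the cutoff combine. If only
one is, its cutoff value is itself a difference of cutoffs and hence at most `L δ`. In every case
the growth factors involve stopped paths only. -/
lemma norm_pathForce_sub_le (hp : p ∈ Ioc 1 3) (hθ : IsCutoff θ) (hL : LipschitzWith L θ)
    (x y : ℝ≥0 → LTorus 4) {s δ : ℝ≥0} (h1 : pathNorm x s ≤ pathNorm y s + δ)
    (h2 : pathNorm y s ≤ pathNorm x s + δ) :
    ‖pathForce hp θ x s - pathForce hp θ y s‖ ≤
      18 * L * (‖x s - y s‖ * (1 + ‖stopped x s‖ ^ 2 + ‖stopped y s‖ ^ 2)) +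
      9 * L * δ * (‖stopped x s‖ * (1 + ‖stopped x s‖ ^ 2 + ‖(0 : ℝ)‖ ^ 2)) +
      9 * L * δ * (‖stopped y s‖ * (1 + ‖stopped y s‖ ^ 2 + ‖(0 : ℝ)‖ ^ 2)) := by
  have hcut := abs_cut_sub_cut_le hL h1 h2
  by_cases hx : s ∈ activeTimes x
  · by_cases hy : s ∈ activeTimes y
    · rw [stopped_of_mem hx, stopped_of_mem hy]
      have e : pathForce hp θ x s - pathForce hp θ y s =
          (cut θ (pathNorm x s) : ℂ) • (powerLp hp (x s) - powerLp hp (y s)) +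
          ((cut θ (pathNorm x s) - cut θ (pathNorm y s) : ℝ) : ℂ) • powerLp hp (y s) := by
        rw [pathForce, pathForce]; push_cast; module
      rw [e]
      refine (norm_add_le _ _).trans ?_
      rw [norm_smul, norm_smul, Complex.norm_real, Complex.norm_real, Real.norm_eq_abs,
        Real.norm_eq_abs]
      have a1 : |cut θ (pathNorm x s)| * ‖powerLp hp (x s) - powerLp hp (y s)‖ ≤
          2 * L * (9 * (‖x s - y s‖ * (1 + ‖x s‖ ^ 2 + ‖y s‖ ^ 2))) := by
        gcongr
        · exact abs_cut_le hθ hL _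
        · exact norm_powerLp_sub_le hp _ _
      have a2 : |cut θ (pathNorm x s) - cut θ (pathNorm y s)| * ‖powerLp hp (y s)‖ ≤
          L * δ * (9 * (‖y s‖ * (1 + ‖y s‖ ^ 2))) := by
        gcongr
        exact norm_powerLp_le hp _
      have a3 : 0 ≤ 9 * L * δ * (‖x s‖ * (1 + ‖x s‖ ^ 2 + ‖(0 : ℝ)‖ ^ 2)) := by positivity
      refine (add_le_add a1 a2).trans ?_
      rw [norm_zero] at a3 ⊢
      linarith
    · rw [pathForce_of_notMem hp hθ hy, sub_zero, stopped_of_mem hx]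
      rw [cut_eq_zero hθ (not_lt.1 hy), sub_zero] at hcut
      have a2 : ‖pathForce hp θ x s‖ ≤ L * δ * (9 * (‖x s‖ * (1 + ‖x s‖ ^ 2))) := by
        rw [pathForce, norm_smul, Complex.norm_real, Real.norm_eq_abs]
        gcongr
        exact norm_powerLp_le hp _
      have a3 : 0 ≤ 18 * L * (‖x s - y s‖ * (1 + ‖x s‖ ^ 2 + ‖stopped y s‖ ^ 2)) := by positivity
      have a4 : 0 ≤ 9 * L * δ * (‖stopped y s‖ * (1 + ‖stopped y s‖ ^ 2 + ‖(0 : ℝ)‖ ^ 2)) := by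
        positivity
      rw [norm_zero] at a4 ⊢
      linarith
  · by_cases hy : s ∈ activeTimes y
    · rw [pathForce_of_notMem hp hθ hx, zero_sub, norm_neg, stopped_of_mem hy]
      rw [cut_eq_zero hθ (not_lt.1 hx), zero_sub, abs_neg] at hcut
      have a2 : ‖pathForce hp θ y s‖ ≤ L * δ * (9 * (‖y s‖ * (1 + ‖y s‖ ^ 2))) := by
        rw [pathForce, norm_smul, Complex.norm_real, Real.norm_eq_abs]
        gcongr
        exact norm_powerLp_le hp _
      have a3 : 0 ≤ 18 * L * (‖x s - y s‖ * (1 + ‖stopped x s‖ ^ 2 + ‖y s‖ ^ 2)) := by positivity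
      have a4 : 0 ≤ 9 * L * δ * (‖stopped x s‖ * (1 + ‖stopped x s‖ ^ 2 + ‖(0 : ℝ)‖ ^ 2)) := by
        positivity
      rw [norm_zero] at a4 ⊢
      linarith
    · rw [pathForce_of_notMem hp hθ hx, pathForce_of_notMem hp hθ hy, sub_zero, norm_zero]
      positivity

lemma stronglyMeasurable_stopped {x : ℝ≥0 → LTorus 4} (hx : StronglyMeasurable x) :
    StronglyMeasurable (stopped x) := hx.indicator (measurableSet_activeTimes x)

lemma stronglyMeasurable_pathForce (hp : p ∈ Ioc 1 3) (hL : LipschitzWith L θ)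
    {x : ℝ≥0 → LTorus 4} (hx : StronglyMeasurable x) : StronglyMeasurable (pathForce hp θ x) := by
  have h1 : Measurable fun s => (cut θ (pathNorm x s) : ℂ) :=
    Complex.measurable_ofReal.comp (hL.continuous.measurable.comp
      (((pathNorm_mono x).measurable.min measurable_const).ennreal_toReal))
  exact h1.stronglyMeasurable.smul ((continuous_powerLp hp).comp_stronglyMeasurable hx)

lemma eLpNorm_pathForce_le (hp : p ∈ Ioc 1 3) (hθ : IsCutoff θ) (hL : LipschitzWith L θ)
    {x : ℝ≥0 → LTorus 4} (hx : StronglyMeasurable x) {μ : Measure ℝ≥0} (hμ : μ ≤ timeMeasure) :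
    eLpNorm (pathForce hp θ x) (4 / 3) μ ≤
      ENNReal.ofReal (18 * L) * (2 * (eLpNorm (fun _ => (1 : ℝ)) 2 μ + 2 ^ 2)) := by
  have hs := (stronglyMeasurable_stopped hx).aestronglyMeasurable (μ := μ)
  have h1 := eLpNorm_mul_one_add_sq_le (c := fun _ => ‖(0 : ℝ)‖) hs.norm hs.norm
    aestronglyMeasurable_const
  refine (eLpNorm_le_mul_eLpNorm_of_ae_le_mul (ae_of_all _ fun s => ?_) _).trans
    (mul_le_mul_right (h1.trans ?_) _)
  · rw [Real.norm_of_nonneg (by positivity)]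
    exact norm_pathForce_le hp hθ hL x s
  · simp only [eLpNorm_norm]
    have := eLpNorm_stopped_le x μ hμ
    simp only [eLpNorm_zero', ne_eq, OfNat.ofNat_ne_zero, not_false_eq_true, zero_pow,
      add_zero]
    gcongr

lemma pathNorm_le_add {x y : ℝ≥0 → LTorus 4} (hx : StronglyMeasurable x)
    (hy : StronglyMeasurable y) {s T : ℝ≥0} (hs : s ≤ T) :
    pathNorm x s ≤ pathNorm y s +
      eLpNorm (fun t => x t - y t) 4 (timeMeasure.restrict (Icc 0 T)) := by
  have h1 : eLpNorm (fun t => x t - y t) 4 (timeMeasure.restrict (Iio s)) ≤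
      eLpNorm (fun t => x t - y t) 4 (timeMeasure.restrict (Icc 0 T)) :=
    eLpNorm_mono_measure _ (Measure.restrict_mono
      (fun t (ht : t < s) => (⟨zero_le, ht.le.trans hs⟩ : t ∈ Icc 0 T)) le_rfl)
  have h2 := eLpNorm_add_le (μ := timeMeasure.restrict (Iio s)) (p := 4) hy.aestronglyMeasurable
    (hx.sub hy).aestronglyMeasurable (by norm_num)
  rw [add_sub_cancel] at h2
  exact h2.trans (add_le_add le_rfl h1)

/-- The truncated nonlinearity is Lipschitz from `L⁴` to `L^{4/3}` in time, uniformly over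
all paths. -/
lemma eLpNorm_pathForce_sub_le (hp : p ∈ Ioc 1 3) (hθ : IsCutoff θ) (hL : LipschitzWith L θ)
    {x y : ℝ≥0 → LTorus 4} (hx : StronglyMeasurable x) (hy : StronglyMeasurable y) {T : ℝ≥0}
    (hT : T ≤ 1) :
    eLpNorm (fun s => pathForce hp θ x s - pathForce hp θ y s) (4 / 3)
      (timeMeasure.restrict (Icc 0 T)) ≤ ENNReal.ofReal (342 * L) *
        eLpNorm (fun s => x s - y s) 4 (timeMeasure.restrict (Icc 0 T)) := by
  set μ := timeMeasure.restrict (Icc 0 T) with hμ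
  have hμle : μ ≤ timeMeasure := Measure.restrict_le_self
  -- The cutoff falls from one to zero, so `L` is positive; otherwise the right side would be `0 · ∞
  -- = 0` when the paths are infinitely far apart.
  have hL0 : 0 < (342 * L : ℝ) := by
    have h := hL.dist_le_mul 0 2
    rw [hθ.eq_zero 2 (by simp), hθ.eq_one 0 (by simp), Real.dist_eq, Real.dist_eq] at h
    norm_num at h
    linarith
  by_cases hΔ : eLpNorm (fun s => x s - y s) 4 μ = ∞
  · rw [hΔ, ENNReal.mul_top (ENNReal.ofReal_pos.2 hL0).ne']
    exact le_top
  lift eLpNorm (fun s => x s - y s) 4 μ to ℝ≥0 using hΔ with δ hδ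
  have hsx := (stronglyMeasurable_stopped hx).aestronglyMeasurable (μ := μ)
  have hsy := (stronglyMeasurable_stopped hy).aestronglyMeasurable (μ := μ)
  have hxy := (hx.sub hy).aestronglyMeasurable (μ := μ)
  have h0 : AEStronglyMeasurable (fun _ : ℝ≥0 => ‖(0 : ℝ)‖) μ := aestronglyMeasurable_const
  have hone : eLpNorm (fun _ => (1 : ℝ)) 2 μ ≤ 1 := by
    refine (eLpNorm_le_of_ae_bound (C := 1) (ae_of_all _ fun _ => by simp)).trans ?_
    rw [ENNReal.ofReal_one, mul_one, hμ, Measure.restrict_apply_univ, timeMeasure_Icc_zero]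
    exact ENNReal.rpow_le_one (by exact_mod_cast hT) (by positivity)
  have b1 := eLpNorm_mul_one_add_sq_le hxy.norm hsx.norm hsy.norm
  have b2 := eLpNorm_mul_one_add_sq_le hsx.norm hsx.norm h0
  have b3 := eLpNorm_mul_one_add_sq_le hsy.norm hsy.norm h0
  have sx := eLpNorm_stopped_le x μ hμle
  have sy := eLpNorm_stopped_le y μ hμle
  simp only [eLpNorm_norm] at b1 b2 b3
  set g1 : ℝ≥0 → ℝ := fun s => ‖(x - y) s‖ * (1 + ‖stopped x s‖ ^ 2 + ‖stopped y s‖ ^ 2) with hg1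
  set g2 : ℝ≥0 → ℝ := fun s => ‖stopped x s‖ * (1 + ‖stopped x s‖ ^ 2 + ‖(0 : ℝ)‖ ^ 2) with hg2
  set g3 : ℝ≥0 → ℝ := fun s => ‖stopped y s‖ * (1 + ‖stopped y s‖ ^ 2 + ‖(0 : ℝ)‖ ^ 2) with hg3
  have c1 : eLpNorm g1 (4 / 3) μ ≤ δ * 9 := by
    refine b1.trans ?_
    rw [show eLpNorm (x - y) 4 μ = δ from hδ.symm]
    gcongr
    calc _ ≤ (1 : ℝ≥0∞) + 2 ^ 2 + 2 ^ 2 := by gcongr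
      _ = 9 := by norm_num
  have c2 : eLpNorm g2 (4 / 3) μ ≤ 10 := by
    refine b2.trans ?_
    rw [show eLpNorm (fun _ : ℝ≥0 => (0 : ℝ)) 4 μ = 0 by simp]
    calc _ ≤ (2 : ℝ≥0∞) * (1 + 2 ^ 2 + 0 ^ 2) := by gcongr
      _ = 10 := by norm_num
  have c3 : eLpNorm g3 (4 / 3) μ ≤ 10 := by
    refine b3.trans ?_
    rw [show eLpNorm (fun _ : ℝ≥0 => (0 : ℝ)) 4 μ = 0 by simp]
    calc _ ≤ (2 : ℝ≥0∞) * (1 + 2 ^ 2 + 0 ^ 2) := by gcongr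
      _ = 10 := by norm_num
  have m1 : AEStronglyMeasurable g1 μ :=
    hxy.norm.mul ((aestronglyMeasurable_const.add (hsx.norm.pow 2)).add (hsy.norm.pow 2))
  have m2 : AEStronglyMeasurable g2 μ :=
    hsx.norm.mul ((aestronglyMeasurable_const.add (hsx.norm.pow 2)).add (h0.pow 2))
  have m3 : AEStronglyMeasurable g3 μ :=
    hsy.norm.mul ((aestronglyMeasurable_const.add (hsy.norm.pow 2)).add (h0.pow 2))
  have hpt : ∀ᵐ s ∂μ, ‖pathForce hp θ x s - pathForce hp θ y s‖ ≤
      ((((18 * L : ℝ) • g1) + (9 * L * δ : ℝ) • g2) + (9 * L * δ : ℝ) • g3) s := by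
    filter_upwards [ae_restrict_mem measurableSet_Icc] with s hs
    have k1 := pathNorm_le_add hx hy hs.2
    have k2 := pathNorm_le_add hy hx hs.2
    have e : eLpNorm (fun t => y t - x t) 4 μ = δ := by
      rw [hδ]
      exact eLpNorm_sub_comm y x 4 μ
    rw [← hμ, ← hδ] at k1
    rw [← hμ, e] at k2
    exact norm_pathForce_sub_le hp hθ hL x y k1 k2
  refine (eLpNorm_mono_ae_real hpt).trans ?_
  have one_le : (1 : ℝ≥0∞) ≤ 4 / 3 := instFactFourThirds.out
  refine (eLpNorm_add_le ((m1.const_smul _).add (m2.const_smul _)) (m3.const_smul _)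
    one_le).trans ?_
  refine (add_le_add (eLpNorm_add_le (m1.const_smul _) (m2.const_smul _) one_le) le_rfl).trans ?_
  simp only [eLpNorm_const_smul]
  have e1 : ‖(18 * L : ℝ)‖ₑ = ENNReal.ofReal (18 * L) := Real.enorm_of_nonneg (by positivity)
  have e2 : ‖(9 * L * δ : ℝ)‖ₑ = ENNReal.ofReal (9 * L * δ) := Real.enorm_of_nonneg (by positivity)
  rw [e1, e2]
  -- Stopped norms at most two give the factors `9 = 1 + 4 + 4` and `10 = 2 (1 + 4)`, and `342 = 18
  -- · 9 + 2 · 9 · 10`.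
  calc _ ≤ ENNReal.ofReal (18 * L) * (δ * 9) + ENNReal.ofReal (9 * L * δ) * 10 +
        ENNReal.ofReal (9 * L * δ) * 10 := by gcongr
    _ = ENNReal.ofReal (342 * L) * δ := by
      rw [← ENNReal.ofReal_coe_nnreal (p := δ), ← ENNReal.ofReal_ofNat 9, ← ENNReal.ofReal_ofNat 10]
      repeat rw [← ENNReal.ofReal_mul (by positivity)]
      rw [← ENNReal.ofReal_add (by positivity) (by positivity),
        ← ENNReal.ofReal_add (by positivity) (by positivity)]
      congr 1
      ring

end Paths

end WND
end

/-! ### Predictable limits and fixed points, and the tails of data and forcing. -/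

noncomputable section
namespace WND

open ComplexConjugate Set Filter Topology AddCircle

section SubSigmaAlgebra

variable {α E : Type*} {m m0 : MeasurableSpace α} {μ : Measure[m0] α} [NormedAddCommGroup E]
  {q : ℝ≥0∞}

lemma memLp_trim_iff (hm : m ≤ m0) {f : α → E} (hf : StronglyMeasurable[m] f) :
    MemLp f q (μ.trim hm) ↔ MemLp f q μ :=
  ⟨memLp_of_memLp_trim hm, fun h => ⟨hf.aestronglyMeasurable, by
    rw [eLpNorm_trim hm hf]; exact h.2⟩⟩

variable [CompleteSpace E] [Fact (1 ≤ q)]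

/-- Completeness of the `L^q` functions that are measurable for a smaller `σ`-algebra. -/
lemma exists_stronglyMeasurable_limit (hm : m ≤ m0) {g : ℕ → α → E}
    (hg : ∀ n, StronglyMeasurable[m] (g n)) (hgq : ∀ n, MemLp (g n) q μ) {b : ℕ → ℝ≥0∞}
    (hb : Tendsto b atTop (𝓝 0)) (hgb : ∀ i j, i ≤ j → eLpNorm (g j - g i) q μ ≤ b i) :
    ∃ D : α → E, StronglyMeasurable[m] D ∧ MemLp D q μ ∧
      Tendsto (fun n => eLpNorm (g n - D) q μ) atTop (𝓝 0) := by
  have hgt : ∀ n, MemLp (g n) q (μ.trim hm) := fun n => (memLp_trim_iff hm (hg n)).2 (hgq n)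
  -- Working with the trimmed measure makes the limit measurable for the smaller `σ`-algebra itself;
  -- a limit for `μ` would provide this only up to null sets.
  set x : ℕ → Lp E q (μ.trim hm) := fun n => (hgt n).toLp with hx
  have hdist : ∀ i j, edist (x j) (x i) = eLpNorm (g j - g i) q μ := by
    intro i j
    rw [hx, Lp.edist_toLp_toLp, eLpNorm_trim hm ((hg j).sub (hg i))]
  have hcauchy : CauchySeq x := by
    rw [EMetric.cauchySeq_iff']
    intro ε hε
    obtain ⟨N, hN⟩ := (hb.eventually (gt_mem_nhds hε)).exists
    refine ⟨N, fun n hn => ?_⟩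
    rw [hdist]
    exact (hgb N n hn).trans_lt hN
  obtain ⟨y, hy⟩ := cauchySeq_tendsto_of_complete hcauchy
  refine ⟨y, Lp.stronglyMeasurable y, memLp_of_memLp_trim hm (Lp.memLp y), ?_⟩
  have h := Lp.tendsto_Lp_iff_tendsto_eLpNorm' x y |>.1 hy
  refine h.congr fun n => ?_
  rw [← eLpNorm_trim hm ((hg n).sub (Lp.stronglyMeasurable y))]
  exact eLpNorm_congr_ae ((hgt n).coeFn_toLp.sub (EventuallyEq.refl _ _))

/-- A contraction on the `L^q` functions measurable for a smaller `σ`-algebra has a fixed point. -/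
lemma exists_stronglyMeasurable_fixedPoint (hm : m ≤ m0) (Φ : (α → E) → α → E)
    (hΦ : ∀ u, StronglyMeasurable[m] u → MemLp u q μ →
      StronglyMeasurable[m] (Φ u) ∧ MemLp (Φ u) q μ)
    (hlip : ∀ u v, StronglyMeasurable[m] u → MemLp u q μ → StronglyMeasurable[m] v → MemLp v q μ →
      eLpNorm (Φ u - Φ v) q μ ≤ (1 / 2 : ℝ≥0) * eLpNorm (u - v) q μ) :
    ∃ u, StronglyMeasurable[m] u ∧ MemLp u q μ ∧ Φ u =ᵐ[μ] u := by
  have hmem : ∀ x : Lp E q (μ.trim hm), MemLp x q μ := fun x =>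
    memLp_of_memLp_trim hm (Lp.memLp x)
  have h1 := fun x : Lp E q (μ.trim hm) => hΦ x (Lp.stronglyMeasurable x) (hmem x)
  have h2 : ∀ x : Lp E q (μ.trim hm), MemLp (Φ x) q (μ.trim hm) := fun x =>
    (memLp_trim_iff hm (h1 x).1).2 (h1 x).2
  set Ψ : Lp E q (μ.trim hm) → Lp E q (μ.trim hm) := fun x => (h2 x).toLp with hΨ
  have hc : ContractingWith (1 / 2) Ψ := by
    refine ⟨by rw [← NNReal.coe_lt_coe]; norm_num, fun x y => ?_⟩
    rw [hΨ, Lp.edist_toLp_toLp, eLpNorm_trim hm ((h1 x).1.sub (h1 y).1), Lp.edist_def,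
      eLpNorm_trim hm ((Lp.stronglyMeasurable x).sub (Lp.stronglyMeasurable y))]
    exact hlip x y (Lp.stronglyMeasurable x) (hmem x) (Lp.stronglyMeasurable y) (hmem y)
  set x := hc.fixedPoint Ψ
  refine ⟨x, Lp.stronglyMeasurable x, hmem x, ?_⟩
  have h3 : Ψ x = x := hc.fixedPoint_isFixedPt
  have h4 : (Ψ x : α → E) =ᵐ[μ.trim hm] Φ x := (h2 x).coeFn_toLp
  rw [h3] at h4
  exact (ae_eq_of_ae_eq_trim h4).symm

end SubSigmaAlgebra

section LinearProblem

variable {Ω : Type*} {mΩ : MeasurableSpace Ω} {𝓕 : Filtration ℝ≥0 mΩ} {P : Measure Ω}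
  {T : ℝ≥0} {B : ℝ≥0 → Ω → ℝ}

lemma IsLinearData.eLpNorm_galerkin_pow_le [IsProbabilityMeasure P] {S : Finset ℤ}
    {a : ℤ → Ω → ℂ} {f : ℤ → ℝ≥0 → Ω → ℂ} {ρ : ℝ≥0 → Ω → ℝ}
    (H : IsLinearData 𝓕 P T B S a f ρ) {ε : ℝ} (hε : 0 ≤ ε) (hε1 : ε ≤ 1)
    (hT : (T : ℝ) ≤ ε ^ 4) (hK : strichartzConst * ε ≤ 1 / 2) :
    eLpNorm (fun z : ℝ≥0 × Ω => galerkin B S a f z.1 z.2) 4 (timeProb T P) ^ 4 ≤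
      ENNReal.ofReal (2 * strichartzConst * ε) *
        (∫⁻ ω, ENNReal.ofReal (dataNorm S a ω ^ 4) ∂P +
          ∫⁻ ω, eLpNorm (fun s => ρ s ω) (4 / 3) (timeMeasure.restrict (Icc 0 T)) ^ 4 ∂P) := by
  have h := H.integral_solNorm_pow_le hε hε1 hT hK
  rw [H.integral_solNorm_pow] at h
  have e1 : ENNReal.ofReal (∫ z : ℝ≥0 × Ω, ‖galerkin B S a f z.1 z.2‖ ^ 4 ∂(timeProb T P)) =
      eLpNorm (fun z : ℝ≥0 × Ω => galerkin B S a f z.1 z.2) 4 (timeProb T P) ^ 4 := by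
    rw [ofReal_integral_eq_lintegral_ofReal H.integrable_norm_galerkin_pow
      (ae_of_all _ fun z => by positivity), eLpNorm_four_pow]
    refine lintegral_congr fun z => ?_
    rw [ENNReal.ofReal_pow (norm_nonneg _), ofReal_norm]
  have e2 : ENNReal.ofReal (∫ ω, forceNorm T ρ ω ^ 4 ∂P) =
      ∫⁻ ω, eLpNorm (fun s => ρ s ω) (4 / 3) (timeMeasure.restrict (Icc 0 T)) ^ 4 ∂P := by
    rw [ofReal_integral_eq_lintegral_ofReal H.integrable_forceNorm_pow
      (ae_of_all _ fun ω => by positivity)]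
    refine lintegral_congr fun ω => ?_
    rw [ENNReal.ofReal_pow (forceNorm_nonneg ω), forceNorm,
      ENNReal.ofReal_toReal (H.memLp_ρ ω).2.ne]
  rw [← e1, ← e2, ← ofReal_integral_eq_lintegral_ofReal H.integrable_dataNorm_pow
      (ae_of_all _ fun ω => by positivity), ← ENNReal.ofReal_add
      (integral_nonneg fun ω => by positivity) (integral_nonneg fun ω => by positivity),
    ← ENNReal.ofReal_mul (by have := strichartzConst_pos; positivity)]
  exact ENNReal.ofReal_le_ofReal h

/-- The Fourier coefficients of the initial datum. -/
def dataCoeff (u₀ : Ω → LTorus 2) (k : ℤ) (ω : Ω) : ℂ := coeff 2 k (u₀ ω)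

/-- The Fourier coefficients of the forcing `-i F`. -/
def forceCoeff (F : ℝ≥0 → Ω → LTorus (4 / 3)) (k : ℤ) (s : ℝ≥0) (ω : Ω) : ℂ :=
  -Complex.I * coeff (4 / 3) k (F s ω)

/-- A predictable forcing that is bounded in `L^{4/3}([0, T] × 𝕋)`, uniformly over all paths. -/
structure IsForcing (𝓕 : Filtration ℝ≥0 mΩ) (T : ℝ≥0) (F : ℝ≥0 → Ω → LTorus (4 / 3)) : Prop where
  predictable : IsStronglyPredictable 𝓕 F
  integrable : ∀ t ω, IntegrableOn (fun s => F s ω) (Icc 0 t) timeMeasure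
  bound : ∃ M : ℝ≥0, ∀ ω, eLpNorm (fun s => F s ω) (4 / 3) (timeMeasure.restrict (Icc 0 T)) ≤ M

lemma IsForcing.stronglyMeasurable {F : ℝ≥0 → Ω → LTorus (4 / 3)} (hF : IsForcing 𝓕 T F) :
    StronglyMeasurable (Function.uncurry F) :=
  StronglyMeasurable.mono hF.predictable (predictable_le_prod 𝓕)

lemma IsForcing.sub {F G : ℝ≥0 → Ω → LTorus (4 / 3)} (hF : IsForcing 𝓕 T F)
    (hG : IsForcing 𝓕 T G) : IsForcing 𝓕 T (fun s ω => F s ω - G s ω) where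
  predictable := StronglyMeasurable.sub hF.predictable hG.predictable
  integrable t ω := (hF.integrable t ω).sub (hG.integrable t ω)
  bound := by
    obtain ⟨M, hM⟩ := hF.bound
    obtain ⟨N, hN⟩ := hG.bound
    refine ⟨M + N, fun ω => ?_⟩
    refine (eLpNorm_sub_le ?_ ?_ instFactFourThirds.out).trans
      (by rw [ENNReal.coe_add]; exact add_le_add (hM ω) (hN ω))
    · exact (hF.stronglyMeasurable.comp_measurable
        (measurable_prodMk_right (y := ω))).aestronglyMeasurable
    · exact (hG.stronglyMeasurable.comp_measurable
        (measurable_prodMk_right (y := ω))).aestronglyMeasurable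

/-- The set `S'` decides what is measured. For `S' = ∅` the size of the forcing is its full norm;
for `S'` a window disjoint from `S` it is the distance to low frequencies, which is small for high
blocks. -/
lemma isLinearData (hB : IsDriver 𝓕 B P) {u₀ : Ω → LTorus 2} (hu₀ : StronglyMeasurable[𝓕 0] u₀)
    (hu₀' : MemLp u₀ 4 P) {F : ℝ≥0 → Ω → LTorus (4 / 3)} (hF : IsForcing 𝓕 T F)
    {S S' : Finset ℤ} (hS : Disjoint S S') :
    IsLinearData 𝓕 P T B S (dataCoeff u₀) (forceCoeff F) (fun s ω => trigDist S' (F s ω)) where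
  driver := hB
  a_meas k := ((coeff 2 k).continuous.comp_stronglyMeasurable hu₀).measurable
  a_memLp k := (coeff 2 k).comp_memLp' hu₀'
  f_pred k := by
    have h := hF.predictable
    unfold IsStronglyPredictable at h
    have h2 := (continuous_const.mul (coeff (4 / 3) k).continuous
      : Continuous fun F => -Complex.I * coeff (4 / 3) k F).comp_stronglyMeasurable h
    exact h2.measurable
  f_int k t ω := ((coeff (4 / 3) k).integrable_comp (hF.integrable t ω)).const_mul _
  ρ_meas := ((continuous_trigDist S').comp_stronglyMeasurable hF.stronglyMeasurable).measurable
  ρ_nonneg s ω := trigDist_nonneg _ _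
  pair s ω d := by
    simp only [forceCoeff, mul_assoc]
    rw [← Finset.mul_sum, norm_mul, norm_neg, Complex.norm_I, one_mul]
    exact norm_sum_coeff_le_trigDist hS _ d
  ρ_le := by
    obtain ⟨M, hM⟩ := hF.bound
    refine ⟨M, fun ω => (eLpNorm_mono fun s => ?_).trans (hM ω)⟩
    rw [Real.norm_of_nonneg (trigDist_nonneg _ _)]
    exact trigDist_le_norm _ _

/-- The squared `ℓ²` mass of the datum at the frequencies outside `[-n, n]`. -/
def dataTail (u₀ : Ω → LTorus 2) (n : ℕ) (ω : Ω) : ℝ :=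
  (2 * Real.pi)⁻¹ * ‖u₀ ω‖ ^ 2 - ∑ k ∈ window n, ‖dataCoeff u₀ k ω‖ ^ 2

lemma sum_sq_dataCoeff_le_dataTail (u₀ : Ω → LTorus 2) {S : Finset ℤ} {n : ℕ}
    (hS : Disjoint S (window n)) (ω : Ω) :
    ∑ k ∈ S, ‖dataCoeff u₀ k ω‖ ^ 2 ≤ dataTail u₀ n ω := by
  rw [dataTail, le_sub_iff_add_le, ← Finset.sum_union hS]
  exact sum_le_hasSum _ (fun k _ => sq_nonneg _) (hasSum_sq_coeff (u₀ ω))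

lemma sum_sq_dataCoeff_le (u₀ : Ω → LTorus 2) (S : Finset ℤ) (ω : Ω) :
    ∑ k ∈ S, ‖dataCoeff u₀ k ω‖ ^ 2 ≤ ‖u₀ ω‖ ^ 2 := by
  refine (sum_le_hasSum S (fun k _ => sq_nonneg _) (hasSum_sq_coeff (u₀ ω))).trans ?_
  refine mul_le_of_le_one_left (sq_nonneg _) (inv_le_one_of_one_le₀ ?_)
  nlinarith [Real.pi_gt_three]

lemma dataTail_nonneg (u₀ : Ω → LTorus 2) (n : ℕ) (ω : Ω) : 0 ≤ dataTail u₀ n ω := by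
  have := sum_sq_dataCoeff_le_dataTail u₀ (Finset.disjoint_empty_left (window n)) ω
  simpa using this

lemma dataTail_le (u₀ : Ω → LTorus 2) (n : ℕ) (ω : Ω) : dataTail u₀ n ω ≤ ‖u₀ ω‖ ^ 2 := by
  have h1 : (2 * Real.pi)⁻¹ * ‖u₀ ω‖ ^ 2 ≤ ‖u₀ ω‖ ^ 2 := by
    refine mul_le_of_le_one_left (sq_nonneg _) (inv_le_one_of_one_le₀ ?_)
    nlinarith [Real.pi_gt_three]
  have h2 : 0 ≤ ∑ k ∈ window n, ‖dataCoeff u₀ k ω‖ ^ 2 := Finset.sum_nonneg fun _ _ => sq_nonneg _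
  rw [dataTail]; linarith

lemma tendsto_dataTail (u₀ : Ω → LTorus 2) (ω : Ω) :
    Tendsto (fun n => dataTail u₀ n ω) atTop (𝓝 0) := by
  have h : Tendsto (fun n => ∑ k ∈ window n, ‖dataCoeff u₀ k ω‖ ^ 2) atTop
      (𝓝 ((2 * Real.pi)⁻¹ * ‖u₀ ω‖ ^ 2)) := (hasSum_sq_coeff (u₀ ω)).comp tendsto_window
  have := h.const_sub ((2 * Real.pi)⁻¹ * ‖u₀ ω‖ ^ 2)
  rwa [sub_self] at this

/-- The `L^{4/3}` norm in time of the distance of the forcing to the frequencies `[-n, n]`. -/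
def forceTail (T : ℝ≥0) (F : ℝ≥0 → Ω → LTorus (4 / 3)) (n : ℕ) (ω : Ω) : ℝ≥0∞ :=
  eLpNorm (fun s => trigDist (window n) (F s ω)) (4 / 3) (timeMeasure.restrict (Icc 0 T))

lemma forceTail_le (F : ℝ≥0 → Ω → LTorus (4 / 3)) (n : ℕ) (ω : Ω) :
    forceTail T F n ω ≤ eLpNorm (fun s => F s ω) (4 / 3) (timeMeasure.restrict (Icc 0 T)) := by
  refine eLpNorm_mono fun s => ?_
  rw [Real.norm_of_nonneg (trigDist_nonneg _ _)]
  exact trigDist_le_norm _ _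

lemma IsForcing.measurable_forceTail {F : ℝ≥0 → Ω → LTorus (4 / 3)} (hF : IsForcing 𝓕 T F)
    (n : ℕ) : Measurable (forceTail T F n) :=
  measurable_eLpNorm_slice ((continuous_trigDist _).comp_stronglyMeasurable hF.stronglyMeasurable)
    (ne_of_gt (zero_lt_one.trans_le instFactFourThirds.out))
    (ENNReal.div_ne_top (by norm_num) (by norm_num)) _

lemma IsForcing.tendsto_forceTail {F : ℝ≥0 → Ω → LTorus (4 / 3)} (hF : IsForcing 𝓕 T F) (ω : Ω) :
    Tendsto (fun n => forceTail T F n ω) atTop (𝓝 0) := by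
  have hp0 : (4 / 3 : ℝ≥0∞) ≠ 0 := ne_of_gt (zero_lt_one.trans_le instFactFourThirds.out)
  have hpt : (4 / 3 : ℝ≥0∞) ≠ ∞ := ENNReal.div_ne_top (by norm_num) (by norm_num)
  have hpos : 0 < (4 / 3 : ℝ≥0∞).toReal := ENNReal.toReal_pos hp0 hpt
  have hFm : StronglyMeasurable fun s => F s ω :=
    hF.stronglyMeasurable.comp_measurable (measurable_prodMk_right (y := ω))
  obtain ⟨M, hM⟩ := hF.bound
  have hfin := (hM ω).trans_lt ENNReal.coe_lt_top
  simp only [forceTail, eLpNorm_eq_lintegral_rpow_enorm_toReal hp0 hpt] at hfin ⊢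
  have h1 : Tendsto (fun n => ∫⁻ s in Icc 0 T, ‖trigDist (window n) (F s ω)‖ₑ ^
      (4 / 3 : ℝ≥0∞).toReal ∂timeMeasure) atTop (𝓝 (∫⁻ _ in Icc 0 T, 0 ∂timeMeasure)) := by
    refine tendsto_lintegral_of_dominated_convergence
      (fun s => ‖F s ω‖ₑ ^ (4 / 3 : ℝ≥0∞).toReal) (fun n => ?_) (fun n => ae_of_all _ fun s => ?_)
      ?_ (ae_of_all _ fun s => ?_)
    · exact ((continuous_trigDist _).comp_stronglyMeasurable hFm).enorm.pow_const _
    · refine ENNReal.rpow_le_rpow ?_ hpos.le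
      rw [enorm_le_iff_norm_le, Real.norm_of_nonneg (trigDist_nonneg _ _)]
      exact trigDist_le_norm _ _
    · exact (lintegral_rpow_enorm_lt_top_of_eLpNorm_lt_top hp0 hpt (by
        rw [eLpNorm_eq_lintegral_rpow_enorm_toReal hp0 hpt]; exact hfin)).ne
    · have := ((tendsto_trigDist (F s ω)).enorm).ennrpow_const (4 / 3 : ℝ≥0∞).toReal
      simpa [ENNReal.zero_rpow_of_pos hpos] using this
  rw [lintegral_zero] at h1
  have h2 := h1.ennrpow_const (1 / (4 / 3 : ℝ≥0∞).toReal)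
  rwa [ENNReal.zero_rpow_of_pos (by positivity)] at h2

/-- The modulus that controls the frequencies outside `[-n, n]`. -/
def tailModulus (T : ℝ≥0) (P : Measure Ω) (u₀ : Ω → LTorus 2) (F : ℝ≥0 → Ω → LTorus (4 / 3))
    (n : ℕ) : ℝ≥0∞ :=
  ∫⁻ ω, ENNReal.ofReal (dataTail u₀ n ω ^ 2) ∂P + ∫⁻ ω, forceTail T F n ω ^ 4 ∂P

/-- Dominated convergence in `ω`, with majorants `‖u₀‖⁴` for the data and the uniform bound of the
forcing. -/
lemma tendsto_tailModulus [IsProbabilityMeasure P] {u₀ : Ω → LTorus 2} (hu₀' : MemLp u₀ 4 P)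
    {F : ℝ≥0 → Ω → LTorus (4 / 3)} (hF : IsForcing 𝓕 T F) :
    Tendsto (tailModulus T P u₀ F) atTop (𝓝 0) := by
  have h1 : Tendsto (fun n => ∫⁻ ω, ENNReal.ofReal (dataTail u₀ n ω ^ 2) ∂P) atTop
      (𝓝 (∫⁻ _, 0 ∂P)) := by
    refine tendsto_lintegral_of_dominated_convergence' (fun ω => ‖u₀ ω‖ₑ ^ 4) (fun n => ?_)
      (fun n => ae_of_all _ fun ω => ?_) ?_ (ae_of_all _ fun ω => ?_)
    · refine ((AEMeasurable.sub ?_ ?_).pow_const 2).ennreal_ofReal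
      · exact (hu₀'.1.norm.aemeasurable.pow_const 2).const_mul _
      · exact Finset.aemeasurable_fun_sum _ fun k _ =>
          ((coeff 2 k).continuous.comp_aestronglyMeasurable hu₀'.1).norm.aemeasurable.pow_const 2
    · beta_reduce
      rw [← ofReal_norm, ← ENNReal.ofReal_pow (norm_nonneg _)]
      refine ENNReal.ofReal_le_ofReal ?_
      calc dataTail u₀ n ω ^ 2 ≤ (‖u₀ ω‖ ^ 2) ^ 2 :=
            pow_le_pow_left₀ (dataTail_nonneg u₀ n ω) (dataTail_le u₀ n ω) 2
        _ = _ := by ring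
    · rw [← eLpNorm_four_pow]
      exact ENNReal.pow_ne_top hu₀'.2.ne
    · have := ((tendsto_dataTail u₀ ω).pow 2)
      simpa using ENNReal.tendsto_ofReal this
  have h2 : Tendsto (fun n => ∫⁻ ω, forceTail T F n ω ^ 4 ∂P) atTop (𝓝 (∫⁻ _, 0 ∂P)) := by
    obtain ⟨M, hM⟩ := hF.bound
    refine tendsto_lintegral_of_dominated_convergence (fun _ => (M : ℝ≥0∞) ^ 4)
      (fun n => (hF.measurable_forceTail n).pow_const 4) (fun n => ae_of_all _ fun ω => ?_) ?_
      (ae_of_all _ fun ω => ?_)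
    · exact pow_le_pow_left' ((forceTail_le F n ω).trans (hM ω)) 4
    · simp
    · have := (hF.tendsto_forceTail ω)
      have h := (ENNReal.continuous_pow 4).tendsto 0 |>.comp this
      simpa [Function.comp_def] using h
  rw [lintegral_zero] at h1 h2
  have h := h1.add h2
  rwa [add_zero] at h

end LinearProblem

end WND
end

/-! ### The linear problem as a limit of Galerkin approximations. -/

noncomputable section
namespace WND

open ComplexConjugate Set Filter Topology AddCircle

lemma eLpNorm_le_of_tendsto {α E : Type*} [MeasurableSpace α] {μ : Measure α}
    [NormedAddCommGroup E] {q : ℝ≥0∞} (hq : 1 ≤ q) {g : ℕ → α → E} {D : α → E}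
    (hg : ∀ n, AEStronglyMeasurable (g n) μ) (hD : AEStronglyMeasurable D μ)
    (h : Tendsto (fun n => eLpNorm (g n - D) q μ) atTop (𝓝 0)) {C : ℝ≥0∞}
    (hC : ∀ n, eLpNorm (g n) q μ ≤ C) : eLpNorm D q μ ≤ C := by
  have h1 : ∀ n, eLpNorm D q μ ≤ C + eLpNorm (g n - D) q μ := by
    intro n
    have := eLpNorm_sub_le (p := q) (hg n) ((hg n).sub hD) hq
    rw [sub_sub_cancel] at this
    exact this.trans (add_le_add (hC n) le_rfl)
  have h2 := h.const_add C
  rw [add_zero] at h2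
  exact ge_of_tendsto' h2 h1

lemma le_rpow_of_pow_four_le {x y : ℝ≥0∞} (h : x ^ 4 ≤ y) : x ≤ y ^ (1 / 4 : ℝ) := by
  have h1 := ENNReal.rpow_le_rpow h (z := 1 / 4) (by norm_num)
  rw [← ENNReal.rpow_natCast, ← ENNReal.rpow_mul] at h1
  norm_num at h1 ⊢
  exact h1

section LinearSolution

variable {Ω : Type*} {mΩ : MeasurableSpace Ω} {𝓕 : Filtration ℝ≥0 mΩ} {P : Measure Ω}
  {T : ℝ≥0} {B : ℝ≥0 → Ω → ℝ} {u₀ : Ω → LTorus 2} {F G : ℝ≥0 → Ω → LTorus (4 / 3)}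

/-- The Galerkin approximation at the frequencies `[-n, n]` of the linear problem with datum `u₀`
and forcing `-i F`. -/
def approx (B : ℝ≥0 → Ω → ℝ) (u₀ : Ω → LTorus 2) (F : ℝ≥0 → Ω → LTorus (4 / 3)) (n : ℕ)
    (z : ℝ≥0 × Ω) : LTorus 4 :=
  galerkin B (window n) (dataCoeff u₀) (forceCoeff F) z.1 z.2

/-- `D` is the limit in `L⁴_{ω,T,x}` of the Galerkin approximations of the linear problem. -/
structure IsLinearSolution (𝓕 : Filtration ℝ≥0 mΩ) (P : Measure Ω) (T : ℝ≥0) (B : ℝ≥0 → Ω → ℝ)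
    (u₀ : Ω → LTorus 2) (F : ℝ≥0 → Ω → LTorus (4 / 3)) (D : ℝ≥0 → Ω → LTorus 4) : Prop where
  predictable : IsStronglyPredictable 𝓕 D
  memLp : MemLp (Function.uncurry D) 4 (timeProb T P)
  tendsto : Tendsto (fun n => eLpNorm (approx B u₀ F n - Function.uncurry D) 4 (timeProb T P))
    atTop (𝓝 0)

variable {ε : ℝ}

/-- The linear estimate on a high block, where both data and forcing are replaced by their tails. -/
lemma eLpNorm_galerkin_tail_le [IsProbabilityMeasure P] (hB : IsDriver 𝓕 B P) (hu₀ : StronglyMeasurable[𝓕 0] u₀)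
    (hu₀' : MemLp u₀ 4 P) (hF : IsForcing 𝓕 T F) (hε : 0 ≤ ε) (hε1 : ε ≤ 1)
    (hT : (T : ℝ) ≤ ε ^ 4) (hK : strichartzConst * ε ≤ 1 / 2) {S : Finset ℤ} {n : ℕ}
    (hS : Disjoint S (window n)) :
    eLpNorm (fun z : ℝ≥0 × Ω => galerkin B S (dataCoeff u₀) (forceCoeff F) z.1 z.2) 4
      (timeProb T P) ≤ (ENNReal.ofReal (2 * strichartzConst * ε) * tailModulus T P u₀ F n) ^
        (1 / 4 : ℝ) := by
  refine le_rpow_of_pow_four_le (((isLinearData hB hu₀ hu₀' hF hS).eLpNorm_galerkin_pow_le hε hε1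
    hT hK).trans ?_)
  refine mul_le_mul_right (add_le_add (lintegral_mono fun ω => ?_) le_rfl) _
  refine ENNReal.ofReal_le_ofReal ?_
  have h := sum_sq_dataCoeff_le_dataTail u₀ hS ω
  rw [← dataNorm_sq] at h
  calc dataNorm S (dataCoeff u₀) ω ^ 4 = (dataNorm S (dataCoeff u₀) ω ^ 2) ^ 2 := by ring
    _ ≤ _ := pow_le_pow_left₀ (sq_nonneg _) h 2

lemma predictable_approx (hB : IsDriver 𝓕 B P) (hu₀ : StronglyMeasurable[𝓕 0] u₀)
    (hu₀' : MemLp u₀ 4 P) (hF : IsForcing 𝓕 T F) (n : ℕ) :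
    StronglyMeasurable[𝓕.predictable] (approx B u₀ F n) :=
  (isLinearData hB hu₀ hu₀' hF (Finset.disjoint_empty_right (window n))).predictable_galerkin

lemma stronglyMeasurable_approx (hB : IsDriver 𝓕 B P) (hu₀ : StronglyMeasurable[𝓕 0] u₀)
    (hu₀' : MemLp u₀ 4 P) (hF : IsForcing 𝓕 T F) (n : ℕ) : StronglyMeasurable (approx B u₀ F n) :=
  (predictable_approx hB hu₀ hu₀' hF n).mono (predictable_le_prod 𝓕)

lemma eLpNorm_approx_pow_le [IsProbabilityMeasure P] (hB : IsDriver 𝓕 B P) (hu₀ : StronglyMeasurable[𝓕 0] u₀)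
    (hu₀' : MemLp u₀ 4 P) (hF : IsForcing 𝓕 T F) (hε : 0 ≤ ε) (hε1 : ε ≤ 1)
    (hT : (T : ℝ) ≤ ε ^ 4) (hK : strichartzConst * ε ≤ 1 / 2) (n : ℕ) :
    eLpNorm (approx B u₀ F n) 4 (timeProb T P) ^ 4 ≤ ENNReal.ofReal (2 * strichartzConst * ε) *
      (eLpNorm u₀ 4 P ^ 4 + ∫⁻ ω, eLpNorm (fun s => F s ω) (4 / 3)
        (timeMeasure.restrict (Icc 0 T)) ^ 4 ∂P) := by
  refine ((isLinearData hB hu₀ hu₀' hF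
    (Finset.disjoint_empty_right (window n))).eLpNorm_galerkin_pow_le hε hε1 hT hK).trans ?_
  simp only [trigDist_empty, eLpNorm_norm]
  refine mul_le_mul_right (add_le_add ?_ le_rfl) _
  rw [eLpNorm_four_pow]
  refine lintegral_mono fun ω => ?_
  rw [← ofReal_norm, ← ENNReal.ofReal_pow (norm_nonneg _)]
  refine ENNReal.ofReal_le_ofReal ?_
  have h := sum_sq_dataCoeff_le u₀ (window n) ω
  rw [← dataNorm_sq] at h
  calc dataNorm (window n) (dataCoeff u₀) ω ^ 4 = (dataNorm (window n) (dataCoeff u₀) ω ^ 2) ^ 2 := by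
        ring
    _ ≤ (‖u₀ ω‖ ^ 2) ^ 2 := pow_le_pow_left₀ (sq_nonneg _) h 2
    _ = _ := by ring

theorem exists_isLinearSolution [IsProbabilityMeasure P] (hB : IsDriver 𝓕 B P) (hu₀ : StronglyMeasurable[𝓕 0] u₀)
    (hu₀' : MemLp u₀ 4 P) (hF : IsForcing 𝓕 T F) (hε : 0 ≤ ε) (hε1 : ε ≤ 1)
    (hT : (T : ℝ) ≤ ε ^ 4) (hK : strichartzConst * ε ≤ 1 / 2) :
    ∃ D, IsLinearSolution 𝓕 P T B u₀ F D := by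
  have hb : Tendsto (fun n => (ENNReal.ofReal (2 * strichartzConst * ε) * tailModulus T P u₀ F n) ^
      (1 / 4 : ℝ)) atTop (𝓝 0) := by
    have h1 := ENNReal.Tendsto.const_mul (tendsto_tailModulus hu₀' hF)
      (Or.inr (ENNReal.ofReal_ne_top (r := 2 * strichartzConst * ε)))
    have h2 := h1.ennrpow_const (1 / 4)
    rwa [mul_zero, ENNReal.zero_rpow_of_pos (by norm_num)] at h2
  obtain ⟨D, hD1, hD2, hD3⟩ := exists_stronglyMeasurable_limit (predictable_le_prod 𝓕)
    (μ := timeProb T P) (q := 4) (predictable_approx hB hu₀ hu₀' hF)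
    (fun n => ⟨(stronglyMeasurable_approx hB hu₀ hu₀' hF n).aestronglyMeasurable, by
      have h := eLpNorm_approx_pow_le hB hu₀ hu₀' hF hε hε1 hT hK n
      obtain ⟨M, hM⟩ := hF.bound
      have h2 : ∫⁻ ω, eLpNorm (fun s => F s ω) (4 / 3)
        (timeMeasure.restrict (Icc 0 T)) ^ 4 ∂P ≤ (M : ℝ≥0∞) ^ 4 := by
        refine (lintegral_mono fun ω => pow_le_pow_left' (hM ω) 4).trans ?_
        simp
      have h3 : eLpNorm (approx B u₀ F n) 4 (timeProb T P) ^ 4 < ∞ := by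
        refine h.trans_lt (ENNReal.mul_lt_top ENNReal.ofReal_lt_top (ENNReal.add_lt_top.2
          ⟨ENNReal.pow_lt_top hu₀'.2, h2.trans_lt (ENNReal.pow_lt_top ENNReal.coe_lt_top)⟩))
      exact (ENNReal.pow_lt_top_iff.1 h3).resolve_right (by norm_num)⟩)
    -- With a given forcing the frequencies do not interact, so the difference of two approximations
    -- is the Galerkin solution on the difference of the windows.
    hb (fun i j hij => by
      refine le_trans (le_of_eq ?_) (eLpNorm_galerkin_tail_le hB hu₀ hu₀' hF hε hε1 hT hK
        (Finset.sdiff_disjoint (t := window j) (s := window i)))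
      congr 1
      funext z
      exact trig_sub_trig (window_mono hij) _)
  exact ⟨fun t ω => D (t, ω), hD1, hD2, hD3⟩

namespace IsLinearSolution

variable {D E : ℝ≥0 → Ω → LTorus 4}

lemma stronglyMeasurable (hD : IsLinearSolution 𝓕 P T B u₀ F D) :
    StronglyMeasurable (Function.uncurry D) :=
  StronglyMeasurable.mono hD.predictable (predictable_le_prod 𝓕)

/-- The Fourier coefficients of the solution of the linear problem. -/
lemma coeff_eq (hD : IsLinearSolution 𝓕 P T B u₀ F D) (hB : IsDriver 𝓕 B P)
    (hu₀ : StronglyMeasurable[𝓕 0] u₀) (hu₀' : MemLp u₀ 4 P) (hF : IsForcing 𝓕 T F) :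
    ∀ᵐ z : ℝ≥0 × Ω ∂(timeProb T P), ∀ k : ℤ, coeff 4 k (D z.1 z.2) =
      amplitude B (dataCoeff u₀) (forceCoeff F) k z.1 z.2 := by
  rw [ae_all_iff]
  intro k
  have H := isLinearData hB hu₀ hu₀' hF (Finset.disjoint_empty_right ∅)
  set g : ℝ≥0 × Ω → ℂ := fun z => coeff 4 k (D z.1 z.2) -
    amplitude B (dataCoeff u₀) (forceCoeff F) k z.1 z.2 with hg
  have hgm : AEStronglyMeasurable g (timeProb T P) :=
    (((coeff 4 k).continuous.comp_stronglyMeasurable hD.stronglyMeasurable).sub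
      (H.measurable_amplitude_prod k).stronglyMeasurable).aestronglyMeasurable
  -- A coefficient is a bounded functional, and for an approximation it is exactly the amplitude as
  -- soon as the window contains `k`.
  have h0 : eLpNorm g 4 (timeProb T P) ≤ 0 := by
    refine ge_of_tendsto hD.tendsto ?_
    filter_upwards [eventually_mem_window k] with n hn
    refine eLpNorm_mono fun z => ?_
    have e : g z = -coeff 4 k (approx B u₀ F n z - Function.uncurry D z) := by
      rw [map_sub, approx, galerkin, coeff_trig, if_pos hn, neg_sub]
      rfl
    rw [e, norm_neg]
    exact norm_coeff_le _ k
  have h1 := (eLpNorm_eq_zero_iff hgm (by norm_num)).1 (le_antisymm h0 zero_le)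
  filter_upwards [h1] with z hz
  exact sub_eq_zero.1 hz

/-- The linear estimate is proved for Galerkin limits only; this carries it over to an arbitrary
process that satisfies the Duhamel formula. -/
lemma eq_of_coeff_eq (hD : IsLinearSolution 𝓕 P T B u₀ F D) (hB : IsDriver 𝓕 B P)
    (hu₀ : StronglyMeasurable[𝓕 0] u₀) (hu₀' : MemLp u₀ 4 P) (hF : IsForcing 𝓕 T F)
    (hE : ∀ᵐ z : ℝ≥0 × Ω ∂(timeProb T P), ∀ k : ℤ, coeff 4 k (E z.1 z.2) =
      amplitude B (dataCoeff u₀) (forceCoeff F) k z.1 z.2) :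
    Function.uncurry E =ᵐ[timeProb T P] Function.uncurry D := by
  filter_upwards [hD.coeff_eq hB hu₀ hu₀' hF, hE] with z h1 h2
  exact eq_of_coeff_four_eq fun k => (h2 k).trans (h1 k).symm

lemma congr (hD : IsLinearSolution 𝓕 P T B u₀ F D) (hE : IsStronglyPredictable 𝓕 E)
    (h : Function.uncurry E =ᵐ[timeProb T P] Function.uncurry D) :
    IsLinearSolution 𝓕 P T B u₀ F E where
  predictable := hE
  memLp := hD.memLp.ae_eq h.symm
  tendsto := by
    refine hD.tendsto.congr fun n => ?_
    exact eLpNorm_congr_ae ((EventuallyEq.refl _ _).sub h.symm)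

lemma eLpNorm_pow_le [IsProbabilityMeasure P] (hD : IsLinearSolution 𝓕 P T B u₀ F D) (hB : IsDriver 𝓕 B P)
    (hu₀ : StronglyMeasurable[𝓕 0] u₀) (hu₀' : MemLp u₀ 4 P) (hF : IsForcing 𝓕 T F)
    (hε : 0 ≤ ε) (hε1 : ε ≤ 1) (hT : (T : ℝ) ≤ ε ^ 4) (hK : strichartzConst * ε ≤ 1 / 2) :
    eLpNorm (Function.uncurry D) 4 (timeProb T P) ^ 4 ≤ ENNReal.ofReal (2 * strichartzConst * ε) *
      (eLpNorm u₀ 4 P ^ 4 + ∫⁻ ω, eLpNorm (fun s => F s ω) (4 / 3)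
        (timeMeasure.restrict (Icc 0 T)) ^ 4 ∂P) := by
  have h := eLpNorm_le_of_tendsto (by norm_num)
    (fun n => (stronglyMeasurable_approx hB hu₀ hu₀' hF n).aestronglyMeasurable)
    hD.stronglyMeasurable.aestronglyMeasurable hD.tendsto
    (fun n => le_rpow_of_pow_four_le (eLpNorm_approx_pow_le hB hu₀ hu₀' hF hε hε1 hT hK n))
  refine (pow_le_pow_left' h 4).trans_eq ?_
  rw [← ENNReal.rpow_natCast, ← ENNReal.rpow_mul]
  norm_num

/-- The data cancel: the difference of the approximations is the approximation with zero datum and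
forcing `F - G`. -/
lemma eLpNorm_sub_pow_le [IsProbabilityMeasure P] (hD : IsLinearSolution 𝓕 P T B u₀ F D)
    (hE : IsLinearSolution 𝓕 P T B u₀ G E) (hB : IsDriver 𝓕 B P)
    (hu₀ : StronglyMeasurable[𝓕 0] u₀) (hu₀' : MemLp u₀ 4 P) (hF : IsForcing 𝓕 T F)
    (hG : IsForcing 𝓕 T G)
    (hε : 0 ≤ ε) (hε1 : ε ≤ 1) (hT : (T : ℝ) ≤ ε ^ 4) (hK : strichartzConst * ε ≤ 1 / 2) :
    eLpNorm (Function.uncurry D - Function.uncurry E) 4 (timeProb T P) ^ 4 ≤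
      ENNReal.ofReal (2 * strichartzConst * ε) * ∫⁻ ω, eLpNorm (fun s => F s ω - G s ω) (4 / 3)
        (timeMeasure.restrict (Icc 0 T)) ^ 4 ∂P := by
  have hFm := fun n => stronglyMeasurable_approx hB hu₀ hu₀' hF n
  have hGm := fun n => stronglyMeasurable_approx hB hu₀ hu₀' hG n
  have hDm := hD.stronglyMeasurable
  have hEm := hE.stronglyMeasurable
  have hlin : ∀ n, approx B u₀ F n - approx B u₀ G n =
      approx B (fun _ => 0) (fun s ω => F s ω - G s ω) n := by
    intro n
    funext z
    simp only [Pi.sub_apply, approx, galerkin]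
    rw [trig_sub]
    congr 1
    funext k
    rw [amplitude, amplitude, amplitude, ← mul_sub]
    congr 1
    have iF := integrableOn_propagator_mul hB.predictable
      (isLinearData hB hu₀ hu₀' hF (Finset.disjoint_empty_right ∅)).f_int k z.1 z.2
    have iG := integrableOn_propagator_mul hB.predictable
      (isLinearData hB hu₀ hu₀' hG (Finset.disjoint_empty_right ∅)).f_int k z.1 z.2
    rw [profile, profile, profile, add_sub_add_left_eq_sub, ← integral_sub iF iG]
    simp only [dataCoeff, map_zero, zero_add, forceCoeff, map_sub, mul_sub]
  have hz : MemLp (fun _ : Ω => (0 : LTorus 2)) 4 P := MemLp.zero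
  have hbound : ∀ n, eLpNorm (approx B u₀ F n - approx B u₀ G n) 4 (timeProb T P) ≤
      (ENNReal.ofReal (2 * strichartzConst * ε) * ∫⁻ ω, eLpNorm (fun s => F s ω - G s ω) (4 / 3)
        (timeMeasure.restrict (Icc 0 T)) ^ 4 ∂P) ^ (1 / 4 : ℝ) := by
    intro n
    rw [hlin n]
    refine le_rpow_of_pow_four_le ((eLpNorm_approx_pow_le hB stronglyMeasurable_const hz
      (hF.sub hG) hε hε1 hT hK n).trans_eq ?_)
    have : eLpNorm (fun _ : Ω => (0 : LTorus 2)) 4 P = 0 := by simp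
    rw [this]
    simp
  have htend : Tendsto (fun n => eLpNorm ((approx B u₀ F n - approx B u₀ G n) -
      (Function.uncurry D - Function.uncurry E)) 4 (timeProb T P)) atTop (𝓝 0) := by
    have h := hD.tendsto.add hE.tendsto
    rw [add_zero] at h
    refine tendsto_of_tendsto_of_tendsto_of_le_of_le tendsto_const_nhds h (fun _ => zero_le)
      fun n => ?_
    beta_reduce
    rw [sub_sub_sub_comm]
    exact eLpNorm_sub_le ((hFm n).sub hDm).aestronglyMeasurable
      ((hGm n).sub hEm).aestronglyMeasurable (by norm_num)
  have h := eLpNorm_le_of_tendsto (by norm_num)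
    (fun n => ((hFm n).sub (hGm n)).aestronglyMeasurable) (hDm.sub hEm).aestronglyMeasurable
    htend hbound
  refine (pow_le_pow_left' h 4).trans_eq ?_
  rw [← ENNReal.rpow_natCast, ← ENNReal.rpow_mul]
  norm_num

end IsLinearSolution

end LinearSolution

end WND
end

/-! ### The contraction: existence and uniqueness. -/

noncomputable section
namespace WND

open ComplexConjugate Set Filter Topology AddCircle

section Force

variable {Ω : Type*} {mΩ : MeasurableSpace Ω} {𝓕 : Filtration ℝ≥0 mΩ} {P : Measure Ω}
  {T : ℝ≥0} {B W : ℝ≥0 → Ω → ℝ} {u₀ : Ω → LTorus 2} {p : ℝ} {θ : ℝ → ℝ} {L : ℝ≥0}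
  {u v : ℝ≥0 → Ω → LTorus 4}

/-- The truncated nonlinearity as an `L^{4/3}`-valued process. -/
def force (hp : p ∈ Ioc 1 3) (θ : ℝ → ℝ) (u : ℝ≥0 → Ω → LTorus 4) (s : ℝ≥0) (ω : Ω) :
    LTorus (4 / 3) :=
  pathForce hp θ (fun t => u t ω) s

lemma stronglyMeasurable_path (hu : IsStronglyPredictable 𝓕 u) (ω : Ω) :
    StronglyMeasurable fun t => u t ω :=
  (StronglyMeasurable.mono hu (predictable_le_prod 𝓕)).comp_measurable
    (measurable_prodMk_right (y := ω))

/-- A bound for the truncated nonlinearity in `L^{4/3}([0, T] × 𝕋)`, for `T ≤ 1`. -/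
lemma eLpNorm_force_le (hp : p ∈ Ioc 1 3) (hθ : IsCutoff θ) (hL : LipschitzWith L θ)
    (hu : IsStronglyPredictable 𝓕 u) (hT : T ≤ 1) (ω : Ω) :
    eLpNorm (fun s => force hp θ u s ω) (4 / 3) (timeMeasure.restrict (Icc 0 T)) ≤
      ENNReal.ofReal (180 * L) := by
  refine (eLpNorm_pathForce_le hp hθ hL (stronglyMeasurable_path hu ω)
    Measure.restrict_le_self).trans ?_
  have hone : eLpNorm (fun _ => (1 : ℝ)) 2 (timeMeasure.restrict (Icc 0 T)) ≤ 1 := by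
    refine (eLpNorm_le_of_ae_bound (C := 1) (ae_of_all _ fun _ => by simp)).trans ?_
    rw [ENNReal.ofReal_one, mul_one, Measure.restrict_apply_univ, timeMeasure_Icc_zero]
    exact ENNReal.rpow_le_one (by exact_mod_cast hT) (by positivity)
  calc _ ≤ ENNReal.ofReal (18 * L) * (2 * (1 + 2 ^ 2)) := by gcongr
    _ = ENNReal.ofReal (18 * L) * ENNReal.ofReal 10 := by rw [ENNReal.ofReal_ofNat]; norm_num
    _ = _ := by
      rw [← ENNReal.ofReal_mul (by positivity)]
      congr 1
      ring

lemma isForcing_force (hp : p ∈ Ioc 1 3) (hθ : IsCutoff θ) (hL : LipschitzWith L θ)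
    (hu : IsStronglyPredictable 𝓕 u) (hT : T ≤ 1) : IsForcing 𝓕 T (force hp θ u) where
  predictable := by
    have h1 := measurable_runningNorm hu
    unfold IsStronglyPredictable at hu ⊢
    generalize 𝓕.predictable = m at h1 hu ⊢
    have h2 : Measurable[m] fun z : ℝ≥0 × Ω => (cut θ (runningNorm u z.1 z.2) : ℂ) :=
      Complex.measurable_ofReal.comp (hL.continuous.measurable.comp
        ((h1.min measurable_const).ennreal_toReal))
    exact h2.stronglyMeasurable.smul ((continuous_powerLp hp).comp_stronglyMeasurable hu)
  integrable t ω := by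
    have hx := stronglyMeasurable_path hu ω
    have h : MemLp (fun s => force hp θ u s ω) (4 / 3) (timeMeasure.restrict (Icc 0 t)) := by
      refine ⟨(stronglyMeasurable_pathForce hp hL hx).aestronglyMeasurable,
        (eLpNorm_pathForce_le hp hθ hL hx Measure.restrict_le_self).trans_lt ?_⟩
      refine ENNReal.mul_lt_top ENNReal.ofReal_lt_top (ENNReal.mul_lt_top (by norm_num)
        (ENNReal.add_lt_top.2 ⟨?_, by norm_num⟩))
      exact (memLp_const (1 : ℝ)).2
    exact h.integrable instFactFourThirds.out
  bound := ⟨_, eLpNorm_force_le hp hθ hL hu hT⟩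

lemma lintegral_eLpNorm_four_pow [SFinite P] {E : Type*} [NormedAddCommGroup E]
    {g : ℝ≥0 → Ω → E} (hg : StronglyMeasurable (Function.uncurry g)) :
    ∫⁻ ω, eLpNorm (fun s => g s ω) 4 (timeMeasure.restrict (Icc 0 T)) ^ 4 ∂P =
      eLpNorm (Function.uncurry g) 4 (timeProb T P) ^ 4 := by
  simp only [eLpNorm_four_pow]
  rw [timeProb, lintegral_prod_symm' _ (hg.enorm.pow_const 4)]
  rfl

/-- The linear estimate for the difference is composed with the pathwise Lipschitz bound of the
forcing; `hc` says that the fourth power of the resulting factor is at most `(1/2)⁴`. -/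
lemma IsLinearSolution.eLpNorm_sub_le_half [IsProbabilityMeasure P] {D E : ℝ≥0 → Ω → LTorus 4}
    (hp : p ∈ Ioc 1 3) (hθ : IsCutoff θ) (hL : LipschitzWith L θ)
    (hu : IsStronglyPredictable 𝓕 u) (hv : IsStronglyPredictable 𝓕 v)
    (hD : IsLinearSolution 𝓕 P T B u₀ (force hp θ u) D)
    (hE : IsLinearSolution 𝓕 P T B u₀ (force hp θ v) E) (hB : IsDriver 𝓕 B P)
    (hu₀ : StronglyMeasurable[𝓕 0] u₀) (hu₀' : MemLp u₀ 4 P) {ε : ℝ}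
    (hε : 0 ≤ ε) (hε1 : ε ≤ 1) (hT : (T : ℝ) ≤ ε ^ 4) (hK : strichartzConst * ε ≤ 1 / 2)
    (hc : 2 * strichartzConst * ε * (342 * L) ^ 4 ≤ (1 / 2) ^ 4) :
    eLpNorm (Function.uncurry D - Function.uncurry E) 4 (timeProb T P) ≤
      (1 / 2 : ℝ≥0) * eLpNorm (Function.uncurry u - Function.uncurry v) 4 (timeProb T P) := by
  have hT1 : T ≤ 1 := by
    have : (T : ℝ) ≤ 1 := hT.trans (pow_le_one₀ hε hε1)
    exact_mod_cast this
  refine (ENNReal.pow_right_strictMono (n := 4) (by norm_num)).le_iff_le.1 ?_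
  refine (hD.eLpNorm_sub_pow_le hE hB hu₀ hu₀' (isForcing_force hp hθ hL hu hT1)
    (isForcing_force hp hθ hL hv hT1) hε hε1 hT hK).trans ?_
  have hu' := StronglyMeasurable.mono hu (predictable_le_prod 𝓕)
  have hv' := StronglyMeasurable.mono hv (predictable_le_prod 𝓕)
  have h1 : ∫⁻ ω, eLpNorm (fun s => force hp θ u s ω - force hp θ v s ω) (4 / 3)
      (timeMeasure.restrict (Icc 0 T)) ^ 4 ∂P ≤ ENNReal.ofReal (342 * L) ^ 4 *
        eLpNorm (Function.uncurry u - Function.uncurry v) 4 (timeProb T P) ^ 4 := by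
    have e := lintegral_eLpNorm_four_pow (P := P) (T := T) (g := fun s ω => u s ω - v s ω)
      (hu'.sub hv')
    have e' : (Function.uncurry fun s ω => u s ω - v s ω) =
      Function.uncurry u - Function.uncurry v := rfl
    rw [← e', ← e, ← lintegral_const_mul']
    · refine lintegral_mono fun ω => ?_
      rw [← mul_pow]
      exact pow_le_pow_left' (eLpNorm_pathForce_sub_le hp hθ hL (stronglyMeasurable_path hu ω)
        (stronglyMeasurable_path hv ω) hT1) 4
    · exact ENNReal.pow_ne_top ENNReal.ofReal_ne_top
  have hK0 := strichartzConst_pos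
  calc _ ≤ ENNReal.ofReal (2 * strichartzConst * ε) * (ENNReal.ofReal (342 * L) ^ 4 *
        eLpNorm (Function.uncurry u - Function.uncurry v) 4 (timeProb T P) ^ 4) := by gcongr
    _ = ENNReal.ofReal (2 * strichartzConst * ε * (342 * L) ^ 4) *
        eLpNorm (Function.uncurry u - Function.uncurry v) 4 (timeProb T P) ^ 4 := by
      rw [ENNReal.ofReal_mul (p := 2 * strichartzConst * ε) (by positivity),
        ENNReal.ofReal_pow (by positivity)]
      ring
    _ ≤ ENNReal.ofReal ((1 / 2) ^ 4) *
        eLpNorm (Function.uncurry u - Function.uncurry v) 4 (timeProb T P) ^ 4 := by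
      gcongr
    _ = _ := by
      rw [mul_pow, ENNReal.ofReal_pow (by norm_num)]
      congr 2
      rw [← ENNReal.ofReal_coe_nnreal]
      norm_num

/-- There is a process that solves the linear problem forced by its own truncated nonlinearity. -/
theorem exists_isLinearSolution_force [IsProbabilityMeasure P]
    (hp : p ∈ Ioc 1 3) (hθ : IsCutoff θ) (hL : LipschitzWith L θ) (hB : IsDriver 𝓕 B P)
    (hu₀ : StronglyMeasurable[𝓕 0] u₀) (hu₀' : MemLp u₀ 4 P) {ε : ℝ}
    (hε : 0 ≤ ε) (hε1 : ε ≤ 1) (hT : (T : ℝ) ≤ ε ^ 4) (hK : strichartzConst * ε ≤ 1 / 2)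
    (hc : 2 * strichartzConst * ε * (342 * L) ^ 4 ≤ (1 / 2) ^ 4) :
    ∃ u, IsLinearSolution 𝓕 P T B u₀ (force hp θ u) u := by
  have hT1 : T ≤ 1 := by
    have : (T : ℝ) ≤ 1 := hT.trans (pow_le_one₀ hε hε1)
    exact_mod_cast this
  -- The solution map gets an arbitrary value at arguments that are not predictable, so that it can
  -- be chosen as a total function.
  have hex : ∀ u : ℝ≥0 × Ω → LTorus 4, ∃ D : ℝ≥0 → Ω → LTorus 4,
      StronglyMeasurable[𝓕.predictable] u →
        IsLinearSolution 𝓕 P T B u₀ (force hp θ (Function.curry u)) D := by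
    intro u
    by_cases hu : StronglyMeasurable[𝓕.predictable] u
    · obtain ⟨D, hD⟩ := exists_isLinearSolution hB hu₀ hu₀'
        (isForcing_force hp hθ hL (u := Function.curry u) hu hT1) hε hε1 hT hK
      exact ⟨D, fun _ => hD⟩
    · exact ⟨fun _ _ => 0, fun h => absurd h hu⟩
  choose Φ hΦ using hex
  obtain ⟨u, hu, -, hfix⟩ := exists_stronglyMeasurable_fixedPoint (predictable_le_prod 𝓕)
    (μ := timeProb T P) (q := 4) (fun u => Function.uncurry (Φ u))
    (fun u hu _ => ⟨(hΦ u hu).predictable, (hΦ u hu).memLp⟩)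
    (fun u v hu _ hv _ => (hΦ u hu).eLpNorm_sub_le_half hp hθ hL (u := Function.curry u)
      (v := Function.curry v) hu hv (hΦ v hv) hB hu₀ hu₀' hε hε1 hT hK hc)
  -- The fixed point identity holds almost everywhere only. The solution is replaced by `u` while
  -- the forcing, already built from `u`, stays the same.
  exact ⟨Function.curry u, (hΦ u hu).congr hu hfix.symm⟩

/-- Almost surely, the path has finite `L⁴` norm. -/
lemma ae_eLpNorm_path_lt_top [IsProbabilityMeasure P] (hu : IsStronglyPredictable 𝓕 u)
    (hu4 : MemLp (Function.uncurry u) 4 (timeProb T P)) :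
    ∀ᵐ ω ∂P, eLpNorm (fun t => u t ω) 4 (timeMeasure.restrict (Icc 0 T)) < ∞ := by
  have hu' := StronglyMeasurable.mono hu (predictable_le_prod 𝓕)
  have h := lintegral_eLpNorm_four_pow (P := P) (T := T) hu'
  have hm : Measurable fun ω => eLpNorm (fun t => u t ω) 4 (timeMeasure.restrict (Icc 0 T)) ^ 4 :=
    (measurable_eLpNorm_slice hu' (by norm_num) (by norm_num) _).pow_const 4
  have h2 := ae_lt_top hm (by rw [h]; exact ENNReal.pow_ne_top hu4.2.ne)
  filter_upwards [h2] with ω hω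
  exact (ENNReal.pow_lt_top_iff.1 hω).resolve_right (by norm_num)

/-- Finiteness of the path norm is what identifies the truncation through `toReal` with `cut`. -/
lemma fourierCoeff_nonlinearity (hp : p ∈ Ioc 1 3) (hθ : IsCutoff θ) {s t : ℝ≥0} {ω : Ω}
    (hst : s ≤ t) (hfin : eLpNorm (fun t => u t ω) 4 (timeMeasure.restrict (Icc 0 t)) < ∞) (k : ℤ) :
    fourierCoeff (nonlinearity p θ u s ω) k = coeff (4 / 3) k (force hp θ u s ω) := by
  have h1 : runningNorm u s ω ≠ ∞ := by
    refine ne_of_lt (lt_of_le_of_lt ?_ hfin)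
    exact eLpNorm_mono_measure _ (Measure.restrict_mono
      (fun r (hr : r < s) => (⟨zero_le, hr.le.trans hst⟩ : r ∈ Icc 0 t)) le_rfl)
  rw [coeff_apply]
  refine fourierCoeff_congr ?_ k
  filter_upwards [Lp.coeFn_smul (cut θ (runningNorm u s ω) : ℂ) (powerLp hp (u s ω)),
    coeFn_powerLp hp (u s ω)] with x hx1 hx2
  refine Eq.trans ?_ hx1.symm
  rw [Pi.smul_apply, hx2, cut_eq hθ h1, nonlinearity, truncation, power, smul_eq_mul, mul_assoc]

lemma duhamel_eq_amplitude (hp : p ∈ Ioc 1 3) (hθ : IsCutoff θ) {t : ℝ≥0} {ω : Ω}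
    (hBW : ∀ t, B t ω = W t ω)
    (hfin : eLpNorm (fun t => u t ω) 4 (timeMeasure.restrict (Icc 0 t)) < ∞) (k : ℤ) :
    propagatorSymbol (W t ω) k * fourierCoeff (u₀ ω : Torus → ℂ) k
        - Complex.I * ∫ s in Set.Icc (0 : ℝ≥0) t, propagatorSymbol (W t ω - W s ω) k *
              fourierCoeff (nonlinearity p θ u s ω) k ∂timeMeasure =
      amplitude B (dataCoeff u₀) (forceCoeff (force hp θ u)) k t ω := by
  rw [amplitude, profile, mul_add, hBW t, sub_eq_add_neg, ← neg_mul, ← integral_const_mul,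
    ← integral_const_mul]
  congr 1
  refine setIntegral_congr_fun measurableSet_Icc fun s hs => ?_
  rw [fourierCoeff_nonlinearity hp hθ hs.2 hfin, sub_eq_add_neg, propagatorSymbol_add, hBW s,
    forceCoeff]
  ring

lemma ae_duhamel_eq_amplitude [IsProbabilityMeasure P] (hp : p ∈ Ioc 1 3) (hθ : IsCutoff θ)
    (hBW : ∀ᵐ ω ∂P, ∀ t, B t ω = W t ω) (hu : IsStronglyPredictable 𝓕 u)
    (hu4 : MemLp (Function.uncurry u) 4 (timeProb T P)) :
    ∀ᵐ z : ℝ≥0 × Ω ∂(timeProb T P), ∀ k : ℤ,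
      propagatorSymbol (W z.1 z.2) k * fourierCoeff (u₀ z.2 : Torus → ℂ) k
        - Complex.I * ∫ s in Set.Icc (0 : ℝ≥0) z.1, propagatorSymbol (W z.1 z.2 - W s z.2) k *
              fourierCoeff (nonlinearity p θ u s z.2) k ∂timeMeasure =
      amplitude B (dataCoeff u₀) (forceCoeff (force hp θ u)) k z.1 z.2 := by
  have h := Measure.quasiMeasurePreserving_snd (μ := timeMeasure.restrict (Icc 0 T)) (ν := P)
  filter_upwards [h.ae (hBW.and (ae_eLpNorm_path_lt_top hu hu4)), ae_timeProb_fst_le T P]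
    with z hz hzT k
  refine duhamel_eq_amplitude hp hθ hz.1 (lt_of_le_of_lt ?_ hz.2) k
  exact eLpNorm_mono_measure _ (Measure.restrict_mono (Icc_subset_Icc_right hzT) le_rfl)

lemma IsLinearSolution.isTruncSolution [IsProbabilityMeasure P] (hp : p ∈ Ioc 1 3)
    (hθ : IsCutoff θ) (hL : LipschitzWith L θ) (hT : T ≤ 1)
    (hB : IsDriver 𝓕 B P) (hBW : ∀ᵐ ω ∂P, ∀ t, B t ω = W t ω)
    (hu₀ : StronglyMeasurable[𝓕 0] u₀) (hu₀' : MemLp u₀ 4 P)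
    (hu : IsLinearSolution 𝓕 P T B u₀ (force hp θ u) u) :
    IsTruncSolution 𝓕 P W p θ u₀ T u where
  predictable := hu.predictable
  memLp := hu.memLp
  duhamel := by
    filter_upwards [hu.coeff_eq hB hu₀ hu₀' (isForcing_force hp hθ hL hu.predictable hT),
      ae_duhamel_eq_amplitude (u₀ := u₀) hp hθ hBW hu.predictable hu.memLp] with z h1 h2 k
    rw [h2 k, ← h1 k]
    rfl

/-- With the forcing of `v` frozen, the linear solution has the Fourier coefficients of `v`, so `v`
is a Galerkin limit. The contraction estimate then compares it with `u`, and a finite distance that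
is at most half of itself vanishes. -/
lemma IsLinearSolution.eq_of_isTruncSolution [IsProbabilityMeasure P] (hp : p ∈ Ioc 1 3)
    (hθ : IsCutoff θ) (hL : LipschitzWith L θ) (hB : IsDriver 𝓕 B P)
    (hBW : ∀ᵐ ω ∂P, ∀ t, B t ω = W t ω)
    (hu₀ : StronglyMeasurable[𝓕 0] u₀) (hu₀' : MemLp u₀ 4 P)
    {ε : ℝ} (hε : 0 ≤ ε) (hε1 : ε ≤ 1) (hT : (T : ℝ) ≤ ε ^ 4) (hK : strichartzConst * ε ≤ 1 / 2)
    (hc : 2 * strichartzConst * ε * (342 * L) ^ 4 ≤ (1 / 2) ^ 4)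
    (hu : IsLinearSolution 𝓕 P T B u₀ (force hp θ u) u)
    (hv : IsTruncSolution 𝓕 P W p θ u₀ T v) :
    Function.uncurry v =ᵐ[timeProb T P] Function.uncurry u := by
  have hT1 : T ≤ 1 := by
    have : (T : ℝ) ≤ 1 := hT.trans (pow_le_one₀ hε hε1)
    exact_mod_cast this
  have hFv := isForcing_force hp hθ hL hv.predictable hT1
  obtain ⟨D, hD⟩ := exists_isLinearSolution hB hu₀ hu₀' hFv hε hε1 hT hK
  have hvD : Function.uncurry v =ᵐ[timeProb T P] Function.uncurry D := by
    refine hD.eq_of_coeff_eq hB hu₀ hu₀' hFv ?_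
    filter_upwards [hv.duhamel, ae_duhamel_eq_amplitude (u₀ := u₀) hp hθ hBW hv.predictable
      hv.memLp] with z h1 h2 k
    rw [← h2 k, ← h1 k]
    rfl
  have hv' := hD.congr hv.predictable hvD
  have h := hv'.eLpNorm_sub_le_half hp hθ hL hv.predictable hu.predictable hu hB hu₀ hu₀' hε hε1
    hT hK hc
  have hfin : eLpNorm (Function.uncurry v - Function.uncurry u) 4 (timeProb T P) ≠ ∞ :=
    (hv.memLp.sub hu.memLp).2.ne
  have h0 : eLpNorm (Function.uncurry v - Function.uncurry u) 4 (timeProb T P) = 0 := by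
    generalize eLpNorm (Function.uncurry v - Function.uncurry u) 4 (timeProb T P) = x at h hfin ⊢
    lift x to ℝ≥0 using hfin
    rw [← ENNReal.coe_mul, ENNReal.coe_le_coe, ← NNReal.coe_le_coe] at h
    push_cast at h
    rw [ENNReal.coe_eq_zero, ← NNReal.coe_eq_zero]
    linarith [x.2, NNReal.coe_nonneg x]
  have h1 := (eLpNorm_eq_zero_iff (hv.memLp.sub hu.memLp).1 (by norm_num)).1 h0
  filter_upwards [h1] with z hz
  exact sub_eq_zero.1 hz

end Force

end WND
end

/-! ### Continuity in `L²`, conservation of mass, and the hitting time. -/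

noncomputable section
namespace WND

open ComplexConjugate Set Filter Topology AddCircle

section Conservation

variable {Ω : Type*} {mΩ : MeasurableSpace Ω} {𝓕 : Filtration ℝ≥0 mΩ} {P : Measure Ω}
  {T : ℝ≥0} {B : ℝ≥0 → Ω → ℝ} {u₀ : Ω → LTorus 2} {p : ℝ} {θ : ℝ → ℝ} {L : ℝ≥0}
  {u : ℝ≥0 → Ω → LTorus 4}

/-- A sequence whose `L⁴` norms tend to zero has a subsequence along which almost every path
tends to zero in `L⁴`. -/
lemma exists_subseq_path_tendsto [SFinite P] {g : ℕ → ℝ≥0 → Ω → LTorus 4}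
    (hg : ∀ n, StronglyMeasurable (Function.uncurry (g n)))
    (h : Tendsto (fun n => eLpNorm (Function.uncurry (g n)) 4 (timeProb T P)) atTop (𝓝 0)) :
    ∃ ns : ℕ → ℕ, StrictMono ns ∧ ∀ᵐ ω ∂P, Tendsto (fun j =>
      eLpNorm (fun t => g (ns j) t ω) 4 (timeMeasure.restrict (Icc 0 T))) atTop (𝓝 0) := by
  set e : ℕ → Ω → ℝ≥0∞ := fun n ω =>
    eLpNorm (fun t => g n t ω) 4 (timeMeasure.restrict (Icc 0 T)) ^ 4 with he
  have hem : ∀ n, Measurable (e n) := fun n =>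
    (measurable_eLpNorm_slice (hg n) (by norm_num) (by norm_num) _).pow_const 4
  have h1 : Tendsto (fun n => ∫⁻ ω, e n ω ∂P) atTop (𝓝 0) := by
    simp only [he, lintegral_eLpNorm_four_pow (hg _)]
    have := (ENNReal.continuous_pow 4).tendsto 0 |>.comp h
    simpa [Function.comp_def] using this
  -- Along this subsequence the fourth moments are summable, so almost surely the series of fourth
  -- powers converges and its terms tend to zero.
  obtain ⟨ns, hns, hle⟩ := extraction_forall_of_eventually fun j =>
    h1.eventually (ge_mem_nhds (show (0 : ℝ≥0∞) < 2⁻¹ ^ j by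
      exact ENNReal.pow_pos (by simp) j))
  refine ⟨ns, hns, ?_⟩
  have h2 : ∫⁻ ω, ∑' j, e (ns j) ω ∂P ≠ ∞ := by
    rw [lintegral_tsum fun j => (hem (ns j)).aemeasurable]
    refine ne_top_of_le_ne_top ?_ (ENNReal.tsum_le_tsum hle)
    rw [ENNReal.tsum_geometric]
    simp
  have h3 := ae_lt_top (Measurable.tsum fun j => hem (ns j)) h2
  filter_upwards [h3] with ω hω
  have h4 := ENNReal.tendsto_atTop_zero_of_tsum_ne_top hω.ne
  have h5 := h4.ennrpow_const (1 / 4)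
  rw [ENNReal.zero_rpow_of_pos (by norm_num)] at h5
  refine h5.congr fun j => ?_
  simp only [he]
  rw [← ENNReal.rpow_natCast, ← ENNReal.rpow_mul]
  norm_num

/-- The nonlinearity does not change the mass. -/
lemma re_force_mul_conj (hp : p ∈ Ioc 1 3) (s : ℝ≥0) (ω : Ω) :
    (-Complex.I * ∫ x : Torus, force hp θ u s ω x * conj (u s ω x) ∂haarAddCircle).re = 0 := by
  have h : ∫ x : Torus, force hp θ u s ω x * conj (u s ω x) ∂haarAddCircle =
      ((∫ x : Torus, cut θ (runningNorm u s ω) * (‖u s ω x‖ ^ (p - 1) * ‖u s ω x‖ ^ 2)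
        ∂haarAddCircle : ℝ) : ℂ) := by
    rw [← integral_complex_ofReal]
    refine integral_congr_ae ?_
    filter_upwards [haarAddCircle_absolutelyContinuous.ae_eq
      (Lp.coeFn_smul (cut θ (runningNorm u s ω) : ℂ) (powerLp hp (u s ω))),
      haarAddCircle_absolutelyContinuous.ae_eq (coeFn_powerLp hp (u s ω))] with x hx1 hx2
    have e : force hp θ u s ω x = _ := hx1
    rw [e, Pi.smul_apply, hx2, power, smul_eq_mul]
    push_cast
    rw [← Complex.mul_conj']
    ring
  rw [h]
  simp

/-- The rate of change of the mass of a Galerkin approximation. -/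
lemma abs_re_sum_le (hp : p ∈ Ioc 1 3) (n : ℕ) (s : ℝ≥0) (ω : Ω) :
    |(∑ k ∈ window n, forceCoeff (force hp θ u) k s ω *
      conj (amplitude B (dataCoeff u₀) (forceCoeff (force hp θ u)) k s ω)).re| ≤
      ‖force hp θ u s ω‖ * ‖approx B u₀ (force hp θ u) n (s, ω) - u s ω‖ := by
  set F := force hp θ u s ω with hF
  set g := approx B u₀ (force hp θ u) n (s, ω) with hg
  have h1 : ∑ k ∈ window n, forceCoeff (force hp θ u) k s ω *
      conj (amplitude B (dataCoeff u₀) (forceCoeff (force hp θ u)) k s ω) =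
      -Complex.I * ∫ x : Torus, F x * conj (g x) ∂haarAddCircle := by
    simp only [forceCoeff, mul_assoc]
    rw [← Finset.mul_sum, sum_coeff_mul_conj]
    rfl
  have h2 : ∫ x : Torus, F x * conj ((g - u s ω : LTorus 4) x) ∂haarAddCircle =
      (∫ x : Torus, F x * conj (g x) ∂haarAddCircle) -
        ∫ x : Torus, F x * conj (u s ω x) ∂haarAddCircle := by
    rw [← integral_sub (integrable_mul_conj F g) (integrable_mul_conj F (u s ω))]
    refine integral_congr_ae ?_
    filter_upwards [haarAddCircle_absolutelyContinuous.ae_eq (Lp.coeFn_sub g (u s ω))] with x hx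
    rw [hx, Pi.sub_apply, map_sub, mul_sub]
  have h3 := re_force_mul_conj (θ := θ) (u := u) hp s ω
  -- Subtracting `u` from the test function is free, since `u` itself contributes nothing to the
  -- real part.
  have h4 : (-Complex.I * ∫ x : Torus, F x * conj (g x) ∂haarAddCircle).re =
      (-Complex.I * ∫ x : Torus, F x * conj ((g - u s ω : LTorus 4) x) ∂haarAddCircle).re := by
    rw [h2, mul_sub, Complex.sub_re, h3, sub_zero]
  rw [h1, h4]
  refine (Complex.abs_re_le_norm _).trans ?_
  rw [norm_mul, norm_neg, Complex.norm_I, one_mul]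
  exact norm_integral_mul_conj_le F _

/-- Along a path on which the Galerkin approximations converge, the solution has a continuous
version in `L²` with conserved mass. -/
lemma isContinuousConservative_of_tendsto [IsFiniteMeasure P] (hp : p ∈ Ioc 1 3)
    (hB : IsDriver 𝓕 B P) (hu₀ : StronglyMeasurable[𝓕 0] u₀) (hu₀' : MemLp u₀ 4 P)
    (hF : IsForcing 𝓕 T (force hp θ u)) (hu : IsStronglyPredictable 𝓕 u)
    {ω : Ω} (hcont : Continuous fun t => B t ω) {ns : ℕ → ℕ} (hns : StrictMono ns)
    (hlim : Tendsto (fun j => eLpNorm (fun t => approx B u₀ (force hp θ u) (ns j) (t, ω) - u t ω) 4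
      (timeMeasure.restrict (Icc 0 T))) atTop (𝓝 0))
    (hcoeff : ∀ᵐ t ∂(timeMeasure.restrict (Icc 0 T)), ∀ k : ℤ, coeff 4 k (u t ω) =
      amplitude B (dataCoeff u₀) (forceCoeff (force hp θ u)) k t ω) :
    IsContinuousConservative T (u₀ ω) (fun t => u t ω) := by
  set μ := timeMeasure.restrict (Icc 0 T) with hμ
  set a := dataCoeff u₀ with ha
  set f := forceCoeff (force hp θ u) with hf
  set e : ℕ → ℝ≥0∞ := fun j => eLpNorm (fun t => approx B u₀ (force hp θ u) (ns j) (t, ω) - u t ω)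
    4 μ with he
  set G : ℕ → ℝ≥0 → LTorus 2 := fun j t => trig 2 (window (ns j)) fun k => amplitude B a f k t ω
    with hG
  have hfint := (isLinearData hB hu₀ hu₀' hF (Finset.disjoint_empty_right ∅)).f_int
  have hup := stronglyMeasurable_path hu ω
  have hap : ∀ n, StronglyMeasurable fun t => approx B u₀ (force hp θ u) n (t, ω) := fun n =>
    (stronglyMeasurable_approx hB hu₀ hu₀' hF n).comp_measurable measurable_prodMk_right
  -- tails
  set β : ℕ → ℝ := fun i => 2 * Real.pi * (dataTail u₀ (ns i) ω +
    2 * ((forceTail T (force hp θ u) (ns i) ω).toReal * 2)) with hβ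
  have hβlim : Tendsto β atTop (𝓝 0) := by
    have h1 := (tendsto_dataTail u₀ ω).comp hns.tendsto_atTop
    have h2 := (hF.tendsto_forceTail ω).comp hns.tendsto_atTop
    have h3 := (ENNReal.tendsto_toReal ENNReal.zero_ne_top).comp h2
    have h4 := (h1.add ((h3.mul_const 2).const_mul 2)).const_mul (2 * Real.pi)
    simpa [Function.comp_def] using h4
  obtain ⟨i₀, hi₀⟩ := eventually_atTop.1 (hlim.eventually (ge_mem_nhds (zero_lt_one (α := ℝ≥0∞))))
  -- This is the energy inequality on the block between two windows. The tail of the forcing is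
  -- multiplied by the `L⁴` norm of the block, which is at most two once both approximations are
  -- within one of `u`.
  have htail : ∀ i j, i₀ ≤ i → i ≤ j → ∀ t ∈ Icc 0 T, ‖G j t - G i t‖ ^ 2 ≤ β i := by
    intro i j hi hij t ht
    have hsub := window_mono (hns.monotone hij)
    have H := isLinearData hB hu₀ hu₀' hF
      (Finset.sdiff_disjoint (t := window (ns j)) (s := window (ns i)))
    have h1 := H.sum_sq_amplitude_le ht.2 ω
    simp only [hG]
    rw [trig_sub_trig hsub, norm_trig_two_sq, hβ]
    refine mul_le_mul_of_nonneg_left (h1.trans ?_) Real.two_pi_pos.le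
    refine add_le_add ?_ (mul_le_mul_of_nonneg_left ?_ zero_le_two)
    · rw [dataNorm_sq]
      exact sum_sq_dataCoeff_le_dataTail u₀ Finset.sdiff_disjoint ω
    · refine mul_le_mul_of_nonneg_left ?_ ENNReal.toReal_nonneg
      refine ENNReal.toReal_le_of_le_ofReal zero_le_two ?_
      have e1 : (fun t => galerkin B (window (ns j) \ window (ns i)) a f t ω) =
          (fun t => approx B u₀ (force hp θ u) (ns j) (t, ω) - u t ω) -
          fun t => approx B u₀ (force hp θ u) (ns i) (t, ω) - u t ω := by
        funext s
        rw [Pi.sub_apply, sub_sub_sub_cancel_right]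
        exact (trig_sub_trig hsub _).symm
      rw [e1]
      refine (eLpNorm_sub_le ((hap _).sub hup).aestronglyMeasurable
        ((hap _).sub hup).aestronglyMeasurable (by norm_num)).trans ?_
      refine (add_le_add (hi₀ j (hi.trans hij)) (hi₀ i hi)).trans ?_
      rw [ENNReal.ofReal_ofNat]
      norm_num
  -- the continuous limit
  have hcauchy : UniformCauchySeqOn G atTop (Icc 0 T) := by
    rw [Metric.uniformCauchySeqOn_iff]
    intro ε hε
    obtain ⟨N, hN1, hN2⟩ := ((eventually_ge_atTop i₀).and
      (hβlim.eventually (gt_mem_nhds (show (0 : ℝ) < (ε / 2) ^ 2 by positivity)))).exists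
    have key : ∀ n ≥ N, ∀ t ∈ Icc 0 T, dist (G n t) (G N t) < ε / 2 := by
      intro n hn t ht
      rw [dist_eq_norm]
      exact lt_of_pow_lt_pow_left₀ 2 (by positivity) ((htail N n hN1 hn t ht).trans_lt hN2)
    refine ⟨N, fun m hm n hn t ht => ?_⟩
    have := dist_triangle_right (G m t) (G n t) (G N t)
    linarith [key m hm t ht, key n hn t ht]
  have hex : ∀ t ∈ Icc 0 T, ∃ x, Tendsto (fun j => G j t) atTop (𝓝 x) := fun t ht =>
    cauchySeq_tendsto_of_complete (hcauchy.cauchySeq ht)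
  choose! w hw using hex
  have hwu : TendstoUniformlyOn G w atTop (Icc 0 T) :=
    hcauchy.tendstoUniformlyOn_of_tendsto fun t ht => hw t ht
  have hGcont : ∀ j, ContinuousOn (G j) (Icc 0 T) := by
    intro j
    have hamp : ∀ k, ContinuousOn (fun t => amplitude B a f k t ω) (Icc 0 T) := fun k =>
      ((continuous_propagatorSymbol k).comp hcont).continuousOn.mul
        (isPrimitive_profile (a := a) hB.predictable hfint T k ω).continuousOn
    exact continuousOn_finsetSum _ fun k _ => (hamp k).fun_smul continuousOn_const
  have hwcoeff : ∀ t ∈ Icc 0 T, ∀ k, coeff 2 k (w t) = amplitude B a f k t ω := by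
    intro t ht k
    have h1 := ((coeff 2 k).continuous.tendsto (w t)).comp (hw t ht)
    refine tendsto_nhds_unique h1 (tendsto_const_nhds.congr' ?_)
    filter_upwards [hns.tendsto_atTop.eventually (eventually_mem_window k)] with j hj
    simp only [Function.comp_apply, hG]
    rw [coeff_trig, if_pos hj]
  refine ⟨w, hwu.continuousOn (Eventually.of_forall hGcont).frequently, ?_, ?_, ?_⟩
  · filter_upwards [hcoeff, ae_restrict_mem measurableSet_Icc] with t h1 ht
    exact ae_eq_of_coeff_eq fun k => (h1 k).trans (hwcoeff t ht k).symm
  · refine eq_of_coeff_eq fun k => ?_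
    rw [hwcoeff 0 ⟨le_rfl, zero_le⟩ k, amplitude, profile_zero, hB.zero, propagatorSymbol_zero,
      one_mul]
    rfl
  · intro t ht
    -- The mass that an approximation gains is at most the forcing in `L^{4/3}` times the distance
    -- of the approximation to `u` in `L⁴`, and that distance tends to zero along this path.
    have hrate : Tendsto (fun j => ∫ s in Icc 0 t, (∑ k ∈ window (ns j), f k s ω *
        conj (amplitude B a f k s ω)).re ∂timeMeasure) atTop (𝓝 0) := by
      obtain ⟨M, hM⟩ := hF.bound
      have hFm : MemLp (fun s => force hp θ u s ω) (4 / 3) μ :=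
        ⟨(hF.stronglyMeasurable.comp_measurable
          (measurable_prodMk_right (y := ω))).aestronglyMeasurable,
          (hM ω).trans_lt ENNReal.coe_lt_top⟩
      have h0 : Tendsto (fun j => (eLpNorm (fun s => ‖force hp θ u s ω‖) (4 / 3) μ).toReal *
          (e j).toReal) atTop (𝓝 0) := by
        have h := (ENNReal.tendsto_toReal ENNReal.zero_ne_top).comp hlim
        have h2 := h.const_mul (eLpNorm (fun s => ‖force hp θ u s ω‖) (4 / 3) μ).toReal
        simpa [Function.comp_def] using h2
      refine squeeze_zero_norm' ?_ h0
      filter_upwards [eventually_ge_atTop i₀] with j hj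
      have hg : MemLp (fun t => approx B u₀ (force hp θ u) (ns j) (t, ω) - u t ω) 4 μ :=
        ⟨((hap _).sub hup).aestronglyMeasurable, (hi₀ j hj).trans_lt ENNReal.one_lt_top⟩
      have hintegrable : Integrable (fun s => ‖force hp θ u s ω‖ *
          ‖approx B u₀ (force hp θ u) (ns j) (s, ω) - u s ω‖) μ :=
        memLp_one_iff_integrable.1 (hg.norm.mul hFm.norm)
      calc ‖∫ s in Icc 0 t, (∑ k ∈ window (ns j), f k s ω *
            conj (amplitude B a f k s ω)).re ∂timeMeasure‖
          ≤ ∫ s in Icc 0 t, ‖force hp θ u s ω‖ *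
              ‖approx B u₀ (force hp θ u) (ns j) (s, ω) - u s ω‖ ∂timeMeasure := by
            refine norm_integral_le_of_norm_le (hintegrable.mono_measure
              (Measure.restrict_mono (Icc_subset_Icc_right ht.2) le_rfl))
              (ae_of_all _ fun s => abs_re_sum_le hp (ns j) s ω)
        _ ≤ ∫ s in Icc 0 T, ‖force hp θ u s ω‖ *
              ‖approx B u₀ (force hp θ u) (ns j) (s, ω) - u s ω‖ ∂timeMeasure :=
            setIntegral_mono_set hintegrable (ae_of_all _ fun s => by positivity)
              (Icc_subset_Icc_right ht.2).eventuallyLE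
        _ ≤ _ := by
            refine (integral_mul_le_of_memLp hFm.norm hg.norm).trans_eq ?_
            rw [he, eLpNorm_norm (fun t => approx B u₀ (force hp θ u) (ns j) (t, ω) - u t ω)]
    have hdata : Tendsto (fun j => ∑ k ∈ window (ns j), ‖a k ω‖ ^ 2) atTop
        (𝓝 ((2 * Real.pi)⁻¹ * ‖u₀ ω‖ ^ 2)) :=
      (hasSum_sq_coeff (u₀ ω)).comp (tendsto_window.comp hns.tendsto_atTop)
    have h1 : Tendsto (fun j => ‖G j t‖ ^ 2) atTop (𝓝 (‖u₀ ω‖ ^ 2)) := by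
      have h2 := (hdata.add (hrate.const_mul 2)).const_mul (2 * Real.pi)
      rw [mul_zero, add_zero, ← mul_assoc, mul_inv_cancel₀ Real.two_pi_pos.ne', one_mul] at h2
      refine h2.congr fun j => ?_
      simp only [hG]
      rw [norm_trig_two_sq, (sum_sq_amplitude hB.predictable hfint _ t ω).1]
    have h3 := ((hw t ht).norm.pow 2)
    have h4 := tendsto_nhds_unique h3 h1
    exact (pow_left_inj₀ (norm_nonneg _) (norm_nonneg _) two_ne_zero).1 h4

lemma ae_isContinuousConservative [IsProbabilityMeasure P] (hp : p ∈ Ioc 1 3)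
    (hB : IsDriver 𝓕 B P) (hcont : ∀ᵐ ω ∂P, Continuous fun t => B t ω)
    (hu₀ : StronglyMeasurable[𝓕 0] u₀) (hu₀' : MemLp u₀ 4 P)
    (hF : IsForcing 𝓕 T (force hp θ u)) (hu : IsLinearSolution 𝓕 P T B u₀ (force hp θ u) u) :
    ∀ᵐ ω ∂P, IsContinuousConservative T (u₀ ω) (fun t => u t ω) := by
  obtain ⟨ns, hns, hlim⟩ := exists_subseq_path_tendsto (P := P) (T := T)
    (g := fun n t ω => approx B u₀ (force hp θ u) n (t, ω) - u t ω)
    (fun n => (stronglyMeasurable_approx hB hu₀ hu₀' hF n).sub hu.stronglyMeasurable) hu.tendsto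
  have hc : ∀ᵐ ω ∂P, ∀ᵐ t ∂(timeMeasure.restrict (Icc 0 T)), ∀ k : ℤ, coeff 4 k (u t ω) =
      amplitude B (dataCoeff u₀) (forceCoeff (force hp θ u)) k t ω := by
    have h := (Measure.measurePreserving_swap (μ := P)
      (ν := timeMeasure.restrict (Icc 0 T))).quasiMeasurePreserving.ae
      (hu.coeff_eq hB hu₀ hu₀' hF)
    exact Measure.ae_ae_of_ae_prod h
  filter_upwards [hcont, hlim, hc] with ω h1 h2 h3
  exact isContinuousConservative_of_tendsto hp hB hu₀ hu₀' hF hu.predictable h1 hns h2 h3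

/-- If the running norm equals one at some time up to `T`, the full `L⁴` norm of the path is at
least one; Markov's inequality for its fourth power concludes. -/
lemma measure_hittingTime_lt_le [IsProbabilityMeasure P] (hu : IsStronglyPredictable 𝓕 u) :
    P {ω | hittingTime T u ω < T} ≤ eLpNorm (Function.uncurry u) 4 (timeProb T P) ^ 4 := by
  have hu' := StronglyMeasurable.mono hu (predictable_le_prod 𝓕)
  rw [← lintegral_eLpNorm_four_pow hu']
  have hm : Measurable fun ω => eLpNorm (fun t => u t ω) 4 (timeMeasure.restrict (Icc 0 T)) ^ 4 :=
    (measurable_eLpNorm_slice hu' (by norm_num) (by norm_num) _).pow_const 4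
  have h := mul_meas_ge_le_lintegral hm (μ := P) 1
  rw [one_mul] at h
  refine (measure_mono fun ω hω => ?_).trans h
  have hω' : hittingTime T u ω < T := hω
  simp only [hittingTime, iInf_lt_iff] at hω'
  obtain ⟨t, ⟨-, htT, hrun⟩, -⟩ := hω'
  change (1 : ℝ≥0∞) ≤ _ ^ 4
  refine one_le_pow₀ ?_
  rw [← hrun]
  exact eLpNorm_mono_measure _ (Measure.restrict_mono
    (fun r (hr : r < t) => (⟨zero_le, hr.le.trans htT⟩ : r ∈ Icc 0 T)) le_rfl)

end Conservation

/-- The last three conditions serve, in this order, the absorption in the linear estimate, the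
contraction and the hitting time. They involve only `L` and `R`, hence so does the time of
existence. -/
lemma exists_small_time (L R : ℝ≥0) : ∃ ε : ℝ, 0 < ε ∧ ε ≤ 1 ∧ strichartzConst * ε ≤ 1 / 2 ∧
    2 * strichartzConst * ε * (342 * L) ^ 4 ≤ (1 / 2) ^ 4 ∧
    2 * strichartzConst * ε * ((R : ℝ) ^ 4 + (180 * L) ^ 4) ≤ 1 / 2 := by
  have hK := strichartzConst_pos
  set K := strichartzConst
  set A : ℝ := (342 * L) ^ 4 with hA
  set C : ℝ := (R : ℝ) ^ 4 + (180 * L) ^ 4 with hC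
  have hA0 : 0 ≤ A := by positivity
  have hC0 : 0 ≤ C := by positivity
  have hD : 0 < 1 + 32 * K * (1 + A + C) := by positivity
  -- The factor `32` is set by the contraction condition: `32 K A ε ≤ 1` is the same as `2 K A ε ≤
  -- (1/2)⁴`.
  obtain ⟨ε, hε⟩ : ∃ ε : ℝ, ε = (1 + 32 * K * (1 + A + C))⁻¹ := ⟨_, rfl⟩
  have hε0 : 0 < ε := hε ▸ inv_pos.2 hD
  have h : ε * (1 + 32 * K * (1 + A + C)) = 1 := by rw [hε, inv_mul_cancel₀ hD.ne']
  have h1 : 0 ≤ ε * K := by positivity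
  have h2 : 0 ≤ ε * K * A := by positivity
  have h3 : 0 ≤ ε * K * C := by positivity
  exact ⟨ε, hε0, by nlinarith, by nlinarith, by nlinarith, by nlinarith⟩

end WND
end

/-! ### The proposition. -/

theorem proposition4p1 (p : ℝ) (hp₁ : 1 < p) (hp₃ : p ≤ 3) (θ : ℝ → ℝ) (hθ : WND.IsCutoff θ)
    (R : ℝ≥0) :
    ∃ T₀ : ℝ≥0, 0 < T₀ ∧
      ∀ (Ω : Type*) (mΩ : MeasurableSpace Ω) (P : Measure Ω) [IsProbabilityMeasure P]
        (𝓕 : Filtration ℝ≥0 mΩ) (W : ℝ≥0 → Ω → ℝ) (_hW : WND.IsBrownianFor 𝓕 W P)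
        (u₀ : Ω → WND.LTorus 2) (_hu₀ : StronglyMeasurable[𝓕 0] u₀) (_hu₀' : MemLp u₀ 4 P)
        (_hR : eLpNorm u₀ 4 P ≤ R) (T : ℝ≥0) (_hT : 0 < T) (_hT₀ : T ≤ T₀),
        ∃ u : ℝ≥0 → Ω → WND.LTorus 4,
          WND.IsTruncSolution 𝓕 P W p θ u₀ T u ∧
          (∀ v : ℝ≥0 → Ω → WND.LTorus 4, WND.IsTruncSolution 𝓕 P W p θ u₀ T v →
            Function.uncurry v =ᵐ[WND.timeProb T P] Function.uncurry u) ∧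
          (∀ᵐ ω ∂P, WND.IsContinuousConservative T (u₀ ω) (fun t => u t ω)) ∧
          P {ω | WND.hittingTime T u ω < T} ≤ 1 / 2 := by
  obtain ⟨L, hL⟩ := hθ.exists_lipschitzWith
  obtain ⟨ε, hε, hε1, hK, hc, hR⟩ := WND.exists_small_time L R
  have hp : p ∈ Set.Ioc 1 3 := ⟨hp₁, hp₃⟩
  -- The interpolated kernel gains `T^{1/4}`, so smallness `ε` requires `T ≤ ε⁴`.
  refine ⟨(ε ^ 4).toNNReal, Real.toNNReal_pos.2 (pow_pos hε 4), ?_⟩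
  intro Ω mΩ P _ 𝓕 W hW u₀ hu₀ hu₀' hu₀R T _ hT₀
  have hT : (T : ℝ) ≤ ε ^ 4 := (Real.le_toNNReal_iff_coe_le (by positivity)).1 hT₀
  have hT1 : T ≤ 1 := by
    have : (T : ℝ) ≤ 1 := hT.trans (pow_le_one₀ hε.le hε1)
    exact_mod_cast this
  obtain ⟨B, hB, hBW⟩ := hW.exists_driver
  have hcont : ∀ᵐ ω ∂P, Continuous fun t => B t ω := by
    filter_upwards [hW.isBrownian.cont, hBW] with ω h1 h2
    simpa only [h2] using h1
  obtain ⟨u, hu⟩ := WND.exists_isLinearSolution_force (T := T) hp hθ hL hB hu₀ hu₀' hε.le hε1 hT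
    hK hc
  have hF := WND.isForcing_force (T := T) hp hθ hL hu.predictable hT1
  refine ⟨u, hu.isTruncSolution hp hθ hL hT1 hB hBW hu₀ hu₀', fun v hv =>
    hu.eq_of_isTruncSolution hp hθ hL hB hBW hu₀ hu₀' hε.le hε1 hT hK hc hv,
    WND.ae_isContinuousConservative hp hB hcont hu₀ hu₀' hF hu, ?_⟩
  -- The truncated forcing is at most `180 L` along every path, whatever `u` is, so the linear
  -- estimate bounds the fourth moment of `u` directly.
  refine (WND.measure_hittingTime_lt_le hu.predictable).trans
    ((hu.eLpNorm_pow_le hB hu₀ hu₀' hF hε.le hε1 hT hK).trans ?_)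
  have hforce : ∫⁻ ω, eLpNorm (fun s => WND.force hp θ u s ω) (4 / 3)
      (WND.timeMeasure.restrict (Set.Icc 0 T)) ^ 4 ∂P ≤ ENNReal.ofReal (180 * L) ^ 4 := by
    refine (lintegral_mono fun ω => pow_le_pow_left'
      (WND.eLpNorm_force_le hp hθ hL hu.predictable hT1 ω) 4).trans ?_
    simp
  have hK0 := WND.strichartzConst_pos
  calc _ ≤ ENNReal.ofReal (2 * WND.strichartzConst * ε) *
        ((R : ℝ≥0∞) ^ 4 + ENNReal.ofReal (180 * L) ^ 4) := by gcongr
    _ = ENNReal.ofReal (2 * WND.strichartzConst * ε * ((R : ℝ) ^ 4 + (180 * L) ^ 4)) := by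
      rw [ENNReal.ofReal_mul (p := 2 * WND.strichartzConst * ε) (by positivity),
        ENNReal.ofReal_add (by positivity) (by positivity), ENNReal.ofReal_pow (by positivity),
        ENNReal.ofReal_pow (by positivity), ENNReal.ofReal_coe_nnreal]
    _ ≤ ENNReal.ofReal (1 / 2) := ENNReal.ofReal_le_ofReal hR
    _ = 1 / 2 := by
      rw [ENNReal.ofReal_div_of_pos two_pos, ENNReal.ofReal_one, ENNReal.ofReal_ofNat]
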